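/- **Setting.** An instance consists of a convex polygon $P\subset\mathbb R^2$, given by its $m\ge 3$ vertices (strictly convex, in counterclockwise order), and of $n\ge 1$ closed line segments (possibly single points) none of which meets the interior of $P$. All coordinates are rational, with numerators and denominators of at most $b$ bits. A set $Q\subseteq\mathbb R^2$ is *separating* if $P\subseteq Q$ and no segment meets the interior of $Q$. The *minimum number of cuts* of the instance is the least $k$ for which some intersection of $k$ closed half-planes is separating (the intersection is allowed to be unbounded). The instance is *surrounded* if for every direction $d\ne0$ some ray with direction $d$ that starts in the interior of $P$ meets a segment. For $a,b\in S^1$ let $[a,b)$ be the half-open counterclockwise arc, where $[a,a)=S^1$. A map $g:S^1\to S^1$ is the *next-generator* of a family $\mathcal I$ of arcs if for every $t\in S^1$, among the arcs $[a,b)\in\mathcal I$ that contain $t$, there is one with end point $b=g(t)$, and none of them extends farther counterclockwise from $t$. *AnalyticArcCover* for $g$ asks for the least integer $k$ such that some $x\in S^1$ satisfies $[x,g(x))\cup[g(x),g^{(2)}(x))\cup\dots\cup[g^{(k-1)}(x),g^{(k)}(x))=S^1$. A point of $S^1$ is represented by any nonzero vector on the ray through it. A *linear rational function* is a map $x\mapsto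 Ax/Cx$ with $A,C\in\mathbb Z^{2\times2}$ and coordinatewise division. A map $S^1\to S^1$ is *piecewise linear rational* if $S^1$ can be divided into finitely many arcs and points, on each of which the map is given, in this representation, by a linear rational function with nonvanishing denominators and nonzero values. The boundary points are represented by vectors whose coordinates are of the form $\alpha+\beta\sqrt\gamma$ with rational $\alpha,\beta,\gamma$, $\gamma\ge0$. For $u\in S^1$ let $H_u=\{x:\langle u,x\rangle\ge\max_{p\in P}\langle u,p\rangle\}$ be the cut with normal $u$. Let $\mathcal I$ be the family of all arcs $[u,v)$ such that every point of a segment that lies in $H_w$ for some $w\in[u,v)$ lies in $H_u\cup H_v$. **Theorem.** There are an algorithm and a polynomial $p$ such that, for every instance as above, the algorithm computes, in time at most $p(m+n+b)$, a description of a piecewise linear rational map $g:S^1\to S^1$ with at most $p(m+n+b)$ pieces, in which each linear rational function (that is, each of its coefficients) and each boundary point (that is, the numerators and denominators of its $\alpha$'s, $\beta$'s and $\gamma$'s) has at most $p(m+n+b)$ bits, and such that: 1. $g$ is the next-generator of $\mathcal I$; 2. the minimum number of cuts of the instance exists and equals the solution $k$ of AnalyticArcCover for $g$; 3. whenever the arcs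 $[g^{(i)}(x),g^{(i+1)}(x))$, $0\le i<j$, cover $S^1$, the set $\bigcap_{i<j}\{y:\langle u_i,y\rangle\le\max_{p\in P}\langle u_i,p\rangle\}$ with $u_i=g^{(i)}(x)$ is separating; 4. if the instance is surrounded, then $k$ is also the least number of vertices of a separating convex polygon (bounded, not necessarily with sides touching $P$). -/

import Mathlib

/-! ## A machine model with a step count

Programs are structured `while` programs. Registers hold finite binary trees whose leaves are
integers. Every evaluation of a (sub)expression costs the bit size of its value, so that the cost
is, up to a polynomial, the running time of a Turing machine. -/

/-- The number of bits of an integer (without sign). -/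
def intBits (z : ℤ) : ℕ := z.natAbs.size

/-- Data of the machine: binary trees with integer leaves. -/
inductive Data where
  | int (z : ℤ) : Data
  | pair (x y : Data) : Data

namespace Data

/-- The bit size of a datum. -/
def size : Data → ℕ
  | int z => intBits z + 1
  | pair x y => x.size + y.size + 1

def toInt : Data → ℤ
  | int z => z
  | pair _ _ => 0

def fst : Data → Data
  | int _ => int 0
  | pair x _ => x

def snd : Data → Data
  | int _ => int 0
  | pair _ y => y

/-- The test whether a datum is a pair (1) or an integer (0). -/
def isPair : Data → Data
  | int _ => int 0
  | pair _ _ => int 1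

/-- Lists as right-nested pairs, ended by the integer 0. -/
def ofList : List Data → Data
  | [] => int 0
  | x :: l => pair x (ofList l)

end Data

/-- A store assigns a datum to every register. -/
abbrev Store := ℕ → Data

/-- Expressions of the machine. -/
inductive Expr where
  | var (i : ℕ) : Expr
  | const (z : ℤ) : Expr
  | pair (e f : Expr) : Expr
  | fst (e : Expr) : Expr
  | snd (e : Expr) : Expr
  | isPair (e : Expr) : Expr
  | add (e f : Expr) : Expr
  | sub (e f : Expr) : Expr
  | mul (e f : Expr) : Expr
  | div (e f : Expr) : Expr
  | lt (e f : Expr) : Expr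

namespace Expr

/-- The value of an expression. -/
def eval (σ : Store) : Expr → Data
  | var i => σ i
  | const z => Data.int z
  | pair e f => Data.pair (eval σ e) (eval σ f)
  | fst e => (eval σ e).fst
  | snd e => (eval σ e).snd
  | isPair e => (eval σ e).isPair
  | add e f => Data.int ((eval σ e).toInt + (eval σ f).toInt)
  | sub e f => Data.int ((eval σ e).toInt - (eval σ f).toInt)
  | mul e f => Data.int ((eval σ e).toInt * (eval σ f).toInt)
  | div e f => Data.int ((eval σ e).toInt / (eval σ f).toInt)
  | lt e f => if (eval σ e).toInt < (eval σ f).toInt then Data.int 1 else Data.int 0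

/-- The cost of evaluating an expression: the sum of the bit sizes of the values of all of its
subexpressions. -/
def cost (σ : Store) : Expr → ℕ
  | var i => (eval σ (var i)).size
  | const z => (eval σ (const z)).size
  | pair e f => cost σ e + cost σ f + (eval σ (pair e f)).size
  | fst e => cost σ e + (eval σ (fst e)).size
  | snd e => cost σ e + (eval σ (snd e)).size
  | isPair e => cost σ e + (eval σ (isPair e)).size
  | add e f => cost σ e + cost σ f + (eval σ (add e f)).size
  | sub e f => cost σ e + cost σ f + (eval σ (sub e f)).size
  | mul e f => cost σ e + cost σ f + (eval σ (mul e f)).size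
  | div e f => cost σ e + cost σ f + (eval σ (div e f)).size
  | lt e f => cost σ e + cost σ f + (eval σ (lt e f)).size

end Expr

/-- Programs of the machine. A condition is true if its value is a nonzero integer. -/
inductive Prog where
  | skip : Prog
  | assign (i : ℕ) (e : Expr) : Prog
  | seq (c d : Prog) : Prog
  | branch (e : Expr) (c d : Prog) : Prog
  | loop (e : Expr) (c : Prog) : Prog

/-- `Runs c σ τ t`: started in the store `σ`, the program `c` halts in the store `τ` after `t`
steps. -/
inductive Runs : Prog → Store → Store → ℕ → Prop where
  | skip (σ : Store) : Runs Prog.skip σ σ 1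
  | assign (σ : Store) (i : ℕ) (e : Expr) :
      Runs (Prog.assign i e) σ (Function.update σ i (e.eval σ)) (e.cost σ + 1)
  | seq (c d : Prog) (σ τ ρ : Store) (s t : ℕ) :
      Runs c σ τ s → Runs d τ ρ t → Runs (Prog.seq c d) σ ρ (s + t + 1)
  | branch_true (e : Expr) (c d : Prog) (σ τ : Store) (t : ℕ) :
      (e.eval σ).toInt ≠ 0 → Runs c σ τ t → Runs (Prog.branch e c d) σ τ (e.cost σ + t + 1)
  | branch_false (e : Expr) (c d : Prog) (σ τ : Store) (t : ℕ) :
      (e.eval σ).toInt = 0 → Runs d σ τ t → Runs (Prog.branch e c d) σ τ (e.cost σ + t + 1)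
  | loop_true (e : Expr) (c : Prog) (σ τ ρ : Store) (s t : ℕ) :
      (e.eval σ).toInt ≠ 0 → Runs c σ τ s → Runs (Prog.loop e c) τ ρ t →
        Runs (Prog.loop e c) σ ρ (e.cost σ + s + t + 1)
  | loop_false (e : Expr) (c : Prog) (σ : Store) :
      (e.eval σ).toInt = 0 → Runs (Prog.loop e c) σ σ (e.cost σ + 1)

/-- On the given input (in register 0, all other registers being 0) the program halts after at
most `T` steps with the given output in register 0. -/
def Prog.OutputsWithin (c : Prog) (input output : Data) (T : ℕ) : Prop :=
  ∃ (τ : Store) (t : ℕ),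
    Runs c (Function.update (fun _ => Data.int 0) 0 input) τ t ∧ τ 0 = output ∧ t ≤ T

/-! ## Arcs of the unit circle and the arc cover problem -/

/-- The counterclockwise angle from `a` to `x`, in `[0, 2π)`. -/
noncomputable def ccwAngle (a x : Circle) : ℝ :=
  toIcoMod Real.two_pi_pos 0 (Complex.arg ((x / a : Circle) : ℂ))

/-- The length of the counterclockwise arc from `a` to `b`, in `(0, 2π]`: the arc from a point to
itself is a full turn. -/
noncomputable def turn (a b : Circle) : ℝ :=
  toIocMod Real.two_pi_pos 0 (Complex.arg ((b / a : Circle) : ℂ))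

/-- The half-open counterclockwise arc `[a, b)`; `[a, a)` is the whole circle. -/
def arc (a b : Circle) : Set Circle := {x | ccwAngle a x < turn a b}

/-- The open counterclockwise arc `(a, b)`; `(a, a)` is the circle without `a`. -/
def openArc (a b : Circle) : Set Circle := {x | 0 < ccwAngle a x ∧ ccwAngle a x < turn a b}

/-- `g` is the next-generator of a family of arcs `[a, b)` (given as pairs `(a, b)`): for every
`t`, among all arcs of the family that contain `t`, some arc reaches counterclockwise from `t`
exactly to `g t`, and none reaches farther. -/
def IsNextGenerator (𝓘 : Set (Circle × Circle)) (g : Circle → Circle) : Prop :=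
  ∀ t, (∃ a, (a, g t) ∈ 𝓘 ∧ t ∈ arc a (g t)) ∧
    ∀ a b, (a, b) ∈ 𝓘 → t ∈ arc a b → turn t b ≤ turn t (g t)

/-- `[x, g x) ∪ [g x, g (g x)) ∪ ⋯` (with `k` arcs) is the whole circle. -/
def OrbitCovers (g : Circle → Circle) (k : ℕ) (x : Circle) : Prop :=
  (⋃ i ∈ Finset.range k, arc (g^[i] x) (g^[i + 1] x)) = Set.univ

/-- `k` is the solution of the analytic arc cover problem for the next-generator `g`. -/
def IsArcCoverOptimum (g : Circle → Circle) (k : ℕ) : Prop :=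
  IsLeast {k : ℕ | ∃ x, OrbitCovers g k x} k

/-! ## Piecewise linear rational functions in the ray representation -/

/-- The plane; only its linear structure, topology and bounded sets are used. -/
abbrev Plane := Fin 2 → ℝ

/-- The point of the unit circle on the ray from the origin through `x ≠ 0`. -/
noncomputable def rayPoint (x : Plane) : Circle := Circle.exp (Complex.arg ⟨x 0, x 1⟩)

/-- A point of the unit circle as a vector. -/
def circleVec (u : Circle) : Plane := ![(u : ℂ).re, (u : ℂ).im]

def ratBits (q : ℚ) : ℕ := max (intBits q.num) (intBits q.den)

/-- A first order radical number `a + b √c` with rational `a`, `b`, `c`. -/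
structure Radical where
  a : ℚ
  b : ℚ
  c : ℚ

namespace Radical

noncomputable def val (r : Radical) : ℝ := r.a + r.b * Real.sqrt r.c

def bits (r : Radical) : ℕ := max (ratBits r.a) (max (ratBits r.b) (ratBits r.c))

end Radical

/-- A point of the plane with radical coordinates, which stands for the ray through it. -/
structure RadicalRay where
  x : Radical
  y : Radical

namespace RadicalRay

noncomputable def val (r : RadicalRay) : Plane := ![r.x.val, r.y.val]

def Valid (r : RadicalRay) : Prop := 0 ≤ r.x.c ∧ 0 ≤ r.y.c ∧ r.val ≠ 0

def bits (r : RadicalRay) : ℕ := max r.x.bits r.y.bits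

end RadicalRay

/-- A two-dimensional linear rational function `x ↦ A x / C x` without constant terms, with
integer coefficients and pointwise division. -/
structure LinRat where
  A : Matrix (Fin 2) (Fin 2) ℤ
  C : Matrix (Fin 2) (Fin 2) ℤ

namespace LinRat

def numer (f : LinRat) (x : Plane) : Plane := (f.A.map (Int.cast : ℤ → ℝ)).mulVec x

def denom (f : LinRat) (x : Plane) : Plane := (f.C.map (Int.cast : ℤ → ℝ)).mulVec x

noncomputable def eval (f : LinRat) (x : Plane) : Plane := fun i => f.numer x i / f.denom x i

def BitsAtMost (f : LinRat) (B : ℕ) : Prop :=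
  ∀ i j, intBits (f.A i j) ≤ B ∧ intBits (f.C i j) ≤ B

/-- At the vector `x`, the function is well defined and represents the value of `g`. -/
def AgreesAt (f : LinRat) (g : Circle → Circle) (x : Plane) : Prop :=
  (∀ i, f.denom x i ≠ 0) ∧ f.eval x ≠ 0 ∧ rayPoint (f.eval x) = g (rayPoint x)

end LinRat

/-- A description of a piecewise linear rational function: `N + 1` boundary points, for each of
them a linear rational function that gives the value there (so that pieces may contain or omit
their end points), and one for the open arc from it to the (cyclically) next boundary point. -/
structure PiecewiseLinRat where
  N : ℕ
  boundary : Fin (N + 1) → RadicalRay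
  atPoint : Fin (N + 1) → LinRat
  onArc : Fin (N + 1) → LinRat

namespace PiecewiseLinRat

/-- The boundary points are in strict counterclockwise order, starting from the positive
`x`-axis. -/
def Valid (G : PiecewiseLinRat) : Prop :=
  (∀ i, (G.boundary i).Valid) ∧ StrictMono fun i => ccwAngle 1 (rayPoint (G.boundary i).val)

/-- `G` describes the function `g` on the unit circle, in the ray representation. -/
def Represents (G : PiecewiseLinRat) (g : Circle → Circle) : Prop :=
  G.Valid ∧ ∀ (i : Fin (G.N + 1)) (x : Plane), x ≠ 0 →
    (rayPoint x = rayPoint (G.boundary i).val → (G.atPoint i).AgreesAt g x) ∧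
    (rayPoint x ∈ openArc (rayPoint (G.boundary i).val) (rayPoint (G.boundary (i + 1)).val) →
      (G.onArc i).AgreesAt g x)

/-- The number of pieces: the boundary points and the open arcs between them. -/
def pieces (G : PiecewiseLinRat) : ℕ := 2 * (G.N + 1)

end PiecewiseLinRat

/-! ## The separation problem -/

/-- A rational point as a point of the plane. -/
def ratPoint (q : ℚ × ℚ) : Plane := ![(q.1 : ℝ), (q.2 : ℝ)]

/-- `m` vertices of the inner polygon and the end points of `n` outer segments. -/
structure SepInstance (m n : ℕ) where
  vertex : Fin m → ℚ × ℚ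
  seg : Fin n → (ℚ × ℚ) × (ℚ × ℚ)

namespace SepInstance

variable {m n : ℕ}

/-- The inner polygon. -/
def inner (I : SepInstance m n) : Set Plane :=
  convexHull ℝ (Set.range fun i => ratPoint (I.vertex i))

/-- The `i`-th outer segment (possibly a single point). -/
def segmentSet (I : SepInstance m n) (i : Fin n) : Set Plane :=
  segment ℝ (ratPoint (I.seg i).1) (ratPoint (I.seg i).2)

/-- All points of the outer segments. -/
def outer (I : SepInstance m n) : Set Plane := ⋃ i, I.segmentSet i

/-- The vertices are those of a convex polygon, in counterclockwise order; there is at least one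
segment, and no segment meets the interior of the polygon. -/
def Valid (I : SepInstance m n) : Prop :=
  3 ≤ m ∧ 1 ≤ n ∧
  (∀ i j k, i < j → j < k →
    0 < ((I.vertex j).1 - (I.vertex i).1) * ((I.vertex k).2 - (I.vertex i).2)
      - ((I.vertex j).2 - (I.vertex i).2) * ((I.vertex k).1 - (I.vertex i).1)) ∧
  ∀ i, Disjoint (interior I.inner) (I.segmentSet i)

/-- Every coordinate has at most `b` bits. -/
def BitsAtMost (I : SepInstance m n) (b : ℕ) : Prop :=
  (∀ i, ratBits (I.vertex i).1 ≤ b ∧ ratBits (I.vertex i).2 ≤ b) ∧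
  ∀ i, ratBits (I.seg i).1.1 ≤ b ∧ ratBits (I.seg i).1.2 ≤ b ∧
    ratBits (I.seg i).2.1 ≤ b ∧ ratBits (I.seg i).2.2 ≤ b

/-- The set `Q` separates the inner polygon from the outer segments: it contains the polygon, and
the segments do not enter its interior. -/
def Separates (I : SepInstance m n) (Q : Set Plane) : Prop :=
  I.inner ⊆ Q ∧ ∀ i, Disjoint (interior Q) (I.segmentSet i)

/-- `k` is the least number of line cuts, that is, of closed half-planes whose intersection
separates the inner polygon from the outer segments. -/
def IsMinCuts (I : SepInstance m n) (k : ℕ) : Prop :=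
  IsLeast {k : ℕ | ∃ (a : Fin k → Plane) (c : Fin k → ℝ),
    (∀ j, a j ≠ 0) ∧ I.Separates {x | ∀ j, dotProduct (a j) x ≤ c j}} k

/-- `k` is the least number of vertices of a separating convex polygon. -/
def IsMinVertices (I : SepInstance m n) (k : ℕ) : Prop :=
  IsLeast {k : ℕ | ∃ v : Fin k → Plane, I.Separates (convexHull ℝ (Set.range v))} k

/-- In every direction, some ray that starts in the interior of the inner polygon meets an outer
segment. -/
def Surrounded (I : SepInstance m n) : Prop :=
  ∀ d : Plane, d ≠ 0 → ∃ p ∈ interior I.inner, ∃ t : ℝ, 0 ≤ t ∧ p + t • d ∈ I.outer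

/-- The cut with normal `u`: the closed half-plane that touches the inner polygon and lies on the
side of `u`, away from it. -/
def cut (I : SepInstance m n) (u : Circle) : Set Plane :=
  {x | ∀ p ∈ I.inner, dotProduct (circleVec u) p ≤ dotProduct (circleVec u) x}

/-- The closed half-plane complementary to the cut with normal `u`; it contains the polygon. -/
def keep (I : SepInstance m n) (u : Circle) : Set Plane :=
  {x | ∃ p ∈ I.inner, dotProduct (circleVec u) x ≤ dotProduct (circleVec u) p}

/-- The arcs `[u, v)` such that `v` can follow `u` in a counterclockwise sequence of cuts: every
segment point that the cut meets while its normal sweeps counterclockwise from `u` to `v` is in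
the cut of `u` or in the cut of `v`. -/
def sweepArcs (I : SepInstance m n) : Set (Circle × Circle) :=
  {uv | ∀ z ∈ I.outer, (∃ w ∈ arc uv.1 uv.2, z ∈ I.cut w) → z ∈ I.cut uv.1 ∨ z ∈ I.cut uv.2}

end SepInstance

/-! ## Encodings for the machine -/

def ratData (q : ℚ) : Data := Data.pair (Data.int q.num) (Data.int q.den)

def pointData (q : ℚ × ℚ) : Data := Data.pair (ratData q.1) (ratData q.2)

/-- The list of vertices, followed by the list of segments. -/
def SepInstance.toData {m n : ℕ} (I : SepInstance m n) : Data :=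
  Data.pair (Data.ofList (List.ofFn fun i => pointData (I.vertex i)))
    (Data.ofList (List.ofFn fun i => Data.pair (pointData (I.seg i).1) (pointData (I.seg i).2)))

def Radical.toData (r : Radical) : Data :=
  Data.pair (ratData r.a) (Data.pair (ratData r.b) (ratData r.c))

def RadicalRay.toData (r : RadicalRay) : Data := Data.pair r.x.toData r.y.toData

def matrixData (M : Matrix (Fin 2) (Fin 2) ℤ) : Data :=
  Data.pair (Data.pair (Data.int (M 0 0)) (Data.int (M 0 1)))
    (Data.pair (Data.int (M 1 0)) (Data.int (M 1 1)))

def LinRat.toData (f : LinRat) : Data := Data.pair (matrixData f.A) (matrixData f.C)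

/-- The list of boundary points, each with its two linear rational functions. -/
def PiecewiseLinRat.toData (G : PiecewiseLinRat) : Data :=
  Data.ofList (List.ofFn fun i =>
    Data.pair (G.boundary i).toData (Data.pair (G.atPoint i).toData (G.onArc i).toData))

/-!
Every point `z` of a segment determines the set of normals of the cuts that contain it, which is a
closed arc of the circle shorter than a half-turn (`inCut_between`). From a cut with normal `x`, the
next-generator turns counterclockwise as far as possible without leaving out a point of a segment.
The turn has to stop at the last normal of a cut containing some point outside of the current cut,
and it is the key observation that finitely many points matter: the end points of the segments
and the points where the boundary line of the current cut crosses a segment. For an end point, the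
last normal is constant. For a crossing point, it is linear in `x`, as the crossing point is a
quotient of linear functions of `x`, and scaling does not change the ray. Hence the next normal is
the one with the smallest turn among polynomially many candidates `IsCand`, each of which is linear
in `x` and restricted to those `x` where certain quadratic forms have prescribed signs. This is the
content of `turn_le_of_isCand` (no feasible turn passes a candidate) and `follows_of_le_turn` (a
turn that passes no candidate is feasible).

In each quadrant, `x` is a positive multiple of `e₀ + τ e₁` with `τ ≥ 0`, so that the quadratic
forms become quadratic polynomials in `τ`. Between consecutive roots of all these polynomials and
of those that compare two candidates, the same candidate is the best one. The roots are of the form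
`(n + s √D) / d`, and comparing two of them, as well as finding the sign of a quadratic polynomial
at a root, or immediately to its right, needs only integer arithmetic (`isSign_radSign₂`,
`isSign_signAtRoot`, `isSign_signAt_right`). The algorithm multiplies with a common denominator,
lists all candidates and all roots, and selects a candidate for every root and every gap. Its
running time and the size of its output are bounded by composing functions that are computable in
polynomial time (`PT`), so that the bounds on the coefficients need no separate estimate.

For the correspondence of covers, angles are lifted to the real line. An orbit of the next-generator
proceeds at least as fast as any cyclic sequence of cuts that contain all segment points
(`le_orbitAngle_of_cuts`), and the cuts of an orbit that goes around contain all segment points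
(`exists_inCut_orbitAngle`). Conversely, every separating half-plane may be moved until it touches the
polygon. If the instance is surrounded, then consecutive normals of a separating orbit differ by
less than a half-turn, and the intersection points of the consecutive tangents span a separating
polygon (`exists_polygon`). In the other direction, the half-planes to the left of the edges that
leave the vertices of a separating polygon separate as well (`cutsSuffice_of_polygon`).
-/

/-! ### A calculus of functions computable in polynomial time -/

/-- A type whose elements are represented by data of the machine. -/
class Enc (α : Type) where
  /-- The datum that represents an element. -/
  enc : α → Data

instance : Enc ℤ := ⟨Data.int⟩

instance : Enc Bool := ⟨fun b => Data.int (if b then 1 else 0)⟩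

instance {α β : Type} [Enc α] [Enc β] : Enc (α × β) := ⟨fun p => Data.pair (Enc.enc p.1) (Enc.enc p.2)⟩

instance {α : Type} [Enc α] : Enc (List α) := ⟨fun l => Data.ofList (l.map Enc.enc)⟩

/-- The bit size of the datum that represents `a`. -/
def esize {α : Type} [Enc α] (a : α) : ℕ := (Enc.enc a).size

section Sizes

variable {α β : Type} [Enc α] [Enc β]

theorem esize_pair (a : α) (b : β) : esize (a, b) = esize a + esize b + 1 := rfl

theorem esize_nil : esize ([] : List α) = 1 := rfl

theorem esize_cons (a : α) (l : List α) : esize (a :: l) = esize a + esize l + 1 := rfl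

theorem Data.size_pos (d : Data) : 1 ≤ d.size := by
  cases d <;> simp [Data.size]

theorem esize_pos (a : α) : 1 ≤ esize a := Data.size_pos _

theorem esize_bool_le (b : Bool) : esize b ≤ 2 := by
  cases b <;> simp [esize, Enc.enc, Data.size, intBits]

theorem esize_append (l l' : List α) : esize (l ++ l') + 1 = esize l + esize l' := by
  induction l with
  | nil => simp [esize_nil]; ring
  | cons a l ih => simp only [List.cons_append, esize_cons]; omega

theorem esize_reverse (l : List α) : esize l.reverse = esize l := by
  induction l with
  | nil => rfl
  | cons a l ih =>
    have := esize_append l.reverse [a]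
    simp only [List.reverse_cons, esize_cons, esize_nil] at *
    omega

theorem length_le_esize (l : List α) : l.length ≤ esize l := by
  induction l with
  | nil => simp
  | cons a l ih => simp only [List.length_cons, esize_cons]; omega

theorem esize_mem_le {a : α} {l : List α} (h : a ∈ l) : esize a ≤ esize l := by
  induction l with
  | nil => simp at h
  | cons b l ih =>
    rcases List.mem_cons.1 h with rfl | h
    · simp only [esize_cons]; omega
    · have := ih h; simp only [esize_cons]; omega

theorem esize_list_le (l : List α) (B : ℕ) (h : ∀ a ∈ l, esize a ≤ B) :
    esize l ≤ (B + 1) * l.length + 1 := by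
  induction l with
  | nil => simp [esize_nil]
  | cons b l ih =>
    have h1 := ih fun a ha => h a (List.mem_cons_of_mem _ ha)
    have h2 := h b List.mem_cons_self
    simp only [esize_cons, List.length_cons]
    nlinarith

theorem esize_prefix_le {l l' : List α} (h : l <+: l') : esize l ≤ esize l' := by
  obtain ⟨r, rfl⟩ := h
  have := esize_append l r
  have := esize_pos r
  omega

theorem intBits_add_le (x y : ℤ) : intBits (x + y) ≤ intBits x + intBits y + 1 := by
  unfold intBits
  rw [Nat.size_le]
  have h1 := Nat.lt_size_self x.natAbs
  have h2 := Nat.lt_size_self y.natAbs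
  have h3 := Int.natAbs_add_le x y
  have h4 : 2 ^ x.natAbs.size ≤ 2 ^ (x.natAbs.size + y.natAbs.size) :=
    Nat.pow_le_pow_right (by norm_num) (by omega)
  have h5 : 2 ^ y.natAbs.size ≤ 2 ^ (x.natAbs.size + y.natAbs.size) :=
    Nat.pow_le_pow_right (by norm_num) (by omega)
  rw [pow_succ]
  omega

theorem intBits_neg (x : ℤ) : intBits (-x) = intBits x := by simp [intBits]

theorem intBits_mul_le (x y : ℤ) : intBits (x * y) ≤ intBits x + intBits y := by
  unfold intBits
  rw [Nat.size_le, Int.natAbs_mul, pow_add]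
  exact Nat.mul_lt_mul'' (Nat.lt_size_self _) (Nat.lt_size_self _)

theorem intBits_div_le (x y : ℤ) : intBits (x / y) ≤ intBits x := by
  unfold intBits
  exact Nat.size_le_size (Int.natAbs_ediv_le_natAbs x y)

theorem esize_int (x : ℤ) : esize x = intBits x + 1 := rfl

end Sizes

theorem Expr.size_eval_le_cost (σ : Store) (e : Expr) : (e.eval σ).size ≤ e.cost σ := by
  cases e <;> simp only [Expr.cost] <;> omega

theorem Polynomial.eval_nat_mono (p : Polynomial ℕ) : Monotone fun n => p.eval n := by
  intro m n h
  simp only [Polynomial.eval_eq_sum, Polynomial.sum]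
  gcongr

/-- The programs `c k` compute `f` within time `p`: the argument is read from register `k` and the
value is written there, registers above `k` are used as scratch space whatever they hold, and
registers below `k` are left alone. -/
def Computes {α β : Type} [Enc α] [Enc β] (c : ℕ → Prog) (f : α → β) (p : Polynomial ℕ) : Prop :=
  ∀ (k : ℕ) (σ : Store) (a : α), σ k = Enc.enc a →
    ∃ (τ : Store) (t : ℕ), Runs (c k) σ τ t ∧ τ k = Enc.enc (f a) ∧ (∀ j < k, τ j = σ j) ∧
      t ≤ p.eval (esize a)

/-- The function `f` is computable in polynomial time. The bound on the size of the values is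
part of the definition so that it composes along with the time bound. -/
@[fun_prop]
def PT {α β : Type} [Enc α] [Enc β] (f : α → β) : Prop :=
  ∃ (c : ℕ → Prog) (p : Polynomial ℕ), Computes c f p ∧ ∀ a, esize (f a) ≤ p.eval (esize a)

theorem foldl_cons {α : Type} (l l' : List α) : l.foldl (fun r x => x :: r) l' = l.reverse ++ l' := by
  induction l generalizing l' with
  | nil => rfl
  | cons a l ih => simp [ih]

theorem foldl_cons_map {α β : Type} (f : α → β) (l : List α) (l' : List β) :
    l.foldl (fun r x => f x :: r) l' = (l.map f).reverse ++ l' := by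
  induction l generalizing l' with
  | nil => rfl
  | cons a l ih => simp [ih]

theorem foldl_append {α : Type} (L : List (List α)) (l : List α) :
    L.foldl (fun r x => r ++ x) l = l ++ L.flatten := by
  induction L generalizing l with
  | nil => simp
  | cons a L ih => simp [ih]

section Framework

variable {α β γ δ : Type} [Enc α] [Enc β] [Enc γ] [Enc δ]

/-- A function that is given by a single expression of the machine. The output needs no bound of
its own, as the cost of an expression is at least the size of its value. -/
theorem PT.of_expr {f : α → β} (E : ℕ → Expr) (p : Polynomial ℕ)
    (h : ∀ k σ a, σ k = Enc.enc a →
      (E k).eval σ = Enc.enc (f a) ∧ (E k).cost σ ≤ p.eval (esize a)) : PT f := by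
  refine ⟨fun k => Prog.assign k (E k), p + 1, ?_, ?_⟩
  · intro k σ a ha
    obtain ⟨h1, h2⟩ := h k σ a ha
    refine ⟨_, _, Runs.assign σ k (E k), ?_, ?_, ?_⟩
    · simp [h1]
    · intro j hj
      simp [hj.ne]
    · simpa using h2
  · intro a
    obtain ⟨h1, h2⟩ := h 0 (fun _ => Enc.enc a) a rfl
    have := Expr.size_eval_le_cost (fun _ => Enc.enc a) (E 0)
    rw [h1] at this
    simp only [Polynomial.eval_add, Polynomial.eval_one, esize] at *
    omega

/-- The expression that builds a given datum. -/
def Data.toExpr : Data → Expr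
  | Data.int z => Expr.const z
  | Data.pair x y => Expr.pair x.toExpr y.toExpr

theorem Data.eval_toExpr (σ : Store) (d : Data) : d.toExpr.eval σ = d := by
  induction d with
  | int z => rfl
  | pair x y hx hy => simp [Data.toExpr, Expr.eval, hx, hy]

theorem Data.cost_toExpr (σ τ : Store) (d : Data) : d.toExpr.cost σ = d.toExpr.cost τ := by
  induction d with
  | int z => rfl
  | pair x y hx hy => simp [Data.toExpr, Expr.cost, Expr.eval, hx, hy, Data.eval_toExpr]

@[fun_prop]
theorem PT.const (b : β) : PT fun _ : α => b := by
  refine PT.of_expr (fun _ => (Enc.enc b).toExpr)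
    (Polynomial.C ((Enc.enc b).toExpr.cost fun _ => Data.int 0)) ?_
  intro k σ a _
  exact ⟨Data.eval_toExpr _ _, by simp [Data.cost_toExpr σ fun _ => Data.int 0]⟩

@[fun_prop]
theorem PT.id : PT fun a : α => a := by
  refine PT.of_expr (fun k => Expr.var k) Polynomial.X ?_
  intro k σ a h
  simp [Expr.eval, Expr.cost, h, esize]

@[fun_prop]
theorem PT.comp {g : β → γ} {f : α → β} (hg : PT g) (hf : PT f) : PT fun a => g (f a) := by
  obtain ⟨c, p, hc, hp⟩ := hf
  obtain ⟨d, q, hd, hq⟩ := hg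
  refine ⟨fun k => Prog.seq (c k) (d k), p + q.comp p + 1, ?_, ?_⟩
  · intro k σ a ha
    obtain ⟨τ, s, h1, h2, h3, h4⟩ := hc k σ a ha
    obtain ⟨ρ, t, h5, h6, h7, h8⟩ := hd k τ (f a) h2
    refine ⟨ρ, _, Runs.seq _ _ _ _ _ _ _ h1 h5, h6, fun j hj => (h7 j hj).trans (h3 j hj), ?_⟩
    have := q.eval_nat_mono (hp a)
    simp only [Polynomial.eval_add, Polynomial.eval_comp, Polynomial.eval_one] at *
    omega
  · intro a
    have h1 := q.eval_nat_mono (hp a)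
    have h2 := hq (f a)
    simp only [Polynomial.eval_add, Polynomial.eval_comp, Polynomial.eval_one] at *
    omega

@[fun_prop]
theorem PT.prodMk {f : α → β} {g : α → γ} (hf : PT f) (hg : PT g) : PT fun a => (f a, g a) := by
  obtain ⟨c, p, hc, hp⟩ := hf
  obtain ⟨d, q, hd, hq⟩ := hg
  refine ⟨fun k => Prog.seq (Prog.assign (k + 1) (Expr.var k)) (Prog.seq (c (k + 1))
    (Prog.seq (Prog.assign (k + 2) (Expr.var k)) (Prog.seq (d (k + 2))
      (Prog.assign k (Expr.pair (Expr.var (k + 1)) (Expr.var (k + 2))))))),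
    3 * p + 3 * q + 2 * Polynomial.X + 20, ?_, ?_⟩
  · intro k σ a ha
    have r1 := Runs.assign σ (k + 1) (Expr.var k)
    obtain ⟨τ, s, h1, h2, h3, h4⟩ :=
      hc (k + 1) (Function.update σ (k + 1) ((Expr.var k).eval σ)) a (by simp [Expr.eval, ha])
    have hτ : τ k = Enc.enc a := by rw [h3 k (by omega)]; simp [ha]
    have r2 := Runs.assign τ (k + 2) (Expr.var k)
    obtain ⟨ρ, t, h5, h6, h7, h8⟩ :=
      hd (k + 2) (Function.update τ (k + 2) ((Expr.var k).eval τ)) a (by simp [Expr.eval, hτ])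
    have hρ : ρ (k + 1) = Enc.enc (f a) := by rw [h7 (k + 1) (by omega)]; simp [h2]
    have r3 := Runs.assign ρ k (Expr.pair (Expr.var (k + 1)) (Expr.var (k + 2)))
    refine ⟨_, _, Runs.seq _ _ _ _ _ _ _ r1 (Runs.seq _ _ _ _ _ _ _ h1
      (Runs.seq _ _ _ _ _ _ _ r2 (Runs.seq _ _ _ _ _ _ _ h5 r3))), ?_, ?_, ?_⟩
    · simp [Expr.eval, hρ, h6, Enc.enc]
    · intro j hj
      have e1 : j ≠ k := by omega
      have e2 : j ≠ k + 1 := by omega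
      have e3 : j ≠ k + 2 := by omega
      simp [e1, h7 j (by omega), e3, h3 j (by omega), e2]
    · have e1 := hp a
      have e2 := hq a
      simp [Expr.cost, Expr.eval, ha, hτ, hρ, h6, Data.size] at *
      simp only [esize] at *
      omega
  · intro a
    have e1 := hp a
    have e2 := hq a
    simp [esize_pair]
    omega

@[fun_prop]
theorem PT.fst' : PT fun x : α × β => x.1 := by
  refine PT.of_expr (fun k => Expr.fst (Expr.var k)) (2 * Polynomial.X) ?_
  rintro k σ ⟨a, b⟩ h
  refine ⟨by simp [Expr.eval, h, Enc.enc, Data.fst], ?_⟩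
  simp [Expr.cost, Expr.eval, h, Enc.enc, Data.fst, esize, Data.size]
  omega

@[fun_prop]
theorem PT.snd' : PT fun x : α × β => x.2 := by
  refine PT.of_expr (fun k => Expr.snd (Expr.var k)) (2 * Polynomial.X) ?_
  rintro k σ ⟨a, b⟩ h
  refine ⟨by simp [Expr.eval, h, Enc.enc, Data.snd], ?_⟩
  simp [Expr.cost, Expr.eval, h, Enc.enc, Data.snd, esize, Data.size]
  omega

@[fun_prop]
theorem PT.fst {f : α → β × γ} (hf : PT f) : PT fun a => (f a).1 := PT.fst'.comp hf

@[fun_prop]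
theorem PT.snd {f : α → β × γ} (hf : PT f) : PT fun a => (f a).2 := PT.snd'.comp hf

/-- Binary operations of the machine on integers. -/
theorem PT.binary {op : ℤ → ℤ → β} (E : Expr → Expr → Expr)
    (h1 : ∀ σ e e', (E e e').eval σ = Enc.enc (op (e.eval σ).toInt (e'.eval σ).toInt))
    (h2 : ∀ σ e e', (E e e').cost σ = e.cost σ + e'.cost σ + ((E e e').eval σ).size)
    (h3 : ∀ x y, esize (op x y) ≤ intBits x + intBits y + 2)
    {f g : α → ℤ} (hf : PT f) (hg : PT g) : PT fun a => op (f a) (g a) := by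
  have : PT fun x : ℤ × ℤ => op x.1 x.2 := by
    refine PT.of_expr (fun k => E (Expr.fst (Expr.var k)) (Expr.snd (Expr.var k)))
      (10 * Polynomial.X + 10) ?_
    rintro k σ ⟨x, y⟩ h
    refine ⟨by simp [h1, Expr.eval, h, Enc.enc, Data.fst, Data.snd, Data.toInt], ?_⟩
    have := h3 x y
    simp [h1, h2, Expr.cost, Expr.eval, h, Enc.enc, Data.fst, Data.snd, esize, Data.size,
      Data.toInt] at *
    omega
  exact this.comp (hf.prodMk hg)

@[fun_prop]
theorem PT.add {f g : α → ℤ} (hf : PT f) (hg : PT g) : PT fun a => f a + g a :=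
  PT.binary (op := fun x y => x + y) Expr.add (fun _ _ _ => rfl) (fun _ _ _ => rfl)
    (fun x y => by have := intBits_add_le x y; rw [esize_int]; omega) hf hg

@[fun_prop]
theorem PT.sub {f g : α → ℤ} (hf : PT f) (hg : PT g) : PT fun a => f a - g a :=
  PT.binary (op := fun x y => x - y) Expr.sub (fun _ _ _ => rfl) (fun _ _ _ => rfl)
    (fun x y => by
      have := intBits_add_le x (-y); rw [intBits_neg] at this
      rw [esize_int, sub_eq_add_neg]; omega) hf hg

@[fun_prop]
theorem PT.mul {f g : α → ℤ} (hf : PT f) (hg : PT g) : PT fun a => f a * g a :=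
  PT.binary (op := fun x y => x * y) Expr.mul (fun _ _ _ => rfl) (fun _ _ _ => rfl)
    (fun x y => by have := intBits_mul_le x y; rw [esize_int]; omega) hf hg

@[fun_prop]
theorem PT.div {f g : α → ℤ} (hf : PT f) (hg : PT g) : PT fun a => f a / g a :=
  PT.binary (op := fun x y => x / y) Expr.div (fun _ _ _ => rfl) (fun _ _ _ => rfl)
    (fun x y => by have := intBits_div_le x y; rw [esize_int]; omega) hf hg

@[fun_prop]
theorem PT.neg {f : α → ℤ} (hf : PT f) : PT fun a => -f a := by
  have : PT fun a => 0 - f a := by fun_prop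
  simpa using this

@[fun_prop]
theorem PT.lt {f g : α → ℤ} (hf : PT f) (hg : PT g) : PT fun a => decide (f a < g a) :=
  PT.binary (op := fun x y => decide (x < y)) Expr.lt
    (fun σ e e' => by simp only [Expr.eval, Enc.enc, decide_eq_true_eq]; split_ifs <;> rfl)
    (fun _ _ _ => rfl)
    (fun x y => by have := esize_bool_le (decide (x < y)); omega) hf hg

@[fun_prop]
theorem PT.cond {c : α → Bool} {f g : α → β} (hc : PT c) (hf : PT f) (hg : PT g) :
    PT fun a => if c a = true then f a else g a := by
  obtain ⟨c', r, hc', hr⟩ := hc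
  obtain ⟨c1, p, h1, hp⟩ := hf
  obtain ⟨c2, q, h2, hq⟩ := hg
  refine ⟨fun k => Prog.seq (Prog.assign (k + 1) (Expr.var k)) (Prog.seq (c' (k + 1))
    (Prog.branch (Expr.var (k + 1)) (c1 k) (c2 k))), Polynomial.X + 2 * r + p + q + 10, ?_, ?_⟩
  · intro k σ a ha
    have r1 := Runs.assign σ (k + 1) (Expr.var k)
    obtain ⟨τ, s, g1, g2, g3, g4⟩ :=
      hc' (k + 1) (Function.update σ (k + 1) ((Expr.var k).eval σ)) a (by simp [Expr.eval, ha])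
    have hτ : τ k = Enc.enc a := by rw [g3 k (by omega)]; simp [ha]
    have e0 := hr a
    by_cases hca : c a = true
    · obtain ⟨ρ, t, h5, h6, h7, h8⟩ := h1 k τ a hτ
      have hne : ((Expr.var (k + 1)).eval τ).toInt ≠ 0 := by
        simp [Expr.eval, g2, Enc.enc, hca, Data.toInt]
      refine ⟨ρ, _, Runs.seq _ _ _ _ _ _ _ r1 (Runs.seq _ _ _ _ _ _ _ g1
        (Runs.branch_true _ _ _ _ _ _ hne h5)), by simp [hca, h6], ?_, ?_⟩
      · intro j hj
        have e2 : j ≠ k + 1 := by omega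
        simp [h7 j hj, g3 j (by omega), e2]
      · simp [Expr.cost, Expr.eval, ha, g2] at *
        simp only [esize] at *
        omega
    · obtain ⟨ρ, t, h5, h6, h7, h8⟩ := h2 k τ a hτ
      have hne : ((Expr.var (k + 1)).eval τ).toInt = 0 := by
        simp [Expr.eval, g2, Enc.enc, hca, Data.toInt]
      refine ⟨ρ, _, Runs.seq _ _ _ _ _ _ _ r1 (Runs.seq _ _ _ _ _ _ _ g1
        (Runs.branch_false _ _ _ _ _ _ hne h5)), by simp [hca, h6], ?_, ?_⟩
      · intro j hj
        have e2 : j ≠ k + 1 := by omega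
        simp [h7 j hj, g3 j (by omega), e2]
      · simp [Expr.cost, Expr.eval, ha, g2] at *
        simp only [esize] at *
        omega
  · intro a
    have e1 := hp a
    have e2 := hq a
    simp only [Polynomial.eval_add]
    split_ifs <;> omega

/-- The body of the loop that folds over a list. Register `k` holds the context, the accumulator
and the rest of the list. -/
def foldBody (c : ℕ → Prog) (k : ℕ) : Prog :=
  Prog.seq (Prog.assign (k + 1) (Expr.pair (Expr.fst (Expr.var k))
      (Expr.pair (Expr.fst (Expr.snd (Expr.var k)))
        (Expr.fst (Expr.snd (Expr.snd (Expr.var k)))))))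
    (Prog.seq (c (k + 1)) (Prog.assign k (Expr.pair (Expr.fst (Expr.var k))
      (Expr.pair (Expr.var (k + 1)) (Expr.snd (Expr.snd (Expr.snd (Expr.var k))))))))

/-- The loop of a fold, if `N` bounds the context, the list and all accumulators. -/
theorem runs_foldLoop {f : α → β → δ → β} {c : ℕ → Prog} {p : Polynomial ℕ}
    (hc : Computes c (fun x : α × β × δ => f x.1 x.2.1 x.2.2) p) (a : α) (N k : ℕ)
    (hN : esize a ≤ N) (l : List δ) :
    ∀ (b : β) (σ : Store), σ k = Enc.enc (a, b, l) → esize l ≤ N →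
    (∀ l' : List δ, l' <+: l → esize (l'.foldl (f a) b) ≤ N) →
    ∃ (τ : Store) (t : ℕ),
      Runs (Prog.loop (Expr.isPair (Expr.snd (Expr.snd (Expr.var k)))) (foldBody c k)) σ τ t ∧
      τ k = Enc.enc (a, l.foldl (f a) b, ([] : List δ)) ∧ (∀ j < k, τ j = σ j) ∧
      t ≤ (l.length + 1) * (p.eval (3 * N + 10) + 40 * (3 * N + 10)) := by
  induction l with
  | nil =>
    intro b σ hσ hl hb
    have hb0 := hb [] List.prefix_rfl
    refine ⟨σ, _, Runs.loop_false _ _ _ ?_, hσ, fun _ _ => rfl, ?_⟩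
    · simp [Expr.eval, hσ, Enc.enc, Data.snd, Data.isPair, Data.ofList, Data.toInt]
    · simp [Expr.cost, Expr.eval, hσ, Enc.enc, Data.snd, Data.isPair, Data.ofList,
        Data.size, esize] at *
      simp [intBits]
      omega
  | cons x l ih =>
    intro b σ hσ hl hb
    have hb0 : esize b ≤ N := hb [] (List.nil_prefix)
    rw [esize_cons] at hl
    have hne : ((Expr.isPair (Expr.snd (Expr.snd (Expr.var k)))).eval σ).toInt ≠ 0 := by
      simp [Expr.eval, hσ, Enc.enc, Data.snd, Data.isPair, Data.ofList, Data.toInt]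
    have r1 := Runs.assign σ (k + 1) (Expr.pair (Expr.fst (Expr.var k))
      (Expr.pair (Expr.fst (Expr.snd (Expr.var k)))
        (Expr.fst (Expr.snd (Expr.snd (Expr.var k))))))
    have v1 : (Expr.pair (Expr.fst (Expr.var k)) (Expr.pair (Expr.fst (Expr.snd (Expr.var k)))
        (Expr.fst (Expr.snd (Expr.snd (Expr.var k)))))).eval σ = Enc.enc (a, b, x) := by
      simp [Expr.eval, hσ, Enc.enc, Data.fst, Data.snd, Data.ofList]
    rw [v1] at r1
    obtain ⟨τ, s, h1, h2, h3, h4⟩ := hc (k + 1)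
      (Function.update σ (k + 1) (Enc.enc (a, b, x))) (a, b, x) (Function.update_self ..)
    have hτ : τ k = Enc.enc (a, b, x :: l) := by rw [h3 k (by omega)]; simp [hσ]
    have r2 := Runs.assign τ k (Expr.pair (Expr.fst (Expr.var k))
      (Expr.pair (Expr.var (k + 1)) (Expr.snd (Expr.snd (Expr.snd (Expr.var k))))))
    have hb1 : esize (f a b x) ≤ N := hb [x] (by simp)
    have v2 : (Expr.pair (Expr.fst (Expr.var k)) (Expr.pair (Expr.var (k + 1))
        (Expr.snd (Expr.snd (Expr.snd (Expr.var k)))))).eval τ = Enc.enc (a, f a b x, l) := by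
      simp [Expr.eval, hτ, h2, Enc.enc, Data.fst, Data.snd, Data.ofList]
    rw [v2] at r2
    obtain ⟨ρ, t, g1, g2, g3, g4⟩ := ih (f a b x)
      (Function.update τ k (Enc.enc (a, f a b x, l))) (Function.update_self ..) (by omega)
      (fun l' h' => hb (x :: l') (by simpa using h'))
    refine ⟨ρ, _, Runs.loop_true _ _ _ _ _ _ _ hne (Runs.seq _ _ _ _ _ _ _ r1
      (Runs.seq _ _ _ _ _ _ _ h1 r2)) g1, by simpa using g2, ?_, ?_⟩
    · intro j hj
      have e1 : j ≠ k := by omega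
      have e2 : j ≠ k + 1 := by omega
      simp [g3 j hj, e1, h3 j (by omega), e2]
    · have h5 : p.eval (esize (a, b, x)) ≤ p.eval (3 * N + 10) := p.eval_nat_mono (by
        simp only [esize_pair]; omega)
      have h6 : ∀ y : β, (Enc.enc y).size = esize y := fun _ => rfl
      have h7 : ∀ y : α, (Enc.enc y).size = esize y := fun _ => rfl
      have h8 : ∀ y : δ, (Enc.enc y).size = esize y := fun _ => rfl
      have h9 : ∀ y : List δ, (Data.ofList (List.map Enc.enc y)).size = esize y := fun _ => rfl
      simp [Expr.cost, Expr.eval, hσ, hτ, h2] at *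
      simp [Enc.enc, Data.fst, Data.snd, Data.isPair, Data.ofList,
        Data.size] at *
      simp only [h6, h7, h8, h9, show intBits 1 = 1 from by simp [intBits]] at *
      rw [add_mul (l.length + 1)]
      omega

/-- Folds are computable in polynomial time if the accumulator stays small. -/
theorem PT.foldl {l : α → List δ} {b : α → β} {f : α → β → δ → β} (hl : PT l) (hb : PT b)
    (hf : PT fun x : α × β × δ => f x.1 x.2.1 x.2.2) (q : Polynomial ℕ)
    (hq : ∀ a l', l' <+: l a → esize (l'.foldl (f a) (b a)) ≤ q.eval (esize a)) :
    PT fun a => (l a).foldl (f a) (b a) := by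
  have hpre : PT fun a => (a, b a, l a) := by fun_prop
  have hlast : PT fun x : α × β × List δ => x.2.1 := by fun_prop
  obtain ⟨c, p, hc, hp⟩ := hf
  obtain ⟨c1, p1, hc1, hp1⟩ := hpre
  obtain ⟨c2, p2, hc2, hp2⟩ := hlast
  -- `M` bounds the context, the list and all accumulators
  let M : Polynomial ℕ := Polynomial.X + p1 + q
  let R : Polynomial ℕ := 3 * M + 10
  refine ⟨fun k => Prog.seq (c1 k) (Prog.seq
    (Prog.loop (Expr.isPair (Expr.snd (Expr.snd (Expr.var k)))) (foldBody c k)) (c2 k)),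
    p1 + (p1 + 1) * (p.comp R + 40 * R) + p2.comp R + q + 10, ?_, ?_⟩
  · intro k σ a ha
    obtain ⟨τ, s, h1, h2, h3, h4⟩ := hc1 k σ a ha
    have e0 := hp1 a
    simp only [esize_pair] at e0
    obtain ⟨ρ, t, g1, g2, g3, g4⟩ := runs_foldLoop hc a (M.eval (esize a)) k
      (by simp [M]; omega) (l a) (b a) τ h2 (by simp [M]; omega)
      (fun l' h' => (hq a l' h').trans (by simp [M]))
    obtain ⟨υ, u, u1, u2, u3, u4⟩ := hc2 k ρ _ g2
    refine ⟨υ, _, Runs.seq _ _ _ _ _ _ _ h1 (Runs.seq _ _ _ _ _ _ _ g1 u1), u2,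
      fun j hj => by rw [u3 j hj, g3 j hj, h3 j hj], ?_⟩
    have e1 := length_le_esize (l a)
    have e2 := hq a (l a) List.prefix_rfl
    have e3 : p2.eval (esize (a, (l a).foldl (f a) (b a), ([] : List δ)))
        ≤ p2.eval (R.eval (esize a)) := p2.eval_nat_mono (by
      simp only [esize_pair, esize_nil]
      simp [R, M]
      omega)
    have e4 : ((l a).length + 1) * (p.eval (3 * M.eval (esize a) + 10)
        + 40 * (3 * M.eval (esize a) + 10)) ≤
        (p1.eval (esize a) + 1) * (p.eval (R.eval (esize a)) + 40 * R.eval (esize a)) := by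
      have : R.eval (esize a) = 3 * M.eval (esize a) + 10 := by simp [R]
      rw [this]
      exact Nat.mul_le_mul_right _ (by omega)
    simp only [Polynomial.eval_add, Polynomial.eval_comp, Polynomial.eval_mul,
      Polynomial.eval_one, Polynomial.eval_ofNat] at *
    omega
  · intro a
    have := hq a (l a) List.prefix_rfl
    simp only [Polynomial.eval_add]
    omega

theorem PT.size_le {f : α → β} (hf : PT f) :
    ∃ p : Polynomial ℕ, ∀ a, esize (f a) ≤ p.eval (esize a) := by
  obtain ⟨c, p, hc, hp⟩ := hf
  exact ⟨p, hp⟩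

@[fun_prop]
theorem PT.cons {f : α → β} {g : α → List β} (hf : PT f) (hg : PT g) :
    PT fun a => f a :: g a := by
  obtain ⟨c, p, hc, hp⟩ := hf.prodMk hg
  exact ⟨c, p, hc, hp⟩

@[fun_prop]
theorem PT.reverse {l : α → List β} (hl : PT l) : PT fun a => (l a).reverse := by
  obtain ⟨p, hp⟩ := hl.size_le
  have := PT.foldl (f := fun (_ : α) (r : List β) x => x :: r) hl (PT.const []) (by fun_prop) p
    (fun a l' h' => by
      rw [foldl_cons, List.append_nil, esize_reverse]
      exact (esize_prefix_le h').trans (hp a))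
  simpa [foldl_cons] using this

@[fun_prop]
theorem PT.append {f g : α → List β} (hf : PT f) (hg : PT g) : PT fun a => f a ++ g a := by
  obtain ⟨p, hp⟩ := hf.size_le
  obtain ⟨q, hq⟩ := hg.size_le
  have := PT.foldl (f := fun (_ : α) (r : List β) x => x :: r) hf.reverse hg (by fun_prop)
    (p + q) (fun a l' h' => by
      rw [foldl_cons]
      have e1 := esize_append l'.reverse (g a)
      have e2 := esize_prefix_le h'
      have e3 := hp a
      have e4 := hq a
      simp only [Polynomial.eval_add]
      rw [esize_reverse] at e1 e2
      omega)
  simpa [foldl_cons] using this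

theorem PT.map {l : α → List β} {f : α → β → γ} (hl : PT l)
    (hf : PT fun x : α × β => f x.1 x.2) : PT fun a => (l a).map (f a) := by
  obtain ⟨p, hp⟩ := hl.size_le
  obtain ⟨q, hq⟩ := hf.size_le
  have := PT.foldl (f := fun (a : α) (r : List γ) x => f a x :: r) hl (PT.const [])
    (by
      have : PT fun x : α × List γ × β => f x.1 x.2.2 :=
        hf.comp (f := fun x : α × List γ × β => (x.1, x.2.2)) (by fun_prop)
      fun_prop)
    ((q.comp (Polynomial.X + p + 1) + 1) * p + 1) (fun a l' h' => by
      rw [foldl_cons_map, List.append_nil, esize_reverse]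
      have e1 := esize_prefix_le h'
      have e2 := length_le_esize l'
      have e3 := hp a
      refine (esize_list_le _ (q.eval (esize a + p.eval (esize a) + 1)) ?_).trans ?_
      · intro y hy
        obtain ⟨x, hx, rfl⟩ := List.mem_map.1 hy
        refine (hq (a, x)).trans (q.eval_nat_mono ?_)
        have := esize_mem_le hx
        simp only [esize_pair]
        omega
      · simp only [Polynomial.eval_add, Polynomial.eval_mul, Polynomial.eval_comp,
          Polynomial.eval_one, Polynomial.eval_X, List.length_map]
        gcongr
        omega)
  have := this.reverse
  simpa [foldl_cons_map] using this

theorem esize_flatten_le (L : List (List α)) : esize L.flatten ≤ esize L := by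
  induction L with
  | nil => simp [esize_nil]
  | cons a L ih =>
    have := esize_append a L.flatten
    simp only [List.flatten_cons, esize_cons]
    omega

@[fun_prop]
theorem PT.flatten {L : α → List (List β)} (hL : PT L) : PT fun a => (L a).flatten := by
  obtain ⟨p, hp⟩ := hL.size_le
  have := PT.foldl (f := fun (_ : α) (r : List β) x => r ++ x) hL (PT.const [])
    (by fun_prop) p (fun a l' h' => by
      rw [foldl_append, List.nil_append]
      exact (esize_flatten_le _).trans ((esize_prefix_le h').trans (hp a)))
  simpa [foldl_append] using this

theorem PT.flatMap {l : α → List β} {f : α → β → List γ} (hl : PT l)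
    (hf : PT fun x : α × β => f x.1 x.2) : PT fun a => (l a).flatMap (f a) := by
  simp only [List.flatMap_def]
  exact (PT.map hl hf).flatten

theorem PT.filter {l : α → List β} {f : α → β → Bool} (hl : PT l)
    (hf : PT fun x : α × β => f x.1 x.2) : PT fun a => (l a).filter (f a) := by
  have h : PT fun a => (l a).flatMap fun x => if f a x = true then [x] else [] :=
    PT.flatMap hl (hf.cond (by fun_prop) (by fun_prop))
  have e : ∀ (g : β → Bool) (l : List β),
      (l.flatMap fun x => if g x = true then [x] else []) = l.filter g := by
    intro g l
    induction l with
    | nil => rfl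
    | cons x l ih => by_cases hx : g x = true <;> simp [hx, ih]
  simpa only [e] using h

@[fun_prop]
theorem PT.and {f g : α → Bool} (hf : PT f) (hg : PT g) : PT fun a => f a && g a := by
  have : PT fun a => if f a = true then g a else false := by fun_prop
  refine (funext fun a => ?_ : (fun a => f a && g a) = _) ▸ this
  cases f a <;> simp

@[fun_prop]
theorem PT.or {f g : α → Bool} (hf : PT f) (hg : PT g) : PT fun a => f a || g a := by
  have : PT fun a => if f a = true then true else g a := by fun_prop
  refine (funext fun a => ?_ : (fun a => f a || g a) = _) ▸ this
  cases f a <;> simp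

@[fun_prop]
theorem PT.not {f : α → Bool} (hf : PT f) : PT fun a => !f a := by
  have : PT fun a => if f a = true then false else true := by fun_prop
  refine (funext fun a => ?_ : (fun a => !f a) = _) ▸ this
  cases f a <;> simp

theorem PT.all {l : α → List β} {f : α → β → Bool} (hl : PT l)
    (hf : PT fun x : α × β => f x.1 x.2) : PT fun a => (l a).all (f a) := by
  have := PT.foldl (f := fun (a : α) (r : Bool) x => r && f a x) hl (PT.const true)
    (by
      have : PT fun x : α × Bool × β => f x.1 x.2.2 :=
        hf.comp (f := fun x : α × Bool × β => (x.1, x.2.2)) (by fun_prop)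
      fun_prop) 2 (fun a l' h' => by simpa using esize_bool_le _)
  have e : ∀ (g : β → Bool) (l : List β) (r : Bool),
      l.foldl (fun r x => r && g x) r = (r && l.all g) := by
    intro g l
    induction l with
    | nil => simp
    | cons x l ih => intro r; simp [ih, Bool.and_assoc]
  simpa only [e, Bool.true_and] using this

end Framework


/-! ### Plane vectors with coordinates in a commutative ring -/

section Vectors

variable {R : Type} [CommRing R]

def dot2 (a b : R × R) : R := a.1 * b.1 + a.2 * b.2

def cross2 (a b : R × R) : R := a.1 * b.2 - a.2 * b.1

/-- The counterclockwise rotation by a right angle. -/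
def rot90 (a : R × R) : R × R := (-a.2, a.1)

def scale2 (s : R) (a : R × R) : R × R := (s * a.1, s * a.2)

end Vectors

/-! ### The algorithm -/

abbrev IntPt := ℤ × ℤ

/-- A vector `y₀ + τ y₁` that depends linearly on a parameter `τ`. -/
abbrev LinVec := IntPt × IntPt

/-- A quadratic polynomial `a + b τ + c τ²`. -/
abbrev Quad := ℤ × ℤ × ℤ

/-- A quadruple `(d, n, s, D)` stands for the number `(n + s √D) / d`. -/
abbrev QuadRoot := ℤ × ℤ × ℤ × ℤ

/-- A root together with a flag: the flag `true` stands for the points immediately to the right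
of the root, and `false` for the root itself. -/
abbrev Place := QuadRoot × Bool

/-- A candidate `(y, strict, weak)` for the direction of the next cut: it is admissible for those
`τ` where all polynomials in `strict` are negative and all polynomials in `weak` are at most 0. -/
abbrev Cand := LinVec × List Quad × List Quad

/-- The vector that does not depend on `τ`. -/
def constVec (c : IntPt) : LinVec := (c, (0, 0))

def constQuad (a : ℤ) : Quad := (a, 0, 0)

def negQuad (q : Quad) : Quad := (-q.1, -q.2.1, -q.2.2)

/-- The derivative with respect to `τ`. -/
def derivQuad (q : Quad) : Quad := (q.2.1, 2 * q.2.2, 0)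

/-- The inner product of two linear vectors, as a polynomial in `τ`. -/
def dotQuad (x y : LinVec) : Quad :=
  (dot2 x.1 y.1, dot2 x.1 y.2 + dot2 x.2 y.1, dot2 x.2 y.2)

/-- The determinant of two linear vectors, as a polynomial in `τ`. -/
def crossQuad (x y : LinVec) : Quad :=
  (cross2 x.1 y.1, cross2 x.1 y.2 + cross2 x.2 y.1, cross2 x.2 y.2)

/-- The candidates that come from the end point `z` of a segment, if `z` is not in the current cut
because of the vertex `u`. The normal is that of the line through `z` and the vertex `v`, which
must be tangent to the polygon. -/
def candE (e : LinVec) (V : List IntPt) (z v u : IntPt) : Cand :=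
  (constVec (rot90 (z - v)),
    [dotQuad e (constVec (z - u)),
      negQuad (dotQuad (constVec (rot90 (z - v))) (constVec (rot90 (z - v))))],
    V.map fun w => dotQuad (constVec (rot90 (z - v))) (constVec (w - v)))

def candsE (e : LinVec) (V Z : List IntPt) : List Cand :=
  Z.flatMap fun z => V.flatMap fun v => V.map fun u => candE e V z v u

/-- The normal of the line through `v'` and the point where the line through `v` with normal `x`
crosses the line through `p` and `q`, up to a factor. -/
def crossNormal {R : Type} [CommRing R] (p q v v' x : R × R) : R × R :=
  rot90 (scale2 (dot2 x (q - p)) (p - v') + scale2 (dot2 x (v - p)) (q - p))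

def crossNormalVec (e : LinVec) (p q v v' : IntPt) : LinVec :=
  (crossNormal p q v v' e.1, crossNormal p q v v' e.2)

/-- The strict conditions for a crossing point: the point `p` is not in the current cut, and the
candidate is not zero. -/
def strictX (e : LinVec) (p q v v' : IntPt) : List Quad :=
  [dotQuad e (constVec (p - v)),
    negQuad (dotQuad (crossNormalVec e p q v v') (crossNormalVec e p q v v'))]

/-- The weak conditions for a crossing point: the point `q` is in the current cut, the boundary of
the current cut touches the polygon at `v`, and that of the candidate touches it at `v'`. -/
def weakX (e : LinVec) (V : List IntPt) (p q v v' : IntPt) : List Quad :=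
  dotQuad e (constVec (v - q)) :: ((V.map fun w => dotQuad e (constVec (w - v))) ++
    V.map fun w => dotQuad (crossNormalVec e p q v v') (constVec (w - v')))

/-- The candidates that come from the point where the segment from `p` to `q` enters the current
cut, whose boundary passes through the vertex `v`. They are two because a disjunction of two
conditions has to be split. -/
def candX (e : LinVec) (V : List IntPt) (p q v v' : IntPt) : List Cand :=
  [(crossNormalVec e p q v v', constQuad (-cross2 (q - p) (p - v)) :: strictX e p q v v',
      weakX e V p q v v'),
    (crossNormalVec e p q v v', strictX e p q v v',
      constQuad (cross2 (q - p) (p - v)) :: constQuad (-cross2 (q - p) (p - v)) ::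
        constQuad (cross2 (p - v') (q - p)) :: weakX e V p q v v')]

def candsX (e : LinVec) (V : List IntPt) (S : List (IntPt × IntPt)) : List Cand :=
  S.flatMap fun s => V.flatMap fun v => V.flatMap fun v' => candX e V s.1 s.2 v v'

/-- The segments in both orientations. -/
def bothWays (S : List (IntPt × IntPt)) : List (IntPt × IntPt) := S ++ S.map fun s => (s.2, s.1)

/-- All candidates. The current normal itself is one of them: it stands for a full turn. -/
def cands (e : LinVec) (V : List IntPt) (S : List (IntPt × IntPt)) : List Cand :=
  (e, [], []) :: (candsE e V ((bothWays S).map fun s => s.1) ++ candsX e V (bothWays S))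

/-- All polynomials whose signs decide which candidate is chosen. -/
def quads (e : LinVec) (L : List Cand) : List Quad :=
  L.flatMap fun c => c.2.1 ++ (c.2.2 ++ (crossQuad e c.1 :: dotQuad e c.1 ::
    L.map fun c' => crossQuad c.1 c'.1))

/-- The sign of `A + B` from the signs of `A`, `B` and `A² - B²`. -/
def combineSigns (a b d : ℤ) : ℤ :=
  if decide (a * b < 0) = true then a * d else Int.sign (a + b)

/-- The sign of `u + v √D`. -/
def radSign (u v D : ℤ) : ℤ :=
  combineSigns (Int.sign u) (Int.sign (v * D)) (Int.sign (u * u - v * v * D))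

/-- The sign of `u + v √D + w √E`. -/
def radSign₂ (u v D w E : ℤ) : ℤ :=
  combineSigns (radSign u v D) (Int.sign (w * E))
    (radSign (u * u + v * v * D - w * w * E) (2 * u * v) D)

/-- The order of two roots, where the sign of their difference is computed after multiplication with
the denominators. -/
def rootLt (r r' : QuadRoot) : Bool :=
  decide (radSign₂ (r.2.1 * r'.1 - r'.2.1 * r.1) (r.2.2.1 * r'.1) r.2.2.2 (-(r'.2.2.1 * r.1))
    r'.2.2.2 < 0)

/-- The sign of a polynomial at a root. -/
def signAtRoot (r : QuadRoot) (q : Quad) : ℤ :=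
  radSign (q.1 * (r.1 * r.1) + q.2.1 * (r.1 * r.2.1)
      + q.2.2 * (r.2.1 * r.2.1 + r.2.2.1 * r.2.2.1 * r.2.2.2))
    (q.2.1 * (r.1 * r.2.2.1) + 2 * q.2.2 * (r.2.1 * r.2.2.1)) r.2.2.2

/-- The first argument that is not zero. -/
def firstNonzero (a b c : ℤ) : ℤ :=
  if decide (a * a < 1) = true then (if decide (b * b < 1) = true then c else b) else a

/-- The sign of a polynomial at a root or immediately to its right. -/
def signAt (P : Place) (q : Quad) : ℤ :=
  if P.2 = true then
    firstNonzero (signAtRoot P.1 q) (signAtRoot P.1 (derivQuad q)) (Int.sign q.2.2)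
  else signAtRoot P.1 q

/-- Whether the counterclockwise angle from `x` to `y` is in `(0, π]`. -/
def firstHalf (P : Place) (x y : LinVec) : Bool :=
  decide (0 < signAt P (crossQuad x y)) ||
    (decide (signAt P (crossQuad x y) * signAt P (crossQuad x y) < 1) &&
      decide (signAt P (dotQuad x y) < 0))

/-- Whether the counterclockwise turn, in `(0, 2π]`, from `x` to `y` is smaller than that from `x`
to `y'`. -/
def turnLt (P : Place) (x y y' : LinVec) : Bool :=
  (firstHalf P x y && !firstHalf P x y') ||
    (((firstHalf P x y && firstHalf P x y') || (!firstHalf P x y && !firstHalf P x y')) &&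
      decide (0 < signAt P (crossQuad y y')))

/-- Whether the conditions of the candidate hold at the place. -/
def admissible (P : Place) (c : Cand) : Bool :=
  (c.2.1.all fun q => decide (signAt P q < 0)) && c.2.2.all fun q => decide (signAt P q < 1)

/-- The admissible candidate with the smallest turn. -/
def choose (P : Place) (e : LinVec) (L : List Cand) : LinVec :=
  (L.filter fun c => admissible P c).foldl
    (fun y c => if turnLt P e c.1 y = true then c.1 else y) e

/-- The real roots of a nonzero polynomial. -/
def quadRoots (q : Quad) : List QuadRoot :=
  if decide (q.2.2 * q.2.2 < 1) = true then
    (if decide (q.2.1 * q.2.1 < 1) = true then []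
      else [(q.2.1 * Int.sign q.2.1, -q.1 * Int.sign q.2.1, 0, 0)])
  else if decide (q.2.1 * q.2.1 - 4 * q.1 * q.2.2 < 0) = true then []
  else [(2 * q.2.2 * Int.sign q.2.2, -q.2.1 * Int.sign q.2.2, 1,
      q.2.1 * q.2.1 - 4 * q.1 * q.2.2),
    (2 * q.2.2 * Int.sign q.2.2, -q.2.1 * Int.sign q.2.2, -1,
      q.2.1 * q.2.1 - 4 * q.1 * q.2.2)]

/-- Whether the root is positive. -/
def rootPos (r : QuadRoot) : Bool := decide (0 < radSign r.2.1 r.2.2.1 r.2.2.2)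

/-- Inserts a root into a sorted list, unless its value occurs there already. -/
def insertRoot (l : List QuadRoot) (r : QuadRoot) : List QuadRoot :=
  (l.filter fun r' => rootLt r' r) ++ r ::
    l.filter fun r' => !rootLt r' r && rootLt r r'

/-- The breakpoints in the quadrant: the number 0 and the positive roots of the polynomials. -/
def breaks (Q : List Quad) : List QuadRoot :=
  ((Q.flatMap fun q => quadRoots q).filter fun r => rootPos r).foldl insertRoot [(1, 0, 0, 0)]

/-- A radical with integers `a`, `b`, `c`. -/
abbrev RadOut := (ℤ × ℤ) × (ℤ × ℤ) × (ℤ × ℤ)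

/-- A 2 × 2 matrix, given by its rows. -/
abbrev MatOut := (ℤ × ℤ) × (ℤ × ℤ)

def radOut (a b c : ℤ) : RadOut := ((a, 1), (b, 1), (c, 1))

/-- The ray through `e₀ + τ e₁`, where `τ` is the value of the root. -/
def rayOut (e : LinVec) (r : QuadRoot) : RadOut × RadOut :=
  (radOut (r.1 * e.1.1 + r.2.1 * e.2.1) (r.2.2.1 * e.2.1) r.2.2.2,
    radOut (r.1 * e.1.2 + r.2.1 * e.2.2) (r.2.2.1 * e.2.2) r.2.2.2)

/-- The linear rational function that maps `e₀ + τ e₁` to `y₀ + τ y₁`, where `e₀`, `e₁` are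
orthonormal. -/
def linOut (e y : LinVec) : MatOut × MatOut :=
  (((y.1.1 * e.1.1 + y.2.1 * e.2.1, y.1.1 * e.1.2 + y.2.1 * e.2.2),
      (y.1.2 * e.1.1 + y.2.2 * e.2.1, y.1.2 * e.1.2 + y.2.2 * e.2.2)), (e.1, e.1))

/-- A boundary point with its two linear rational functions. -/
abbrev ItemOut := (RadOut × RadOut) × (MatOut × MatOut) × (MatOut × MatOut)

/-- The boundary point for the root `r`, the function there, and the function on the arc that
follows. -/
def itemOut (e : LinVec) (L : List Cand) (r : QuadRoot) : ItemOut :=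
  (rayOut e r, linOut e (choose (r, false) e L), linOut e (choose (r, true) e L))

/-- The output for the quadrant of the vectors `X (e₀ + τ e₁)` with `X > 0` and `τ ≥ 0`. -/
def quadrantOut (L : List Cand) (e : LinVec) : List ItemOut :=
  (breaks (quads e L)).map fun r => itemOut e L r

/-- The orthonormal bases `(e₀, e₁)` whose nonnegative combinations are the quadrants, in
counterclockwise order. -/
def quadrants : List LinVec :=
  [((1, 0), (0, 1)), ((0, 1), (-1, 0)), ((-1, 0), (0, -1)), ((0, -1), (1, 0))]

def integerOut (V : List IntPt) (S : List (IntPt × IntPt)) : List ItemOut :=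
  quadrants.flatMap fun e => quadrantOut (cands e V S) e

/-- A rational point as pairs of numerators and denominators. -/
abbrev FracPt := (ℤ × ℤ) × (ℤ × ℤ)

/-- A common multiple of all denominators. -/
def commonDenom (V : List FracPt) (S : List (FracPt × FracPt)) : ℤ :=
  ((V ++ ((S.map fun s => s.1) ++ S.map fun s => s.2)).flatMap fun q => [q.1.2, q.2.2]).foldl
    (fun x y => x * y) 1

/-- The point in integer coordinates, where `D` is a multiple of its denominators. -/
def clearPt (D : ℤ) (q : FracPt) : IntPt := (q.1.1 * (D / q.1.2), q.2.1 * (D / q.2.2))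

def clearVertices (D : ℤ) (V : List FracPt) : List IntPt := V.map fun q => clearPt D q

def clearSegs (D : ℤ) (S : List (FracPt × FracPt)) : List (IntPt × IntPt) :=
  S.map fun s => (clearPt D s.1, clearPt D s.2)

def algorithm (x : List FracPt × List (FracPt × FracPt)) : List ItemOut :=
  integerOut (clearVertices (commonDenom x.1 x.2) x.1) (clearSegs (commonDenom x.1 x.2) x.2)

/-! ### The algorithm takes polynomial time -/

section AlgorithmTime

variable {α : Type} [Enc α]

@[fun_prop]
theorem PT.pairLit {β γ : Type} [Enc β] [Enc γ] {f : α → β} {g : α → γ} (hf : PT f) (hg : PT g) :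
    PT fun a => (f a, g a) := hf.prodMk hg

@[fun_prop]
theorem PT.sub2 {f g : α → IntPt} (hf : PT f) (hg : PT g) : PT fun a => f a - g a := by
  have : PT fun a => ((f a).1 - (g a).1, (f a).2 - (g a).2) := by fun_prop
  exact this

@[fun_prop]
theorem PT.add2 {f g : α → IntPt} (hf : PT f) (hg : PT g) : PT fun a => f a + g a := by
  have : PT fun a => ((f a).1 + (g a).1, (f a).2 + (g a).2) := by fun_prop
  exact this

@[fun_prop]
theorem PT.sign {f : α → ℤ} (hf : PT f) : PT fun a => Int.sign (f a) := by
  have : PT fun a => if decide (f a < 0) = true then (-1 : ℤ) else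
    if decide (0 < f a) = true then 1 else 0 := by fun_prop
  refine (funext fun a => ?_ : (fun a => Int.sign (f a)) = _) ▸ this
  rcases lt_trichotomy (f a) 0 with h | h | h
  · simp [h, Int.sign_eq_neg_one_of_neg h]
  · simp [h]
  · simp [h, Int.sign_eq_one_of_pos h, not_lt.2 h.le]

@[fun_prop]
theorem PT.dot2 {f g : α → IntPt} (hf : PT f) (hg : PT g) : PT fun a => dot2 (f a) (g a) := by
  unfold _root_.dot2; fun_prop

@[fun_prop]
theorem PT.cross2 {f g : α → IntPt} (hf : PT f) (hg : PT g) :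
    PT fun a => cross2 (f a) (g a) := by
  unfold _root_.cross2; fun_prop

@[fun_prop]
theorem PT.rot90 {f : α → IntPt} (hf : PT f) : PT fun a => rot90 (f a) := by
  unfold _root_.rot90; fun_prop

@[fun_prop]
theorem PT.scale2 {s : α → ℤ} {f : α → IntPt} (hs : PT s) (hf : PT f) :
    PT fun a => scale2 (s a) (f a) := by
  unfold _root_.scale2; fun_prop

@[fun_prop]
theorem PT.constVec {f : α → IntPt} (hf : PT f) : PT fun a => constVec (f a) := by
  unfold _root_.constVec; fun_prop

@[fun_prop]
theorem PT.constQuad {f : α → ℤ} (hf : PT f) : PT fun a => constQuad (f a) := by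
  unfold _root_.constQuad; fun_prop

@[fun_prop]
theorem PT.negQuad {f : α → Quad} (hf : PT f) : PT fun a => negQuad (f a) := by
  unfold _root_.negQuad; fun_prop

@[fun_prop]
theorem PT.derivQuad {f : α → Quad} (hf : PT f) : PT fun a => derivQuad (f a) := by
  unfold _root_.derivQuad; fun_prop

@[fun_prop]
theorem PT.dotQuad {f g : α → LinVec} (hf : PT f) (hg : PT g) :
    PT fun a => dotQuad (f a) (g a) := by
  unfold _root_.dotQuad; fun_prop

@[fun_prop]
theorem PT.crossQuad {f g : α → LinVec} (hf : PT f) (hg : PT g) :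
    PT fun a => crossQuad (f a) (g a) := by
  unfold _root_.crossQuad; fun_prop

@[fun_prop]
theorem PT.candE {e : α → LinVec} {V : α → List IntPt} {z v u : α → IntPt} (he : PT e)
    (hV : PT V) (hz : PT z) (hv : PT v) (hu : PT u) :
    PT fun a => candE (e a) (V a) (z a) (v a) (u a) := by
  unfold _root_.candE
  have : PT fun a => (V a).map fun w =>
      _root_.dotQuad (_root_.constVec (_root_.rot90 (z a - v a))) (_root_.constVec (w - v a)) :=
    PT.map hV (by fun_prop)
  fun_prop

@[fun_prop]
theorem PT.candsE {e : α → LinVec} {V Z : α → List IntPt} (he : PT e) (hV : PT V) (hZ : PT Z) :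
    PT fun a => candsE (e a) (V a) (Z a) := by
  unfold _root_.candsE
  exact PT.flatMap hZ (PT.flatMap (by fun_prop) (PT.map (by fun_prop) (by fun_prop)))

@[fun_prop]
theorem PT.crossNormal {p q v v' x : α → IntPt} (hp : PT p) (hq : PT q) (hv : PT v)
    (hv' : PT v') (hx : PT x) :
    PT fun a => crossNormal (p a) (q a) (v a) (v' a) (x a) := by
  unfold _root_.crossNormal; fun_prop

@[fun_prop]
theorem PT.crossNormalVec {e : α → LinVec} {p q v v' : α → IntPt} (he : PT e) (hp : PT p)
    (hq : PT q) (hv : PT v) (hv' : PT v') :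
    PT fun a => crossNormalVec (e a) (p a) (q a) (v a) (v' a) := by
  unfold _root_.crossNormalVec; fun_prop

@[fun_prop]
theorem PT.strictX {e : α → LinVec} {p q v v' : α → IntPt} (he : PT e) (hp : PT p)
    (hq : PT q) (hv : PT v) (hv' : PT v') :
    PT fun a => strictX (e a) (p a) (q a) (v a) (v' a) := by
  unfold _root_.strictX; fun_prop

@[fun_prop]
theorem PT.weakX {e : α → LinVec} {V : α → List IntPt} {p q v v' : α → IntPt} (he : PT e)
    (hV : PT V) (hp : PT p) (hq : PT q) (hv : PT v) (hv' : PT v') :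
    PT fun a => weakX (e a) (V a) (p a) (q a) (v a) (v' a) := by
  unfold _root_.weakX
  have h1 : PT fun a => (V a).map fun w => _root_.dotQuad (e a) (_root_.constVec (w - v a)) :=
    PT.map hV (by fun_prop)
  have h2 : PT fun a => (V a).map fun w =>
      _root_.dotQuad (_root_.crossNormalVec (e a) (p a) (q a) (v a) (v' a))
        (_root_.constVec (w - v' a)) :=
    PT.map hV (by fun_prop)
  fun_prop

@[fun_prop]
theorem PT.candX {e : α → LinVec} {V : α → List IntPt} {p q v v' : α → IntPt} (he : PT e)
    (hV : PT V) (hp : PT p) (hq : PT q) (hv : PT v) (hv' : PT v') :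
    PT fun a => candX (e a) (V a) (p a) (q a) (v a) (v' a) := by
  unfold _root_.candX; fun_prop

@[fun_prop]
theorem PT.candsX {e : α → LinVec} {V : α → List IntPt} {S : α → List (IntPt × IntPt)}
    (he : PT e) (hV : PT V) (hS : PT S) : PT fun a => candsX (e a) (V a) (S a) := by
  unfold _root_.candsX
  exact PT.flatMap hS (PT.flatMap (by fun_prop) (PT.flatMap (by fun_prop) (by fun_prop)))

@[fun_prop]
theorem PT.bothWays {S : α → List (IntPt × IntPt)} (hS : PT S) :
    PT fun a => bothWays (S a) := by
  unfold _root_.bothWays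
  exact hS.append (PT.map hS (by fun_prop))

@[fun_prop]
theorem PT.cands {e : α → LinVec} {V : α → List IntPt} {S : α → List (IntPt × IntPt)}
    (he : PT e) (hV : PT V) (hS : PT S) : PT fun a => cands (e a) (V a) (S a) := by
  unfold _root_.cands
  have : PT fun a => (_root_.bothWays (S a)).map fun s => s.1 :=
    PT.map (by fun_prop) (by fun_prop)
  fun_prop

@[fun_prop]
theorem PT.quads {e : α → LinVec} {L : α → List Cand} (he : PT e) (hL : PT L) :
    PT fun a => quads (e a) (L a) := by
  unfold _root_.quads
  refine PT.flatMap hL ?_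
  have : PT fun x : α × Cand => (L x.1).map fun c' => _root_.crossQuad x.2.1 c'.1 :=
    PT.map (by fun_prop) (by fun_prop)
  fun_prop

@[fun_prop]
theorem PT.combineSigns {f g h : α → ℤ} (hf : PT f) (hg : PT g) (hh : PT h) :
    PT fun a => combineSigns (f a) (g a) (h a) := by
  unfold _root_.combineSigns; fun_prop

@[fun_prop]
theorem PT.radSign {f g h : α → ℤ} (hf : PT f) (hg : PT g) (hh : PT h) :
    PT fun a => radSign (f a) (g a) (h a) := by
  unfold _root_.radSign; fun_prop

@[fun_prop]
theorem PT.radSign₂ {f g h k l : α → ℤ} (hf : PT f) (hg : PT g) (hh : PT h) (hk : PT k)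
    (hl : PT l) : PT fun a => radSign₂ (f a) (g a) (h a) (k a) (l a) := by
  unfold _root_.radSign₂; fun_prop

@[fun_prop]
theorem PT.rootLt {r r' : α → QuadRoot} (hr : PT r) (hr' : PT r') :
    PT fun a => rootLt (r a) (r' a) := by
  unfold _root_.rootLt; fun_prop

@[fun_prop]
theorem PT.signAtRoot {r : α → QuadRoot} {q : α → Quad} (hr : PT r) (hq : PT q) :
    PT fun a => signAtRoot (r a) (q a) := by
  unfold _root_.signAtRoot; fun_prop

@[fun_prop]
theorem PT.firstNonzero {f g h : α → ℤ} (hf : PT f) (hg : PT g) (hh : PT h) :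
    PT fun a => firstNonzero (f a) (g a) (h a) := by
  unfold _root_.firstNonzero; fun_prop

@[fun_prop]
theorem PT.signAt {P : α → Place} {q : α → Quad} (hP : PT P) (hq : PT q) :
    PT fun a => signAt (P a) (q a) := by
  unfold _root_.signAt; fun_prop

@[fun_prop]
theorem PT.firstHalf {P : α → Place} {x y : α → LinVec} (hP : PT P) (hx : PT x) (hy : PT y) :
    PT fun a => firstHalf (P a) (x a) (y a) := by
  unfold _root_.firstHalf; fun_prop

@[fun_prop]
theorem PT.turnLt {P : α → Place} {x y z : α → LinVec} (hP : PT P) (hx : PT x) (hy : PT y)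
    (hz : PT z) : PT fun a => turnLt (P a) (x a) (y a) (z a) := by
  unfold _root_.turnLt; fun_prop

@[fun_prop]
theorem PT.admissible {P : α → Place} {c : α → Cand} (hP : PT P) (hc : PT c) :
    PT fun a => admissible (P a) (c a) := by
  unfold _root_.admissible
  exact (PT.all (by fun_prop) (by fun_prop)).and (PT.all (by fun_prop) (by fun_prop))

theorem foldl_min_mem {β γ : Type} (lt : β → β → Bool) (f : γ → β) (l : List γ) (y : β) :
    l.foldl (fun y c => if lt (f c) y = true then f c else y) y = y ∨
      ∃ c ∈ l, l.foldl (fun y c => if lt (f c) y = true then f c else y) y = f c := by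
  induction l generalizing y with
  | nil => simp
  | cons c l ih =>
    rw [List.foldl_cons]
    rcases ih (if lt (f c) y = true then f c else y) with h | ⟨c', h', h⟩
    · rw [h]
      split_ifs
      · exact Or.inr ⟨c, by simp, rfl⟩
      · exact Or.inl rfl
    · exact Or.inr ⟨c', List.mem_cons_of_mem _ h', h⟩

@[fun_prop]
theorem PT.choose {P : α → Place} {e : α → LinVec} {L : α → List Cand} (hP : PT P) (he : PT e)
    (hL : PT L) : PT fun a => choose (P a) (e a) (L a) := by
  unfold _root_.choose
  have hF : PT fun a => (L a).filter fun c => _root_.admissible (P a) c :=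
    PT.filter hL (by fun_prop)
  obtain ⟨p, hp⟩ := he.size_le
  obtain ⟨q, hq⟩ := hF.size_le
  refine PT.foldl (f := fun a y (c : Cand) =>
    if _root_.turnLt (P a) (e a) c.1 y = true then c.1 else y) hF he (by fun_prop) (p + q) ?_
  intro a l' h'
  have h1 := hp a
  have h2 := hq a
  have h3 := esize_prefix_le h'
  rw [Polynomial.eval_add]
  rcases foldl_min_mem (_root_.turnLt (P a) (e a)) (fun c : Cand => c.1) l' (e a) with h | ⟨c, hc, h⟩
  · rw [h]; omega
  · rw [h]
    have h4 := esize_mem_le hc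
    have h5 : esize c = esize c.1 + esize c.2 + 1 := rfl
    omega

@[fun_prop]
theorem PT.quadRoots {q : α → Quad} (hq : PT q) : PT fun a => quadRoots (q a) := by
  unfold _root_.quadRoots; fun_prop

@[fun_prop]
theorem PT.rootPos {r : α → QuadRoot} (hr : PT r) : PT fun a => rootPos (r a) := by
  unfold _root_.rootPos; fun_prop

@[fun_prop]
theorem PT.insertRoot {l : α → List QuadRoot} {r : α → QuadRoot} (hl : PT l) (hr : PT r) :
    PT fun a => insertRoot (l a) (r a) := by
  unfold _root_.insertRoot
  have h1 : PT fun a => (l a).filter fun r' => _root_.rootLt r' (r a) :=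
    PT.filter hl (by fun_prop)
  have h2 : PT fun a => (l a).filter fun r' => !_root_.rootLt r' (r a) && _root_.rootLt (r a) r' :=
    PT.filter hl (by fun_prop)
  fun_prop


theorem esize_filter_add_le (f g : QuadRoot → Bool) (l : List QuadRoot) :
    esize (l.filter f) + esize (l.filter fun r => !f r && g r) ≤ esize l + 1 := by
  induction l with
  | nil => simp [esize_nil]
  | cons r l ih =>
    cases hf : f r <;> cases hg : g r <;> simp [hf, hg, esize_cons] <;> omega

theorem esize_foldl_insertRoot_le (L l : List QuadRoot) :
    esize (L.foldl insertRoot l) ≤ esize l + esize L := by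
  induction L generalizing l with
  | nil => simp
  | cons r L ih =>
    have h1 := ih (insertRoot l r)
    have h2 := esize_filter_add_le (fun r' => rootLt r' r) (fun r' => rootLt r r') l
    have h3 := esize_append (l.filter fun r' => rootLt r' r)
      (r :: l.filter fun r' => !rootLt r' r && rootLt r r')
    simp only [List.foldl_cons, esize_cons] at *
    unfold insertRoot at h1 ⊢
    omega

@[fun_prop]
theorem PT.breaks {Q : α → List Quad} (hQ : PT Q) : PT fun a => breaks (Q a) := by
  unfold _root_.breaks
  have h1 : PT fun a => (Q a).flatMap fun q => _root_.quadRoots q :=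
    PT.flatMap hQ (by fun_prop)
  have h2 : PT fun a => ((Q a).flatMap fun q => _root_.quadRoots q).filter
      fun r => _root_.rootPos r := PT.filter h1 (by fun_prop)
  obtain ⟨p, hp⟩ := h2.size_le
  refine PT.foldl (f := fun _ => _root_.insertRoot) h2 (PT.const _) (by fun_prop)
    (p + Polynomial.C (esize [((1, 0, 0, 0) : QuadRoot)])) ?_
  intro a l' h'
  have e1 := esize_foldl_insertRoot_le l' [(1, 0, 0, 0)]
  have e2 := esize_prefix_le h'
  have e3 := hp a
  rw [Polynomial.eval_add, Polynomial.eval_C]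
  omega

@[fun_prop]
theorem PT.radOut {f g h : α → ℤ} (hf : PT f) (hg : PT g) (hh : PT h) :
    PT fun a => radOut (f a) (g a) (h a) := by
  unfold _root_.radOut; fun_prop

@[fun_prop]
theorem PT.rayOut {e : α → LinVec} {r : α → QuadRoot} (he : PT e) (hr : PT r) :
    PT fun a => rayOut (e a) (r a) := by
  unfold _root_.rayOut; fun_prop

@[fun_prop]
theorem PT.linOut {e y : α → LinVec} (he : PT e) (hy : PT y) :
    PT fun a => linOut (e a) (y a) := by
  unfold _root_.linOut; fun_prop

@[fun_prop]
theorem PT.itemOut {e : α → LinVec} {L : α → List Cand} {r : α → QuadRoot} (he : PT e)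
    (hL : PT L) (hr : PT r) : PT fun a => itemOut (e a) (L a) (r a) := by
  unfold _root_.itemOut; fun_prop

@[fun_prop]
theorem PT.quadrantOut {e : α → LinVec} {L : α → List Cand} (he : PT e) (hL : PT L) :
    PT fun a => quadrantOut (L a) (e a) := by
  unfold _root_.quadrantOut
  exact PT.map (by fun_prop) (by fun_prop)

@[fun_prop]
theorem PT.integerOut {V : α → List IntPt} {S : α → List (IntPt × IntPt)} (hV : PT V)
    (hS : PT S) : PT fun a => integerOut (V a) (S a) := by
  unfold _root_.integerOut
  exact PT.flatMap (PT.const _) (by fun_prop)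

theorem intBits_foldl_mul_le (l : List ℤ) (x : ℤ) :
    intBits (l.foldl (fun x y => x * y) x) ≤ intBits x + esize l := by
  induction l generalizing x with
  | nil => simp
  | cons y l ih =>
    have h1 := ih (x * y)
    have h2 := intBits_mul_le x y
    simp only [List.foldl_cons, esize_cons, esize_int]
    omega

@[fun_prop]
theorem PT.commonDenom {V : α → List FracPt} {S : α → List (FracPt × FracPt)} (hV : PT V)
    (hS : PT S) : PT fun a => commonDenom (V a) (S a) := by
  unfold _root_.commonDenom
  have h1 : PT fun a => (S a).map fun s => s.1 := PT.map hS (by fun_prop)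
  have h2 : PT fun a => (S a).map fun s => s.2 := PT.map hS (by fun_prop)
  have h3 : PT fun a => (V a ++ (((S a).map fun s => s.1) ++ (S a).map fun s => s.2)).flatMap
      fun q => [q.1.2, q.2.2] := PT.flatMap (by fun_prop) (by fun_prop)
  obtain ⟨p, hp⟩ := h3.size_le
  refine PT.foldl (f := fun _ x y => x * y) h3 (PT.const _) (by fun_prop) (p + 2) ?_
  intro a l' h'
  have e1 := intBits_foldl_mul_le l' 1
  have e2 := esize_prefix_le h'
  have e3 := hp a
  have e4 : intBits 1 = 1 := by simp [intBits]
  rw [Polynomial.eval_add, esize_int, Polynomial.eval_ofNat]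
  omega

@[fun_prop]
theorem PT.clearPt {D : α → ℤ} {q : α → FracPt} (hD : PT D) (hq : PT q) :
    PT fun a => clearPt (D a) (q a) := by
  unfold _root_.clearPt; fun_prop

theorem PT.algorithm : PT algorithm := by
  unfold _root_.algorithm
  have h1 : PT fun x : List FracPt × List (FracPt × FracPt) =>
      clearVertices (_root_.commonDenom x.1 x.2) x.1 := by
    unfold clearVertices
    exact PT.map (by fun_prop) (by fun_prop)
  have h2 : PT fun x : List FracPt × List (FracPt × FracPt) =>
      clearSegs (_root_.commonDenom x.1 x.2) x.2 := by
    unfold clearSegs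
    exact PT.map (by fun_prop) (by fun_prop)
  fun_prop

end AlgorithmTime


/-! ### Cuts of a finite point set, parametrized by the angle of their normals -/

section Cuts

open Real

/-- The unit vector at angle `θ`. -/
noncomputable def dirVec (θ : ℝ) : ℝ × ℝ := (cos θ, sin θ)

/-- The point `z` lies in the half-plane that touches `V` on the side of the normal at angle `θ`. -/
def InCut (V : Set (ℝ × ℝ)) (θ : ℝ) (z : ℝ × ℝ) : Prop :=
  ∀ v ∈ V, dot2 (dirVec θ) v ≤ dot2 (dirVec θ) z

/-- The set `V` has width in every direction. -/
def Wide (V : Set (ℝ × ℝ)) : Prop :=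
  ∀ θ, ∃ v ∈ V, ∃ v' ∈ V, dot2 (dirVec θ) v ≠ dot2 (dirVec θ) v'

/-- The point at parameter `t` on the line through `p` and `q`. -/
def linePt (p q : ℝ × ℝ) (t : ℝ) : ℝ × ℝ := p + scale2 t (q - p)

theorem dot2_linePt (x p q : ℝ × ℝ) (t : ℝ) :
    dot2 x (linePt p q t) = dot2 x p + t * dot2 x (q - p) := by
  simp [dot2, linePt, scale2]; ring

theorem dot2_sub {R : Type} [CommRing R] (x p q : R × R) :
    dot2 x (p - q) = dot2 x p - dot2 x q := by
  simp [dot2]; ring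

theorem dot2_scale2_left {R : Type} [CommRing R] (r : R) (x y : R × R) :
    dot2 (scale2 r x) y = r * dot2 x y := by
  simp [dot2, scale2]; ring

theorem dot2_scale2_right {R : Type} [CommRing R] (r : R) (x y : R × R) :
    dot2 x (scale2 r y) = r * dot2 x y := by
  simp [dot2, scale2]; ring

theorem dirVec_add_two_pi (θ : ℝ) : dirVec (θ + 2 * π) = dirVec θ := by simp [dirVec]

theorem dot2_dirVec_combination (a t b : ℝ) (d : ℝ × ℝ) :
    sin (b - a) * dot2 (dirVec t) d
      = sin (b - t) * dot2 (dirVec a) d + sin (t - a) * dot2 (dirVec b) d := by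
  simp only [dot2, dirVec, sin_sub]; ring

theorem dot2_dirVec_rot90 (θ δ : ℝ) : dot2 (dirVec (θ + δ)) (rot90 (dirVec θ)) = sin δ := by
  simp only [dot2, dirVec, rot90, cos_add, sin_add]
  linear_combination (sin δ) * sin_sq_add_cos_sq θ

variable {V : Set (ℝ × ℝ)} {z : ℝ × ℝ}

theorem inCut_add_two_pi {θ : ℝ} : InCut V (θ + 2 * π) z ↔ InCut V θ z := by
  simp only [InCut, dirVec_add_two_pi]

theorem inCut_sub_two_pi {θ : ℝ} : InCut V (θ - 2 * π) z ↔ InCut V θ z := by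
  rw [← inCut_add_two_pi, sub_add_cancel]

theorem inCut_add_int_mul {θ : ℝ} (k : ℤ) : InCut V (θ + k * (2 * π)) z ↔ InCut V θ z := by
  simp [InCut, dirVec]

/-- A point that lies in two opposite cuts would force the width of `V` to vanish. -/
theorem not_inCut_add_pi (hV : Wide V) {θ : ℝ} (h : InCut V θ z) : ¬ InCut V (θ + π) z := by
  intro h'
  obtain ⟨v, hv, v', hv', hne⟩ := hV θ
  have e : ∀ u, dot2 (dirVec (θ + π)) u = -dot2 (dirVec θ) u := by
    intro u; simp [dot2, dirVec]; ring
  have h1 := h v hv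
  have h2 := h v' hv'
  have h3 := h' v hv
  have h4 := h' v' hv'
  rw [e, e] at h3 h4
  exact hne (by linarith)

/-- The angles of the cuts that contain a point form an arc shorter than a half-turn. -/
theorem inCut_between (hV : Wide V) {a t b : ℝ} (ha : InCut V a z) (hb : InCut V b z)
    (hat : a ≤ t) (htb : t ≤ b) (hba : b - a ≤ π) : InCut V t z := by
  rcases hba.eq_or_lt with h | h
  · have : b = a + π := by linarith
    rw [this] at hb
    exact absurd hb (not_inCut_add_pi hV ha)
  · rcases (hat.trans htb).eq_or_lt with h0 | h0
    · have : t = a := by linarith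
      rwa [this]
    · intro v hv
      have h1 := ha v hv
      have h2 := hb v hv
      have h3 : 0 < sin (b - a) := sin_pos_of_pos_of_lt_pi (by linarith) h
      have h4 : 0 ≤ sin (b - t) := sin_nonneg_of_nonneg_of_le_pi (by linarith) (by linarith)
      have h5 : 0 ≤ sin (t - a) := sin_nonneg_of_nonneg_of_le_pi (by linarith) (by linarith)
      have e1 := dot2_dirVec_combination a t b (z - v)
      simp only [dot2_sub] at e1
      have : 0 ≤ sin (b - a) * (dot2 (dirVec t) z - dot2 (dirVec t) v) := by
        rw [e1]
        exact add_nonneg (mul_nonneg h4 (by linarith)) (mul_nonneg h5 (by linarith))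
      have := nonneg_of_mul_nonneg_right this h3
      linarith

/-- If two cuts that contain a point are at least a half-turn apart, then the arc between them is
the complementary one. -/
theorem inCut_outside (hV : Wide V) {a t b : ℝ} (ha : InCut V a z) (hb : InCut V b z)
    (hba : π ≤ b - a) (hbt : b - 2 * π ≤ t) (hta : t ≤ a) : InCut V t z :=
  inCut_between hV (inCut_sub_two_pi.2 hb) ha hbt hta (by linarith)

theorem inCut_linePt {θ : ℝ} {p q : ℝ × ℝ} (hp : InCut V θ p) (hq : InCut V θ q) {t : ℝ}
    (h0 : 0 ≤ t) (h1 : t ≤ 1) : InCut V θ (linePt p q t) := by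
  intro v hv
  have := hp v hv
  have := hq v hv
  rw [dot2_linePt, dot2_sub]
  nlinarith

/-- If the line with normal at angle `θ` through the point `z` touches `V` at a point behind
`z - r rot90 (dirVec θ)`, then `z` is in no cut whose normal is slightly farther counterclockwise. -/
theorem not_inCut_add {θ r : ℝ} {v : ℝ × ℝ} (hv : v ∈ V) (hr : r < 0)
    (hz : z - v = scale2 r (rot90 (dirVec θ))) {δ : ℝ} (h0 : 0 < δ) (h1 : δ < π) :
    ¬ InCut V (θ + δ) z := by
  intro h
  have h2 := h v hv
  have h3 : dot2 (dirVec (θ + δ)) (z - v) = r * sin δ := by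
    rw [hz, dot2_scale2_right, dot2_dirVec_rot90]
  have := sin_pos_of_pos_of_lt_pi h0 h1
  rw [dot2_sub] at h3
  nlinarith

theorem not_inCut_sub {θ r : ℝ} {v : ℝ × ℝ} (hv : v ∈ V) (hr : 0 < r)
    (hz : z - v = scale2 r (rot90 (dirVec θ))) {δ : ℝ} (h0 : 0 < δ) (h1 : δ < π) :
    ¬ InCut V (θ - δ) z := by
  intro h
  have h2 := h v hv
  have h3 : dot2 (dirVec (θ - δ)) (z - v) = -(r * sin δ) := by
    rw [hz, dot2_scale2_right, sub_eq_add_neg, dot2_dirVec_rot90, sin_neg, mul_neg]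
  have := sin_pos_of_pos_of_lt_pi h0 h1
  rw [dot2_sub] at h3
  nlinarith

/-- From a point that is in some cut, there is a tangent to `V` that bounds its last cut in
counterclockwise order. -/
theorem exists_last_tangent (hV : Wide V) (hfin : V.Finite) {w : ℝ} (h : InCut V w z) :
    ∃ v' ∈ V, z ≠ v' ∧ ∀ v ∈ V, dot2 (rot90 (z - v')) (v - v') ≤ 0 := by
  set a : ℝ × ℝ → ℝ := fun v => dot2 (dirVec w) (v - z) with ha
  set b : ℝ × ℝ → ℝ := fun v => dot2 (rot90 (dirVec w)) (v - z) with hb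
  have ha0 : ∀ v ∈ V, a v ≤ 0 := by
    intro v hv
    have := h v hv
    simp only [ha, dot2_sub]
    linarith
  have key : ∀ v v', dot2 (rot90 (z - v')) (v - v') = -(a v' * b v - b v' * a v) := by
    intro v v'
    have := sin_sq_add_cos_sq w
    simp only [ha, hb, dot2, rot90, dirVec, Prod.fst_sub, Prod.snd_sub]
    linear_combination (-((z.2 - v'.2) * (v.1 - v'.1)) + (z.1 - v'.1) * (v.2 - v'.2)) *
      (-this)
  have hne : ∀ v', (a v' ≠ 0 ∨ b v' ≠ 0) → z ≠ v' := by
    rintro v' h rfl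
    simp [ha, hb, dot2] at h
  -- a vertex on the boundary line of the cut and ahead of `z`, or else the one with extreme slope
  by_cases h1 : ∃ v ∈ V, a v = 0 ∧ 0 < b v
  · obtain ⟨v', hv', e1, e2⟩ := h1
    refine ⟨v', hv', hne v' (Or.inr e2.ne'), fun v hv => ?_⟩
    have := ha0 v hv
    rw [key, e1]
    nlinarith
  · by_cases h2 : ∃ v ∈ V, a v < 0
    · obtain ⟨v', ⟨hv', e1⟩, hmin⟩ := Set.exists_min_image (V ∩ {v | a v < 0})
        (fun v => b v / a v) (hfin.subset Set.inter_subset_left)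
        (by obtain ⟨v, hv, e⟩ := h2; exact ⟨v, hv, e⟩)
      refine ⟨v', hv', hne v' (Or.inl (ne_of_lt e1)), fun v hv => ?_⟩
      rw [key, neg_nonpos]
      replace e1 : a v' < 0 := e1
      rcases (ha0 v hv).eq_or_lt with e2 | e2
      · have : b v ≤ 0 := by
          by_contra hc
          exact h1 ⟨v, hv, e2, not_le.1 hc⟩
        rw [e2]
        nlinarith
      · have h3 := hmin v ⟨hv, e2⟩
        have h4 : 0 ≤ (b v / a v - b v' / a v') * (a v * a v') :=
          mul_nonneg (by simpa using h3) (mul_pos_of_neg_of_neg e2 e1).le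
        have h5 : (b v / a v - b v' / a v') * (a v * a v') = a v' * b v - b v' * a v := by
          have := e1.ne
          have := e2.ne
          field_simp
        linarith
    · exfalso
      push Not at h2
      obtain ⟨v, hv, v', hv', hc⟩ := hV w
      have e1 := le_antisymm (ha0 v hv) (h2 v hv)
      have e2 := le_antisymm (ha0 v' hv') (h2 v' hv')
      simp only [ha, dot2_sub] at e1 e2
      exact hc (by linarith)

/-! ### The next cut -/

/-- The points of the segments `S`. -/
def segPts (S : Set ((ℝ × ℝ) × (ℝ × ℝ))) : Set (ℝ × ℝ) :=
  {z | ∃ s ∈ S, ∃ t, 0 ≤ t ∧ t ≤ 1 ∧ z = linePt s.1 s.2 t}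

/-- The cut at angle `φ + T` can follow the cut at angle `φ`: every point of the segments that the
cut meets while sweeping from `φ` to `φ + T` is in one of these two cuts. -/
def Follows (V : Set (ℝ × ℝ)) (S : Set ((ℝ × ℝ) × (ℝ × ℝ))) (φ T : ℝ) : Prop :=
  ∀ z ∈ segPts S, (∃ θ, φ ≤ θ ∧ θ < φ + T ∧ InCut V θ z) → InCut V φ z ∨ InCut V (φ + T) z

/-- The candidates for the normal of the cut that follows the cut with normal `x`: the vector `x`
itself, the last normal for an end point of a segment that is not in the current cut, and the last
normal for a point where a segment enters the current cut. In the last case, the point has to lie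
ahead of the vertex `v` where the current cut touches `V`; if it coincides with `v`, then the
segment has to lie in the cut of the candidate. -/
def IsCand (V : Set (ℝ × ℝ)) (S : Set ((ℝ × ℝ) × (ℝ × ℝ))) (x y : ℝ × ℝ) : Prop :=
  y = x ∨
  (∃ s ∈ S, ∃ v ∈ V, ∃ u ∈ V, y = rot90 (s.1 - v) ∧ dot2 x (s.1 - u) < 0 ∧ 0 < dot2 y y ∧
    ∀ w ∈ V, dot2 y (w - v) ≤ 0) ∨
  (∃ s ∈ S, ∃ v ∈ V, ∃ v' ∈ V, y = crossNormal s.1 s.2 v v' x ∧ dot2 x (s.1 - v) < 0 ∧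
    dot2 x (v - s.2) ≤ 0 ∧ (∀ w ∈ V, dot2 x (w - v) ≤ 0) ∧ 0 < dot2 y y ∧
    (∀ w ∈ V, dot2 y (w - v') ≤ 0) ∧
    (0 < cross2 (s.2 - s.1) (s.1 - v) ∨
      (cross2 (s.2 - s.1) (s.1 - v) = 0 ∧ cross2 (s.1 - v') (s.2 - s.1) ≤ 0)))

/-- The counterclockwise turn, in `(0, 2π]`, from the direction at angle `φ` to the vector `y`. -/
noncomputable def turnFrom (φ : ℝ) (y : ℝ × ℝ) : ℝ :=
  toIocMod two_pi_pos 0 (Complex.arg ⟨y.1, y.2⟩ - φ)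

theorem turnFrom_pos (φ : ℝ) (y : ℝ × ℝ) : 0 < turnFrom φ y := left_lt_toIocMod _ _ _

theorem turnFrom_le (φ : ℝ) (y : ℝ × ℝ) : turnFrom φ y ≤ 2 * π := by
  have h := toIocMod_le_right two_pi_pos 0 (Complex.arg ⟨y.1, y.2⟩ - φ)
  rwa [zero_add] at h

theorem exists_eq_scale2_turnFrom {y : ℝ × ℝ} (hy : 0 < dot2 y y) (φ : ℝ) :
    ∃ r, 0 < r ∧ y = scale2 r (dirVec (φ + turnFrom φ y)) := by
  set c : ℂ := ⟨y.1, y.2⟩ with hc0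
  have hc : c ≠ 0 := by
    intro h
    have h1 : y.1 = 0 := congrArg Complex.re h
    have h2 : y.2 = 0 := congrArg Complex.im h
    simp [dot2, h1, h2] at hy
  refine ⟨‖c‖, norm_pos_iff.2 hc, ?_⟩
  have e : φ + turnFrom φ y
      = c.arg - (toIocDiv two_pi_pos 0 (c.arg - φ) : ℤ) * (2 * π) := by
    have := self_sub_toIocDiv_zsmul two_pi_pos 0 (c.arg - φ)
    rw [zsmul_eq_mul] at this
    rw [turnFrom, ← hc0]
    linarith
  rw [e]
  have h1 := Complex.norm_mul_cos_arg c
  have h2 := Complex.norm_mul_sin_arg c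
  ext
  · rw [scale2, dirVec, cos_sub_int_mul_two_pi]; exact h1.symm
  · rw [scale2, dirVec, sin_sub_int_mul_two_pi]; exact h2.symm

theorem exists_angle_in_turn (θ φ : ℝ) :
    ∃ w, φ ≤ w ∧ w < φ + 2 * π ∧ ∃ k : ℤ, w = θ + k * (2 * π) := by
  refine ⟨toIcoMod two_pi_pos φ θ, left_le_toIcoMod _ _ _, toIcoMod_lt_right _ _ _,
    -toIcoDiv two_pi_pos φ θ, ?_⟩
  have := self_sub_toIcoDiv_zsmul two_pi_pos φ θ
  rw [zsmul_eq_mul] at this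
  push_cast
  linarith

/-- A candidate in normal position: its normal is at angle `θ`, and `z` is the point of contact. -/
theorem inCut_of_tangent {y v' : ℝ × ℝ} {θ r D : ℝ} (hr : 0 < r) (hD : 0 < D)
    (hy : y = scale2 r (dirVec θ)) (hz : y = scale2 D (rot90 (z - v')))
    (ht : ∀ w ∈ V, dot2 y (w - v') ≤ 0) :
    InCut V θ z ∧ z - v' = scale2 (-(r / D)) (rot90 (dirVec θ)) := by
  have h1 := congrArg Prod.fst (hy.symm.trans hz)
  have h2 := congrArg Prod.snd (hy.symm.trans hz)
  simp only [scale2, rot90, dirVec, Prod.fst_sub, Prod.snd_sub] at h1 h2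
  have hzv : z - v' = scale2 (-(r / D)) (rot90 (dirVec θ)) := by
    ext
    · simp only [scale2, rot90, dirVec, Prod.fst_sub]
      field_simp
      linarith
    · simp only [scale2, rot90, dirVec, Prod.snd_sub]
      field_simp
      linarith
  refine ⟨fun w hw => ?_, hzv⟩
  have h3 := ht w hw
  have h4 : dot2 (dirVec θ) (z - v') = 0 := by
    rw [hzv]; simp only [dot2, scale2, rot90, dirVec]; ring
  rw [hy, dot2_scale2_left] at h3
  have h5 : dot2 (dirVec θ) (w - v') ≤ 0 := by
    by_contra hc
    exact absurd h3 (not_le.2 (mul_pos hr (not_le.1 hc)))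
  rw [dot2_sub] at h4 h5
  linarith

/-- The point where the line through `v` with normal `x` meets the line through `p` and `q`. -/
theorem crossing_point {x p q v : ℝ × ℝ} (hD : 0 < dot2 x (q - p)) :
    dot2 x (linePt p q (dot2 x (v - p) / dot2 x (q - p))) = dot2 x v ∧
    (∀ v', crossNormal p q v v' x =
      scale2 (dot2 x (q - p)) (rot90 (linePt p q (dot2 x (v - p) / dot2 x (q - p)) - v'))) ∧
    linePt p q (dot2 x (v - p) / dot2 x (q - p)) - v =
      scale2 (cross2 (q - p) (p - v) / dot2 x (q - p)) (rot90 x) := by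
  have e : dot2 x (v - p) / dot2 x (q - p) * dot2 x (q - p) = dot2 x (v - p) :=
    div_mul_cancel₀ _ hD.ne'
  refine ⟨?_, fun v' => ?_, ?_⟩
  · rw [dot2_linePt, e, dot2_sub]; ring
  · set D := dot2 x (q - p) with hDd
    set t := dot2 x (v - p) / D with ht
    ext
    · simp only [crossNormal, ← hDd, ← e, rot90, scale2, linePt, Prod.fst_sub, Prod.snd_sub,
        Prod.snd_add]
      ring
    · simp only [crossNormal, ← hDd, ← e, rot90, scale2, linePt, Prod.fst_sub, Prod.snd_sub,
        Prod.fst_add]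
      ring
  · have hD' := hD.ne'
    simp only [dot2, Prod.fst_sub, Prod.snd_sub] at hD'
    ext
    · simp only [linePt, scale2, rot90, cross2, dot2, Prod.fst_sub, Prod.snd_sub, Prod.fst_add]
      field_simp
      ring
    · simp only [linePt, scale2, rot90, cross2, dot2, Prod.fst_sub, Prod.snd_sub, Prod.snd_add]
      field_simp
      ring

/-- Cuts are closed, so that a half-open segment in a cut has its end point there. -/
theorem inCut_linePt_of_forall_lt {θ : ℝ} {p q : ℝ × ℝ} {t₀ : ℝ} (h0 : 0 < t₀)
    (h : ∀ t, 0 ≤ t → t < t₀ → InCut V θ (linePt p q t)) : InCut V θ (linePt p q t₀) := by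
  intro v hv
  have hcont : Continuous fun t => dot2 (dirVec θ) (linePt p q t) := by
    simp only [dot2_linePt]; fun_prop
  have hlim := (hcont.tendsto t₀).mono_left (nhdsWithin_le_nhds (s := Set.Iio t₀))
  refine ge_of_tendsto hlim ?_
  filter_upwards [Ioo_mem_nhdsLT h0] with t ht
  exact h t ht.1.le ht.2 v hv

/-- No cut that follows the cut at `φ` can lie beyond a candidate. -/
theorem turn_le_of_isCand {S : Set ((ℝ × ℝ) × (ℝ × ℝ))} (hV : Wide V)
    (hS : ∀ s ∈ S, ∃ θ, InCut V θ s.1 ∧ InCut V θ s.2) {φ ρ r ψ T : ℝ} {y : ℝ × ℝ} (hρ : 0 < ρ)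
    (hy : IsCand V S (scale2 ρ (dirVec φ)) y) (hr : 0 < r) (hψ0 : 0 < ψ) (hψ : ψ ≤ 2 * π)
    (hyψ : y = scale2 r (dirVec (φ + ψ))) (hT : T ≤ 2 * π) (hF : Follows V S φ T) :
    T ≤ ψ := by
  rcases hy with rfl | ⟨s, hs, v, hv, u, hu, hy, hxu, hyy, hw⟩ |
    ⟨s, hs, v, hv, v', hv', hy, hxp, hxq, hsup, hyy, hw, hA⟩
  · -- the turn from `x` to itself is a full turn
    have h1 := congrArg Prod.fst hyψ
    have h2 := congrArg Prod.snd hyψ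
    simp only [scale2, dirVec] at h1 h2
    have e1 := sin_sq_add_cos_sq φ
    have e2 := sin_sq_add_cos_sq (φ + ψ)
    have h3 : ρ = r := by
      have : ρ ^ 2 = r ^ 2 := by
        linear_combination (-ρ ^ 2) * e1 + r ^ 2 * e2 + (ρ * cos φ + r * cos (φ + ψ)) * h1
          + (ρ * sin φ + r * sin (φ + ψ)) * h2
      exact (pow_left_inj₀ hρ.le hr.le two_ne_zero).1 this
    subst h3
    have h4 := mul_left_cancel₀ hρ.ne' h1
    have h5 := mul_left_cancel₀ hρ.ne' h2
    have h6 : cos ψ = 1 := by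
      have : cos ψ = cos (φ + ψ) * cos φ + sin (φ + ψ) * sin φ := by
        rw [← cos_sub]; congr 1; ring
      rw [this, ← h4, ← h5]; linarith
    obtain ⟨k, hk⟩ := (cos_eq_one_iff ψ).1 h6
    have hk0 : 0 < k := by
      by_contra hc
      have : (k : ℝ) ≤ 0 := by exact_mod_cast not_lt.1 hc
      nlinarith [pi_pos]
    have : (1 : ℝ) ≤ k := by exact_mod_cast hk0
    nlinarith [pi_pos]
  · -- the end point is not in the current cut, and it leaves the sweeping cut at the candidate
    have hz : ¬ InCut V φ s.1 := by
      intro h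
      have := h u hu
      rw [dot2_scale2_left, dot2_sub] at hxu
      nlinarith
    obtain ⟨hc, hzv⟩ := inCut_of_tangent (D := 1) (z := s.1) hr one_pos hyψ
      (by rw [hy]; simp [scale2]) hw
    by_contra hlt
    push Not at hlt
    have hmem : s.1 ∈ segPts S := ⟨s, hs, 0, le_rfl, zero_le_one, by simp [linePt, scale2]⟩
    have hb : InCut V (φ + T) s.1 :=
      (hF s.1 hmem ⟨φ + ψ, by linarith, by linarith, hc⟩).resolve_left hz
    rcases lt_or_ge (T - ψ) π with h | h
    · refine not_inCut_add hv (by simpa using hr) hzv (sub_pos.2 hlt) h ?_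
      convert hb using 1; ring
    · exact hz (inCut_outside hV hc hb (by linarith) (by linarith) (by linarith))
  · -- the points of the segment just before the crossing force the turn to stop
    set x := scale2 ρ (dirVec φ) with hx
    have hx' : ∀ d, dot2 x d = ρ * dot2 (dirVec φ) d := fun d => dot2_scale2_left _ _ _
    have hD : 0 < dot2 x (s.2 - s.1) := by rw [dot2_sub] at *; linarith
    obtain ⟨hc1, hc2, hc3⟩ := crossing_point (v := v) hD
    set D := dot2 x (s.2 - s.1) with hDd
    set t₀ := dot2 x (v - s.1) / D with ht₀
    set z₀ := linePt s.1 s.2 t₀ with hz₀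
    have ht0 : 0 < t₀ := div_pos (by rw [dot2_sub] at *; linarith) hD
    have ht1 : t₀ ≤ 1 := by
      rw [ht₀, div_le_one hD, hDd]
      rw [dot2_sub] at *
      rw [dot2_sub]
      linarith
    have hout : ∀ t, t < t₀ → ¬ InCut V φ (linePt s.1 s.2 t) := by
      intro t ht h
      have h1 := h v hv
      have h2 : dot2 x v ≤ dot2 x (linePt s.1 s.2 t) := by
        rw [hx', hx']; exact mul_le_mul_of_nonneg_left h1 hρ.le
      rw [← hc1, hz₀, dot2_linePt, dot2_linePt] at h2
      nlinarith
    obtain ⟨hcψ, hzv⟩ := inCut_of_tangent (z := z₀) hr hD hyψ (by rw [hy, hc2]) hw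
    have hβ : ∀ δ, 0 < δ → δ < π → ¬ InCut V (φ + ψ + δ) z₀ := fun δ h0 h1 =>
      not_inCut_add hv' (by have := div_pos hr hD; linarith) hzv h0 h1
    have hcφ : InCut V φ z₀ := by
      intro w hw
      have h1 := hsup w hw
      rw [dot2_sub, ← hc1, hx', hx'] at h1
      exact le_of_mul_le_mul_left (by linarith) hρ
    -- a common cut of the part of the segment outside of the cut at `φ`
    obtain ⟨w₀, hw1, hw2, hw3⟩ : ∃ w₀, φ < w₀ ∧ w₀ ≤ φ + ψ ∧
        ∀ t, 0 ≤ t → t ≤ t₀ → InCut V w₀ (linePt s.1 s.2 t) := by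
      rcases hA with hA | ⟨hA, hB⟩
      · obtain ⟨θ, h1, h2⟩ := hS s hs
        obtain ⟨w₀, g1, g2, k, hk⟩ := exists_angle_in_turn θ φ
        have h3 : ∀ t, 0 ≤ t → t ≤ t₀ → InCut V w₀ (linePt s.1 s.2 t) := by
          intro t ht ht'
          rw [hk, inCut_add_int_mul]
          exact inCut_linePt h1 h2 ht (ht'.trans ht1)
        have hne : φ ≠ w₀ := by
          rintro rfl
          exact hout 0 ht0 (h3 0 le_rfl ht0.le)
        have h4 := h3 t₀ ht0.le le_rfl
        have hlt : w₀ < φ + π := by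
          by_contra hc
          rcases (not_lt.1 hc).eq_or_lt with h | h
          · rw [← h] at h4
            exact not_inCut_add_pi hV hcφ h4
          · have hz₀v : z₀ - v = scale2 (cross2 (s.2 - s.1) (s.1 - v) / D * ρ)
                (rot90 (dirVec φ)) := by
              rw [hc3, hx]; simp only [scale2, rot90]; ext <;> simp <;> ring
            refine not_inCut_sub hv (mul_pos (div_pos hA hD) hρ) hz₀v
              (δ := φ + 2 * π - w₀) (by linarith) (by linarith) ?_
            have : φ - (φ + 2 * π - w₀) = w₀ - 2 * π := by ring
            rw [this, inCut_sub_two_pi]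
            exact h4
        refine ⟨w₀, lt_of_le_of_ne g1 hne, ?_, h3⟩
        by_contra hc
        refine hβ (w₀ - (φ + ψ)) (by linarith) (by linarith) ?_
        convert h4 using 1; ring
      · refine ⟨φ + ψ, by linarith, le_rfl, fun t ht ht' v₁ hv₁ => ?_⟩
        refine (hcψ v₁ hv₁).trans ?_
        have hBy : dot2 y (s.2 - s.1) ≤ 0 := by
          have : dot2 y (s.2 - s.1) = D * cross2 (s.1 - v') (s.2 - s.1) := by
            rw [hy, hc2]
            simp only [hz₀, dot2, scale2, rot90, linePt, cross2, Prod.fst_sub, Prod.snd_sub,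
              Prod.fst_add, Prod.snd_add]
            ring
          rw [this]
          nlinarith
        rw [hyψ, dot2_scale2_left] at hBy
        have : dot2 (dirVec (φ + ψ)) (s.2 - s.1) ≤ 0 := by
          by_contra hc
          exact absurd hBy (not_le.2 (mul_pos hr (not_le.1 hc)))
        rw [hz₀, dot2_linePt, dot2_linePt]
        nlinarith
    by_contra hlt
    push Not at hlt
    have hmem : ∀ t, 0 ≤ t → t < t₀ → linePt s.1 s.2 t ∈ segPts S := fun t h0 h1 =>
      ⟨s, hs, t, h0, by linarith, rfl⟩
    have hb : ∀ t, 0 ≤ t → t < t₀ → InCut V (φ + T) (linePt s.1 s.2 t) := fun t h0 h1 =>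
      (hF _ (hmem t h0 h1) ⟨w₀, hw1.le, by linarith, hw3 t h0 h1.le⟩).resolve_left (hout t h1)
    rcases lt_or_ge (T - ψ) π with h | h
    · refine hβ (T - ψ) (by linarith) h ?_
      have := inCut_linePt_of_forall_lt ht0 hb
      convert this using 1; ring
    · exact hout 0 ht0 (inCut_outside hV (hw3 0 le_rfl ht0.le) (hb 0 le_rfl ht0) (by linarith)
        (by linarith) hw1.le)

/-- If the turn to no candidate is smaller than `T`, then the part of a segment outside of the
current cut can be prolonged to an end that lies in the cut at angle `φ + T`, provided that a
common cut of the segment has its normal between. -/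
theorem exists_end_inCut {S : Set ((ℝ × ℝ) × (ℝ × ℝ))} (hV : Wide V) (hfin : V.Finite)
    (hsymm : ∀ s ∈ S, (s.2, s.1) ∈ S) {φ ρ T w₀ : ℝ} (hρ : 0 < ρ) (hT : T ≤ 2 * π)
    (hmin : ∀ y, IsCand V S (scale2 ρ (dirVec φ)) y → 0 < dot2 y y → T ≤ turnFrom φ y)
    {p q : ℝ × ℝ} (hs : (p, q) ∈ S) (hp : InCut V w₀ p) (hq : InCut V w₀ q) (hφ : φ < w₀)
    (hwT : w₀ < φ + T) {t : ℝ} (h0 : 0 ≤ t) (h1 : t ≤ 1)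
    (hz : ¬ InCut V φ (linePt p q t)) :
    ∃ t', t ≤ t' ∧ InCut V (φ + T) (linePt p q t') := by
  set x := scale2 ρ (dirVec φ) with hx
  have hx' : ∀ d, dot2 x d = ρ * dot2 (dirVec φ) d := fun d => dot2_scale2_left _ _ _
  by_cases hcq : InCut V φ q
  · -- the segment enters the current cut beyond the given point
    have hcp : ¬ InCut V φ p := fun h => hz (inCut_linePt h hcq h0 h1)
    obtain ⟨v, hv, hvmax⟩ := Set.exists_max_image V (fun v => dot2 x v) hfin
      (by obtain ⟨v, hv, -⟩ := hV 0; exact ⟨v, hv⟩)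
    have hxp : dot2 x (p - v) < 0 := by
      by_contra hc
      refine hcp fun u hu => ?_
      have e1 := hvmax u hu
      rw [dot2_sub] at hc
      simp only [hx'] at e1 hc
      exact le_of_mul_le_mul_left (by linarith) hρ
    have hxq : dot2 x (v - q) ≤ 0 := by
      have := mul_le_mul_of_nonneg_left (hcq v hv) hρ.le
      rw [dot2_sub, hx', hx']
      linarith
    have hD : 0 < dot2 x (q - p) := by rw [dot2_sub] at *; linarith
    obtain ⟨hc1, hc2, hc3⟩ := crossing_point (v := v) hD
    set D := dot2 x (q - p) with hDd
    set t₀ := dot2 x (v - p) / D with ht₀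
    set z₀ := linePt p q t₀ with hz₀
    have ht0 : 0 < t₀ := div_pos (by rw [dot2_sub] at *; linarith) hD
    have ht1 : t₀ ≤ 1 := by
      rw [ht₀, div_le_one hD, hDd]
      rw [dot2_sub] at *
      rw [dot2_sub]
      linarith
    have hcφ : InCut V φ z₀ := by
      intro w hw
      have e1 := hvmax w hw
      rw [← hc1, hx', hx'] at e1
      exact le_of_mul_le_mul_left e1 hρ
    have hcw : InCut V w₀ z₀ := inCut_linePt hp hq ht0.le ht1
    have htt : t ≤ t₀ := by
      by_contra hc
      push Not at hc
      refine hz fun u hu => ?_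
      have e1 := hvmax u hu
      rw [← hc1, hz₀] at e1
      have e2 : dot2 x (linePt p q t₀) ≤ dot2 x (linePt p q t) := by
        rw [dot2_linePt, dot2_linePt]; nlinarith
      have e3 := e1.trans e2
      rw [hx', hx'] at e3
      exact le_of_mul_le_mul_left e3 hρ
    refine ⟨t₀, htt, ?_⟩
    rw [← hz₀]
    -- it suffices that the normal of the common cut is more than a half-turn away
    have hfar : φ + π ≤ w₀ → InCut V (φ + T) z₀ := fun h =>
      inCut_between hV hcw (inCut_add_two_pi.2 hcφ) hwT.le (by linarith) (by linarith)
    obtain ⟨v', hv', hne, htan⟩ := exists_last_tangent hV hfin hcw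
    set y := crossNormal p q v v' x with hy
    have hyz := hc2 v'
    rw [← hy] at hyz
    have hyy : 0 < dot2 y y := by
      have e : dot2 y y = D ^ 2 * ((z₀.1 - v'.1) ^ 2 + (z₀.2 - v'.2) ^ 2) := by
        rw [hyz]; simp only [dot2, scale2, rot90, Prod.fst_sub, Prod.snd_sub]; ring
      rw [e]
      refine mul_pos (by positivity) ?_
      by_contra hc
      have e1 : (z₀.1 - v'.1) ^ 2 = 0 := by nlinarith [sq_nonneg (z₀.1 - v'.1), sq_nonneg (z₀.2 - v'.2)]
      have e2 : (z₀.2 - v'.2) ^ 2 = 0 := by nlinarith [sq_nonneg (z₀.1 - v'.1), sq_nonneg (z₀.2 - v'.2)]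
      exact hne (Prod.ext (sub_eq_zero.1 (pow_eq_zero_iff two_ne_zero |>.1 e1))
        (sub_eq_zero.1 (pow_eq_zero_iff two_ne_zero |>.1 e2)))
    obtain ⟨r, hr, hyψ⟩ := exists_eq_scale2_turnFrom hyy φ
    have hψ0 := turnFrom_pos φ y
    have hψ := turnFrom_le φ y
    set ψ := turnFrom φ y with hψd
    have htan' : ∀ w ∈ V, dot2 y (w - v') ≤ 0 := by
      intro w hw
      rw [hyz, dot2_scale2_left]
      exact mul_nonpos_of_nonneg_of_nonpos hD.le (htan w hw)
    obtain ⟨hcψ, hzv⟩ := inCut_of_tangent (z := z₀) hr hD hyψ hyz htan'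
    have hβ : ∀ δ, 0 < δ → δ < π → ¬ InCut V (φ + ψ + δ) z₀ := fun δ h0 h1 =>
      not_inCut_add hv' (by have := div_pos hr hD; linarith) hzv h0 h1
    have hz₀v : z₀ - v = scale2 (cross2 (q - p) (p - v) / D * ρ) (rot90 (dirVec φ)) := by
      rw [hc3, hx]; simp only [scale2, rot90]; ext <;> simp <;> ring
    by_cases hacc : 0 < cross2 (q - p) (p - v) ∨
        (cross2 (q - p) (p - v) = 0 ∧ cross2 (p - v') (q - p) ≤ 0)
    · have hTψ := hmin y (Or.inr (Or.inr ⟨(p, q), hs, v, hv, v', hv', rfl, hxp, hxq,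
        fun w hw => by rw [dot2_sub]; have := hvmax w hw; linarith,
        hyy, htan', hacc⟩)) hyy
      rcases le_or_gt (φ + ψ - w₀) π with h | h
      · exact inCut_between hV hcw hcψ hwT.le (by linarith) h
      · exfalso
        refine hβ (2 * π - (φ + ψ - w₀)) (by linarith) (by linarith) ?_
        have : φ + ψ + (2 * π - (φ + ψ - w₀)) = w₀ + 2 * π := by ring
        rw [this, inCut_add_two_pi]
        exact hcw
    · push Not at hacc
      obtain ⟨hA, hB⟩ := hacc
      apply hfar
      by_contra hlt
      push Not at hlt
      rcases hA.eq_or_lt with hA | hA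
      · -- the crossing is at the vertex `v` itself
        have hB := hB hA
        have hzv0 : z₀ = v := by
          rw [hA] at hz₀v
          have e1 := congrArg Prod.fst hz₀v
          have e2 := congrArg Prod.snd hz₀v
          simp [scale2] at e1 e2
          exact Prod.ext (sub_eq_zero.1 e1) (sub_eq_zero.1 e2)
        have hψπ : ψ < π := by
          by_contra hc
          push Not at hc
          have hnear : φ + ψ - w₀ < π := by
            by_contra hc'
            rcases (not_lt.1 hc').eq_or_lt with h | h
            · have : φ + ψ = w₀ + π := by linarith
              rw [this] at hcψ
              exact not_inCut_add_pi hV hcw hcψ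
            · refine hβ (2 * π - (φ + ψ - w₀)) (by linarith) (by linarith) ?_
              have : φ + ψ + (2 * π - (φ + ψ - w₀)) = w₀ + 2 * π := by ring
              rw [this, inCut_add_two_pi]
              exact hcw
          rcases hc.eq_or_lt with h | h
          · rw [← h] at hcψ
            exact not_inCut_add_pi hV hcφ hcψ
          · refine hβ (2 * π - ψ) (by linarith) (by linarith) ?_
            have : φ + ψ + (2 * π - ψ) = φ + 2 * π := by ring
            rw [this, inCut_add_two_pi]
            exact hcφ
        have hwψ : w₀ ≤ φ + ψ := by
          by_contra hc
          refine hβ (w₀ - (φ + ψ)) (by linarith) (by linarith) ?_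
          convert hcw using 1; ring
        have d1 : dot2 (dirVec φ) (p - z₀) < 0 := by
          rw [hzv0]
          rw [hx'] at hxp
          by_contra hc
          exact absurd hxp (not_lt.2 (mul_nonneg hρ.le (not_lt.1 hc)))
        have d2 : dot2 (dirVec (φ + ψ)) (p - z₀) < 0 := by
          have e1 : dot2 y (p - z₀) = -(t₀ * D * cross2 (p - v') (q - p)) := by
            rw [hyz]
            simp only [hz₀, dot2, scale2, rot90, linePt, cross2, Prod.fst_sub, Prod.snd_sub,
              Prod.fst_add, Prod.snd_add]
            ring
          have e2 : 0 < t₀ * D * cross2 (p - v') (q - p) := by positivity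
          rw [hyψ, dot2_scale2_left] at e1
          by_contra hc
          have := mul_nonneg hr.le (not_lt.1 hc)
          linarith
        have d3 : 0 ≤ dot2 (dirVec w₀) (p - z₀) := by
          rw [hzv0, dot2_sub]
          have := hp v hv
          linarith
        have e := dot2_dirVec_combination φ w₀ (φ + ψ) (p - z₀)
        have s1 : 0 < sin (φ + ψ - φ) := sin_pos_of_pos_of_lt_pi (by linarith) (by linarith)
        have s2 : 0 ≤ sin (φ + ψ - w₀) := sin_nonneg_of_nonneg_of_le_pi (by linarith) (by linarith)
        have s3 : 0 < sin (w₀ - φ) := sin_pos_of_pos_of_lt_pi (by linarith) (by linarith)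
        nlinarith [mul_nonneg s1.le d3, mul_nonneg s2 (neg_pos.2 d1).le, mul_pos s3 (neg_pos.2 d2)]
      · -- the crossing is behind the vertex `v`, so that the current cut is the last one there
        refine not_inCut_add hv (mul_neg_of_neg_of_pos (div_neg_of_neg_of_pos hA hD) hρ) hz₀v
          (δ := w₀ - φ) (by linarith) (by linarith) ?_
        convert hcw using 1; ring
  · -- the end of the segment is not in the current cut
    refine ⟨1, h1, ?_⟩
    have e : linePt p q 1 = q := by ext <;> simp [linePt, scale2]
    rw [e]
    obtain ⟨v', hv', hne, htan⟩ := exists_last_tangent hV hfin hq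
    obtain ⟨u, hu, hux⟩ : ∃ u ∈ V, dot2 x (q - u) < 0 := by
      simp only [InCut, not_forall, not_le] at hcq
      obtain ⟨u, hu, h⟩ := hcq
      refine ⟨u, hu, ?_⟩
      have := mul_lt_mul_of_pos_left h hρ
      rw [dot2_sub, hx', hx']
      linarith
    have hyy : 0 < dot2 (rot90 (q - v')) (rot90 (q - v')) := by
      have e : dot2 (rot90 (q - v')) (rot90 (q - v')) = (q.1 - v'.1) ^ 2 + (q.2 - v'.2) ^ 2 := by
        simp only [dot2, rot90, Prod.fst_sub, Prod.snd_sub]; ring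
      rw [e]
      by_contra hc
      have e1 : (q.1 - v'.1) ^ 2 = 0 := by nlinarith [sq_nonneg (q.1 - v'.1), sq_nonneg (q.2 - v'.2)]
      have e2 : (q.2 - v'.2) ^ 2 = 0 := by nlinarith [sq_nonneg (q.1 - v'.1), sq_nonneg (q.2 - v'.2)]
      exact hne (Prod.ext (sub_eq_zero.1 (pow_eq_zero_iff two_ne_zero |>.1 e1))
        (sub_eq_zero.1 (pow_eq_zero_iff two_ne_zero |>.1 e2)))
    obtain ⟨r, hr, hyψ⟩ := exists_eq_scale2_turnFrom hyy φ
    have hψ0 := turnFrom_pos φ (rot90 (q - v'))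
    have hψ := turnFrom_le φ (rot90 (q - v'))
    set ψ := turnFrom φ (rot90 (q - v')) with hψd
    have hTψ := hmin _ (Or.inr (Or.inl ⟨(q, p), hsymm _ hs, v', hv', u, hu, rfl, hux, hyy,
      htan⟩)) hyy
    obtain ⟨hcψ, -⟩ := inCut_of_tangent (D := 1) (z := q) hr one_pos hyψ (by simp [scale2]) htan
    rcases le_or_gt (φ + ψ - w₀) π with h | h
    · exact inCut_between hV hq hcψ hwT.le (by linarith) h
    · exact absurd (inCut_outside hV hq hcψ h.le (by linarith) hφ.le) hcq

/-- A turn that is no larger than those to the candidates leads to a cut that can follow. -/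
theorem follows_of_le_turn {S : Set ((ℝ × ℝ) × (ℝ × ℝ))} (hV : Wide V) (hfin : V.Finite)
    (hS : ∀ s ∈ S, ∃ θ, InCut V θ s.1 ∧ InCut V θ s.2) (hsymm : ∀ s ∈ S, (s.2, s.1) ∈ S)
    {φ ρ T : ℝ} (hρ : 0 < ρ) (hT : T ≤ 2 * π)
    (hmin : ∀ y, IsCand V S (scale2 ρ (dirVec φ)) y → 0 < dot2 y y → T ≤ turnFrom φ y) :
    Follows V S φ T := by
  rintro z ⟨⟨p, q⟩, hs, t, ht0, ht1, rfl⟩ ⟨θ, hθ1, hθ2, hθ⟩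
  refine or_iff_not_imp_left.2 fun hz => ?_
  simp only at *
  obtain ⟨θ', h1, h2⟩ := hS _ hs
  obtain ⟨w₀, g1, g2, k, hk⟩ := exists_angle_in_turn θ' φ
  rw [← inCut_add_int_mul k, ← hk] at h1 h2
  have hzw := inCut_linePt h1 h2 ht0 ht1
  have hne : φ ≠ w₀ := by
    rintro rfl
    exact hz hzw
  have hφw := lt_of_le_of_ne g1 hne
  rcases le_or_gt (φ + T) w₀ with h | h
  · rcases le_or_gt (w₀ - θ) π with h' | h'
    · exact inCut_between hV hθ hzw hθ2.le h h'
    · exact absurd (inCut_outside hV hθ hzw h'.le (by linarith) hθ1) hz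
  · -- the new cut contains a point of the line on either side
    obtain ⟨t₁, e1, c1⟩ := exists_end_inCut hV hfin hsymm hρ hT hmin hs h1 h2 hφw h ht0 ht1 hz
    have hrev : ∀ t, linePt q p t = linePt p q (1 - t) := by
      intro t; ext <;> simp [linePt, scale2] <;> ring
    obtain ⟨t₂, e2, c2⟩ := exists_end_inCut hV hfin hsymm hρ hT hmin (hsymm _ hs) h2 h1 hφw h
      (t := 1 - t) (by linarith) (by linarith) (by rw [hrev]; simpa using hz)
    rw [hrev] at c2
    intro v hv
    have d1 := c1 v hv
    have d2 := c2 v hv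
    rw [dot2_linePt] at *
    -- the parameter `t` lies between `1 - t₂` and `t₁`
    rcases le_total 0 (dot2 (dirVec (φ + T)) (q - p)) with hm | hm
    · nlinarith
    · nlinarith

end Cuts


/-! ### Exact signs of quadratic irrationals -/

section Signs

/-- The integer `s` is the sign of the real number `x`. -/
def IsSign (s : ℤ) (x : ℝ) : Prop := (0 < x ∧ s = 1) ∨ (x = 0 ∧ s = 0) ∨ (x < 0 ∧ s = -1)

theorem isSign_sign (n : ℤ) : IsSign (Int.sign n) n := by
  rcases lt_trichotomy n 0 with h | h | h
  · exact Or.inr (Or.inr ⟨by exact_mod_cast h, Int.sign_eq_neg_one_of_neg h⟩)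
  · exact Or.inr (Or.inl ⟨by exact_mod_cast h, by simp [h]⟩)
  · exact Or.inl ⟨by exact_mod_cast h, Int.sign_eq_one_of_pos h⟩

theorem IsSign.pos_iff {s : ℤ} {x : ℝ} (h : IsSign s x) : 0 < s ↔ 0 < x := by
  rcases h with ⟨h, rfl⟩ | ⟨h, rfl⟩ | ⟨h, rfl⟩
  · simp [h]
  · simp [h]
  · simp [h.le]

theorem IsSign.neg_iff {s : ℤ} {x : ℝ} (h : IsSign s x) : s < 0 ↔ x < 0 := by
  rcases h with ⟨h, rfl⟩ | ⟨h, rfl⟩ | ⟨h, rfl⟩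
  · simp [h.le]
  · simp [h]
  · simp [h]

theorem IsSign.zero_iff {s : ℤ} {x : ℝ} (h : IsSign s x) : s = 0 ↔ x = 0 := by
  rcases h with ⟨h, rfl⟩ | ⟨h, rfl⟩ | ⟨h, rfl⟩
  · simp [h.ne']
  · simp [h]
  · simp [h.ne]

theorem IsSign.of_mul_pos {s : ℤ} {x c : ℝ} (hc : 0 < c) (h : IsSign s (c * x)) : IsSign s x := by
  rcases h with ⟨h, e⟩ | ⟨h, e⟩ | ⟨h, e⟩
  · exact Or.inl ⟨pos_of_mul_pos_right h hc.le, e⟩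
  · exact Or.inr (Or.inl ⟨(mul_eq_zero.1 h).resolve_left hc.ne', e⟩)
  · exact Or.inr (Or.inr ⟨by by_contra hx; exact absurd h (not_lt.2 (mul_nonneg hc.le (not_lt.1 hx))), e⟩)

theorem IsSign.mul_pos {s : ℤ} {x c : ℝ} (hc : 0 < c) (h : IsSign s x) : IsSign s (c * x) := by
  rcases h with ⟨h, e⟩ | ⟨h, e⟩ | ⟨h, e⟩
  · exact Or.inl ⟨_root_.mul_pos hc h, e⟩
  · exact Or.inr (Or.inl ⟨by simp [h], e⟩)
  · exact Or.inr (Or.inr ⟨mul_neg_of_pos_of_neg hc h, e⟩)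

theorem isSign_combineSigns {a b d : ℤ} {A B : ℝ} (ha : IsSign a A) (hb : IsSign b B)
    (hd : IsSign d (A * A - B * B)) : IsSign (combineSigns a b d) (A + B) := by
  unfold combineSigns
  rcases ha with ⟨ha, rfl⟩ | ⟨ha, rfl⟩ | ⟨ha, rfl⟩ <;>
    rcases hb with ⟨hb, rfl⟩ | ⟨hb, rfl⟩ | ⟨hb, rfl⟩
  · exact Or.inl ⟨by linarith, by simp⟩
  · exact Or.inl ⟨by linarith, by simp⟩
  · have e : A * A - B * B = (A - B) * (A + B) := by ring
    rw [e] at hd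
    simpa using hd.of_mul_pos (by linarith)
  · exact Or.inl ⟨by linarith, by simp⟩
  · exact Or.inr (Or.inl ⟨by linarith, by simp⟩)
  · exact Or.inr (Or.inr ⟨by linarith, by simp⟩)
  · have e : A * A - B * B = (B - A) * (-(A + B)) := by ring
    rw [e] at hd
    have h := hd.of_mul_pos (by linarith)
    rcases h with ⟨h, rfl⟩ | ⟨h, rfl⟩ | ⟨h, rfl⟩
    · exact Or.inr (Or.inr ⟨by linarith, by simp⟩)
    · exact Or.inr (Or.inl ⟨by linarith, by simp⟩)
    · exact Or.inl ⟨by linarith, by simp⟩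
  · exact Or.inr (Or.inr ⟨by linarith, by simp⟩)
  · exact Or.inr (Or.inr ⟨by linarith, by simp⟩)

theorem isSign_sign_mul_sqrt (v : ℤ) {D : ℤ} (hD : 0 ≤ D) :
    IsSign (Int.sign (v * D)) (v * √(D : ℝ)) := by
  rcases hD.eq_or_lt with h | h
  · subst h
    exact Or.inr (Or.inl ⟨by simp, by simp⟩)
  · have h' : (0 : ℝ) < D := by exact_mod_cast h
    have h1 := isSign_sign (v * D)
    refine IsSign.of_mul_pos (Real.sqrt_pos.2 h') ?_
    convert h1 using 1
    push_cast
    rw [mul_left_comm, Real.mul_self_sqrt h'.le]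

theorem isSign_radSign (u v : ℤ) {D : ℤ} (hD : 0 ≤ D) :
    IsSign (radSign u v D) (u + v * √(D : ℝ)) := by
  have h' : (0 : ℝ) ≤ D := by exact_mod_cast hD
  refine isSign_combineSigns (isSign_sign u) (isSign_sign_mul_sqrt v hD) ?_
  convert isSign_sign (u * u - v * v * D) using 1
  push_cast
  linear_combination (-(v : ℝ) * v) * Real.mul_self_sqrt h'

theorem isSign_radSign₂ (u v w : ℤ) {D E : ℤ} (hD : 0 ≤ D) (hE : 0 ≤ E) :
    IsSign (radSign₂ u v D w E) (u + v * √(D : ℝ) + w * √(E : ℝ)) := by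
  have h' : (0 : ℝ) ≤ D := by exact_mod_cast hD
  have h'' : (0 : ℝ) ≤ E := by exact_mod_cast hE
  refine isSign_combineSigns (isSign_radSign u v hD) (isSign_sign_mul_sqrt w hE) ?_
  convert isSign_radSign (u * u + v * v * D - w * w * E) (2 * u * v) hD using 1
  push_cast
  linear_combination ((v : ℝ) * v) * Real.mul_self_sqrt h' -
    ((w : ℝ) * w) * Real.mul_self_sqrt h''

/-- The real number represented by a root. -/
noncomputable def rootVal (r : QuadRoot) : ℝ := (r.2.1 + r.2.2.1 * √(r.2.2.2 : ℝ)) / r.1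

/-- The denominator is positive and the radicand is nonnegative. -/
def RootOk (r : QuadRoot) : Prop := 0 < r.1 ∧ 0 ≤ r.2.2.2

/-- The value of the polynomial at `τ`. -/
def quadEval (q : Quad) (τ : ℝ) : ℝ := q.1 + q.2.1 * τ + q.2.2 * (τ * τ)

theorem rootLt_iff {r r' : QuadRoot} (h : RootOk r) (h' : RootOk r') :
    rootLt r r' = true ↔ rootVal r < rootVal r' := by
  have h1 : (0 : ℝ) < r.1 := by exact_mod_cast h.1
  have h2 : (0 : ℝ) < r'.1 := by exact_mod_cast h'.1
  have e := isSign_radSign₂ (r.2.1 * r'.1 - r'.2.1 * r.1) (r.2.2.1 * r'.1) (-(r'.2.2.1 * r.1))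
    h.2 h'.2
  rw [rootLt, decide_eq_true_eq, e.neg_iff, rootVal, rootVal, div_lt_div_iff₀ h1 h2]
  push_cast
  constructor <;> intro h <;> linarith

theorem rootPos_iff {r : QuadRoot} (h : RootOk r) : rootPos r = true ↔ 0 < rootVal r := by
  have h1 : (0 : ℝ) < r.1 := by exact_mod_cast h.1
  rw [rootPos, decide_eq_true_eq, (isSign_radSign _ _ h.2).pos_iff, rootVal, lt_div_iff₀ h1, zero_mul]

theorem isSign_signAtRoot {r : QuadRoot} (h : RootOk r) (q : Quad) :
    IsSign (signAtRoot r q) (quadEval q (rootVal r)) := by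
  have h1 : (0 : ℝ) < r.1 := by exact_mod_cast h.1
  have h2 : (0 : ℝ) ≤ r.2.2.2 := by exact_mod_cast h.2
  refine IsSign.of_mul_pos (c := r.1 * r.1) (by positivity) ?_
  have key := isSign_radSign (q.1 * (r.1 * r.1) + q.2.1 * (r.1 * r.2.1)
      + q.2.2 * (r.2.1 * r.2.1 + r.2.2.1 * r.2.2.1 * r.2.2.2))
    (q.2.1 * (r.1 * r.2.2.1) + 2 * q.2.2 * (r.2.1 * r.2.2.1)) h.2
  rw [← signAtRoot] at key
  refine (congrArg (IsSign _) ?_).mpr key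
  simp only [quadEval, rootVal]
  push_cast
  field_simp
  rw [add_sq, mul_pow, Real.sq_sqrt h2]
  ring

theorem quadEval_eq_taylor (q : Quad) (ρ τ : ℝ) :
    quadEval q τ = quadEval q ρ + quadEval (derivQuad q) ρ * (τ - ρ) + q.2.2 * (τ - ρ) ^ 2 := by
  simp only [quadEval, derivQuad]; push_cast; ring

theorem continuous_quadEval (q : Quad) : Continuous (quadEval q) := by
  unfold quadEval; fun_prop

/-- A continuous function without zeros on an interval has constant sign there. -/
theorem isSign_of_forall_ne {f : ℝ → ℝ} (hf : Continuous f) {a b : ℝ} (hab : a ≤ b) {s : ℤ}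
    (hs : IsSign s (f a)) (h : ∀ x ∈ Set.Icc a b, f x ≠ 0) : IsSign s (f b) := by
  rcases hs with ⟨h1, e⟩ | ⟨h1, e⟩ | ⟨h1, e⟩
  · refine Or.inl ⟨?_, e⟩
    by_contra hc
    obtain ⟨x, hx, hx0⟩ := intermediate_value_Icc' hab hf.continuousOn ⟨not_lt.1 hc, h1.le⟩
    exact h x hx hx0
  · exact absurd h1 (h a ⟨le_rfl, hab⟩)
  · refine Or.inr (Or.inr ⟨?_, e⟩)
    by_contra hc
    obtain ⟨x, hx, hx0⟩ := intermediate_value_Icc hab hf.continuousOn ⟨h1.le, not_lt.1 hc⟩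
    exact h x hx hx0

theorem int_mul_self_lt_one_iff (a : ℤ) : a * a < 1 ↔ a = 0 := by
  constructor
  · intro h; by_contra hc
    have : 0 < a * a := mul_self_pos.2 hc
    omega
  · rintro rfl; norm_num

/-- The signs computed for the right of a root are those at all points up to the next root. -/
theorem isSign_signAt_right {r : QuadRoot} (h : RootOk r) (q : Quad) {τ : ℝ} (hτ : rootVal r < τ)
    (hq : ∀ x, rootVal r < x → x ≤ τ → quadEval q x = 0 → ∀ y, quadEval q y = 0) :
    IsSign (signAt (r, true) q) (quadEval q τ) := by
  by_cases hz : ∀ y, quadEval q y = 0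
  · have h0 := hz 0
    have h1 := hz 1
    have h2 := hz (-1)
    simp only [quadEval] at h0 h1 h2
    have e0 : q.1 = 0 := by
      have : (q.1 : ℝ) = 0 := by linarith
      exact_mod_cast this
    have e1 : q.2.1 = 0 := by
      have : (q.2.1 : ℝ) = 0 := by linarith
      exact_mod_cast this
    have e2 : q.2.2 = 0 := by
      have : (q.2.2 : ℝ) = 0 := by linarith
      exact_mod_cast this
    refine Or.inr (Or.inl ⟨hz τ, ?_⟩)
    simp [signAt, signAtRoot, derivQuad, e0, e1, e2, firstNonzero, radSign, combineSigns]
  · have hne : ∀ x, rootVal r < x → x ≤ τ → quadEval q x ≠ 0 := fun x h1 h2 h3 => hz (hq x h1 h2 h3)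
    have s0 := isSign_signAtRoot h q
    have s1 := isSign_signAtRoot h (derivQuad q)
    have hpos : 0 < τ - rootVal r := sub_pos.2 hτ
    simp only [signAt, firstNonzero, decide_eq_true_eq, int_mul_self_lt_one_iff, if_true]
    by_cases c0 : signAtRoot r q = 0
    · have c0' := s0.zero_iff.1 c0
      -- the factor `x - rootVal r` splits off
      have tay : ∀ x, quadEval q x = (x - rootVal r) * (quadEval (derivQuad q) (rootVal r)
          + q.2.2 * (x - rootVal r)) := by
        intro x
        rw [quadEval_eq_taylor q (rootVal r) x, c0']; ring
      rw [if_pos c0, tay]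
      refine IsSign.mul_pos hpos ?_
      by_cases c1 : signAtRoot r (derivQuad q) = 0
      · rw [if_pos c1, s1.zero_iff.1 c1, zero_add, mul_comm]
        exact (isSign_sign _).mul_pos hpos
      · rw [if_neg c1]
        refine isSign_of_forall_ne (f := fun x => quadEval (derivQuad q) (rootVal r)
          + q.2.2 * (x - rootVal r)) (by fun_prop) hτ.le (by simpa using s1) ?_
        rintro x ⟨hx1, hx2⟩ hx0
        rcases hx1.eq_or_lt with rfl | hx1
        · apply c1
          rw [s1.zero_iff]
          simpa using hx0
        · refine hne x hx1 hx2 ?_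
          rw [tay, hx0, mul_zero]
    · rw [if_neg c0]
      refine isSign_of_forall_ne (continuous_quadEval q) hτ.le s0 ?_
      rintro x ⟨hx1, hx2⟩ hx0
      rcases hx1.eq_or_lt with rfl | hx1
      · exact c0 (s0.zero_iff.2 hx0)
      · exact hne x hx1 hx2 hx0

theorem quadRoots_ok {q : Quad} {r : QuadRoot} (hr : r ∈ quadRoots q) : RootOk r := by
  have key : ∀ a : ℤ, a ≠ 0 → 0 < a * Int.sign a := fun a ha => by
    rw [Int.mul_sign_self]; positivity
  unfold quadRoots at hr
  simp only [decide_eq_true_eq, int_mul_self_lt_one_iff] at hr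
  split_ifs at hr with h1 h2 h3
  · simp at hr
  · rw [List.mem_singleton] at hr
    subst hr
    exact ⟨key _ h2, le_rfl⟩
  · simp at hr
  · have h4 := key _ h1
    simp only [List.mem_cons, List.not_mem_nil, or_false] at hr
    rcases hr with rfl | rfl <;> exact ⟨by simp only [mul_assoc]; linarith, not_lt.1 h3⟩

/-- The quadratic formula. The factor `Int.sign q.2.2` makes the denominator positive. -/
theorem exists_mem_quadRoots {q : Quad} (hq : ∃ y, quadEval q y ≠ 0) {τ : ℝ}
    (hτ : quadEval q τ = 0) : ∃ r ∈ quadRoots q, rootVal r = τ := by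
  unfold quadRoots
  simp only [decide_eq_true_eq, int_mul_self_lt_one_iff]
  obtain ⟨a, b, c⟩ := q
  simp only [quadEval] at *
  split_ifs with h1 h2 h3
  · obtain ⟨y, hy⟩ := hq
    simp only [h1, h2] at *
    simp_all
  · subst h1
    refine ⟨_, List.mem_singleton_self _, ?_⟩
    have hb : (b : ℝ) ≠ 0 := by exact_mod_cast h2
    have hs : (Int.sign b : ℝ) ≠ 0 := by exact_mod_cast (by simpa using h2 : Int.sign b ≠ 0)
    simp only [rootVal]
    push_cast at *
    rw [div_eq_iff (mul_ne_zero hb hs)]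
    linear_combination (-(Int.sign b : ℝ)) * hτ
  · exfalso
    have h3' : (b : ℝ) * b - 4 * a * c < 0 := by exact_mod_cast h3
    have hsq : (2 * c * τ + b) ^ 2 = (b : ℝ) * b - 4 * a * c := by
      linear_combination (4 * (c : ℝ)) * hτ
    nlinarith [sq_nonneg (2 * c * τ + b)]
  · have hD : (0 : ℝ) ≤ (b : ℝ) * b - 4 * a * c := by exact_mod_cast not_lt.1 h3
    have hc : (c : ℝ) ≠ 0 := by exact_mod_cast h1
    have hsq : (2 * c * τ + b) ^ 2 = (b : ℝ) * b - 4 * a * c := by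
      linear_combination (4 * (c : ℝ)) * hτ
    have hs : (Int.sign c : ℝ) = 1 ∨ (Int.sign c : ℝ) = -1 := by
      rcases Int.sign_trichotomy c with h | h | h
      · exact Or.inl (by exact_mod_cast h)
      · exact absurd (Int.sign_eq_zero_iff_zero.1 h) h1
      · exact Or.inr (by exact_mod_cast h)
    have hs0 : (Int.sign c : ℝ) ≠ 0 := by rcases hs with h | h <;> rw [h] <;> norm_num
    have h5 : (2 * c * τ + b) = √((b : ℝ) * b - 4 * a * c) ∨
        (2 * c * τ + b) = -√((b : ℝ) * b - 4 * a * c) := by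
      rw [← sq_eq_sq_iff_eq_or_eq_neg, Real.sq_sqrt hD, hsq]
    have h6 : Int.sign c * (2 * c * τ + b) = √((b : ℝ) * b - 4 * a * c) ∨
        Int.sign c * (2 * c * τ + b) = -√((b : ℝ) * b - 4 * a * c) := by
      rcases hs with h | h <;> rw [h] <;> rcases h5 with h5 | h5 <;> rw [h5] <;> simp
    rcases h6 with h6 | h6
    · refine ⟨_, List.mem_cons_self, ?_⟩
      simp only [rootVal]
      push_cast
      rw [div_eq_iff (mul_ne_zero (mul_ne_zero two_ne_zero hc) hs0), ← h6]
      ring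
    · refine ⟨_, List.mem_cons_of_mem _ (List.mem_singleton_self _), ?_⟩
      simp only [rootVal]
      push_cast
      rw [div_eq_iff (mul_ne_zero (mul_ne_zero two_ne_zero hc) hs0)]
      linear_combination -h6

/-- Insertion keeps the list sorted, and keeps the set of values except for the new one. -/
theorem insertRoot_spec {l : List QuadRoot} {r : QuadRoot} (hl : ∀ x ∈ l, RootOk x)
    (hr : RootOk r) (hs : l.Pairwise fun x y => rootVal x < rootVal y) :
    (insertRoot l r).Pairwise (fun x y => rootVal x < rootVal y) ∧
      (∀ x ∈ insertRoot l r, x = r ∨ x ∈ l) ∧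
      ∀ x, x = r ∨ x ∈ l → ∃ y ∈ insertRoot l r, rootVal y = rootVal x := by
  have hmem : ∀ x, x ∈ insertRoot l r ↔
      (x ∈ l ∧ rootVal x < rootVal r) ∨ x = r ∨ (x ∈ l ∧ rootVal r < rootVal x) := by
    intro x
    simp only [insertRoot, List.mem_append, List.mem_filter, List.mem_cons, Bool.and_eq_true,
      Bool.not_eq_true', ← Bool.not_eq_true]
    have h1 : x ∈ l → (rootLt x r = true ↔ rootVal x < rootVal r) := fun h => rootLt_iff (hl x h) hr
    have h2 : x ∈ l → (rootLt r x = true ↔ rootVal r < rootVal x) := fun h => rootLt_iff hr (hl x h)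
    constructor
    · rintro (⟨h, h'⟩ | rfl | ⟨h, -, h'⟩)
      · exact Or.inl ⟨h, (h1 h).1 h'⟩
      · exact Or.inr (Or.inl rfl)
      · exact Or.inr (Or.inr ⟨h, (h2 h).1 h'⟩)
    · rintro (⟨h, h'⟩ | rfl | ⟨h, h'⟩)
      · exact Or.inl ⟨h, (h1 h).2 h'⟩
      · exact Or.inr (Or.inl rfl)
      · exact Or.inr (Or.inr ⟨h, fun h'' => absurd ((h1 h).1 h'') (not_lt.2 h'.le), (h2 h).2 h'⟩)
  refine ⟨?_, ?_, ?_⟩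
  · unfold insertRoot
    have key : ∀ x ∈ l.filter (fun r' => rootLt r' r), rootVal x < rootVal r := by
      intro x hx
      rw [List.mem_filter] at hx
      exact (rootLt_iff (hl x hx.1) hr).1 hx.2
    have key' : ∀ x ∈ l.filter (fun r' => !rootLt r' r && rootLt r r'), rootVal r < rootVal x := by
      intro x hx
      rw [List.mem_filter, Bool.and_eq_true] at hx
      exact (rootLt_iff hr (hl x hx.1)).1 hx.2.2
    rw [List.pairwise_append, List.pairwise_cons]
    refine ⟨hs.sublist List.filter_sublist, ⟨key', hs.sublist List.filter_sublist⟩, ?_⟩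
    intro x hx y hy
    rcases List.mem_cons.1 hy with rfl | hy
    · exact key x hx
    · exact (key x hx).trans (key' y hy)
  · intro x hx
    rcases (hmem x).1 hx with h | h | h
    · exact Or.inr h.1
    · exact Or.inl h
    · exact Or.inr h.1
  · rintro x (rfl | hx)
    · exact ⟨x, (hmem x).2 (Or.inr (Or.inl rfl)), rfl⟩
    · rcases lt_trichotomy (rootVal x) (rootVal r) with h | h | h
      · exact ⟨x, (hmem x).2 (Or.inl ⟨hx, h⟩), rfl⟩
      · exact ⟨r, (hmem r).2 (Or.inr (Or.inl rfl)), h.symm⟩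
      · exact ⟨x, (hmem x).2 (Or.inr (Or.inr ⟨hx, h⟩)), rfl⟩

theorem foldl_insertRoot_spec (L : List QuadRoot) (hL : ∀ x ∈ L, RootOk x) :
    ∀ l : List QuadRoot, (∀ x ∈ l, RootOk x) → (l.Pairwise fun x y => rootVal x < rootVal y) →
    (L.foldl insertRoot l).Pairwise (fun x y => rootVal x < rootVal y) ∧
      (∀ x ∈ L.foldl insertRoot l, x ∈ L ∨ x ∈ l) ∧
      ∀ x, x ∈ L ∨ x ∈ l → ∃ y ∈ L.foldl insertRoot l, rootVal y = rootVal x := by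
  induction L with
  | nil =>
    intro l hl hs
    exact ⟨hs, fun x hx => Or.inr hx, fun x hx => ⟨x, by simpa using hx, rfl⟩⟩
  | cons r L ih =>
    intro l hl hs
    obtain ⟨h1, h2, h3⟩ := insertRoot_spec hl (hL r List.mem_cons_self) hs
    obtain ⟨g1, g2, g3⟩ := ih (fun x hx => hL x (List.mem_cons_of_mem _ hx)) (insertRoot l r)
      (fun x hx => by
        rcases h2 x hx with rfl | h
        · exact hL x List.mem_cons_self
        · exact hl x h) h1
    refine ⟨g1, fun x hx => ?_, fun x hx => ?_⟩
    · rcases g2 x hx with h | h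
      · exact Or.inl (List.mem_cons_of_mem _ h)
      · rcases h2 x h with rfl | h
        · exact Or.inl List.mem_cons_self
        · exact Or.inr h
    · have : x ∈ L ∨ x = r ∨ x ∈ l := by
        rcases hx with hx | hx
        · rcases List.mem_cons.1 hx with h | h
          · exact Or.inr (Or.inl h)
          · exact Or.inl h
        · exact Or.inr (Or.inr hx)
      rcases this with h | h
      · exact g3 x (Or.inl h)
      · obtain ⟨y, hy, e⟩ := h3 x h
        obtain ⟨y', hy', e'⟩ := g3 y (Or.inr hy)
        exact ⟨y', hy', e'.trans e⟩

/-- The breakpoints are sorted and nonnegative, they contain 0, and every positive root of a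
nonzero polynomial of the list occurs among them. -/
theorem breaks_spec (Q : List Quad) :
    (breaks Q).Pairwise (fun x y => rootVal x < rootVal y) ∧
      (∀ r ∈ breaks Q, RootOk r ∧ 0 ≤ rootVal r) ∧
      (∃ r ∈ breaks Q, rootVal r = 0) ∧
      ∀ q ∈ Q, (∃ y, quadEval q y ≠ 0) → ∀ τ, 0 < τ → quadEval q τ = 0 →
        ∃ r ∈ breaks Q, rootVal r = τ := by
  have h0 : RootOk (1, 0, 0, 0) := ⟨by norm_num, le_rfl⟩
  have hv : rootVal (1, 0, 0, 0) = 0 := by simp [rootVal]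
  have hok : ∀ r ∈ Q.flatMap fun q => quadRoots q, RootOk r := by
    intro r hr
    obtain ⟨q, -, h⟩ := List.mem_flatMap.1 hr
    exact quadRoots_ok h
  obtain ⟨h1, h2, h3⟩ := foldl_insertRoot_spec
    ((Q.flatMap fun q => quadRoots q).filter fun r => rootPos r)
    (fun r hr => hok r (List.mem_filter.1 hr).1) [(1, 0, 0, 0)] (by simpa using h0) (by simp)
  refine ⟨h1, fun r hr => ?_, ?_, fun q hq hne τ hτ hτ0 => ?_⟩
  · rcases h2 r hr with h | h
    · have h' := List.mem_filter.1 h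
      exact ⟨hok r h'.1, ((rootPos_iff (hok r h'.1)).1 h'.2).le⟩
    · rw [List.mem_singleton.1 h]
      exact ⟨h0, hv.ge⟩
  · obtain ⟨y, hy, e⟩ := h3 (1, 0, 0, 0) (Or.inr (by simp))
    exact ⟨y, hy, e.trans hv⟩
  · obtain ⟨r, hr, rfl⟩ := exists_mem_quadRoots hne hτ0
    exact h3 r (Or.inl (List.mem_filter.2 ⟨List.mem_flatMap.2 ⟨q, hq, hr⟩,
      (rootPos_iff (quadRoots_ok hr)).2 hτ⟩))

end Signs


/-! ### Orbits of the next cut on the universal cover of the circle -/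

section Orbits

open Real

variable {V : Set (ℝ × ℝ)} {S : Set ((ℝ × ℝ) × (ℝ × ℝ))}

/-- The largest turn from the cut at angle `φ` to a cut that can follow. -/
def IsNextTurn (V : Set (ℝ × ℝ)) (S : Set ((ℝ × ℝ) × (ℝ × ℝ))) (φ T : ℝ) : Prop :=
  0 < T ∧ T ≤ 2 * π ∧ Follows V S φ T ∧ ∀ T', 0 < T' → T' ≤ 2 * π → Follows V S φ T' → T' ≤ T

/-- An arc of the family may be shortened at its beginning. -/
theorem Follows.shrink (hV : Wide V) {φ T δ : ℝ} (h : Follows V S φ T) (hT : T ≤ 2 * π)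
    (h0 : 0 ≤ δ) : Follows V S (φ + δ) (T - δ) := by
  rintro z hz ⟨θ, hθ1, hθ2, hθ⟩
  rw [show φ + δ + (T - δ) = φ + T by ring] at *
  rcases h z hz ⟨θ, by linarith, hθ2, hθ⟩ with h2 | h2
  · rcases le_or_gt (θ - φ) π with h3 | h3
    · exact Or.inl (inCut_between hV h2 hθ (by linarith) hθ1 h3)
    · exact Or.inr (inCut_between hV hθ (inCut_add_two_pi.2 h2) hθ2.le (by linarith)
        (by linarith))
  · exact Or.inr h2

theorem follows_add_two_pi {φ T : ℝ} (k : ℤ) :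
    Follows V S (φ + k * (2 * π)) T ↔ Follows V S φ T := by
  have e : ∀ z, (∃ θ, φ + k * (2 * π) ≤ θ ∧ θ < φ + k * (2 * π) + T ∧ InCut V θ z) ↔
      ∃ θ, φ ≤ θ ∧ θ < φ + T ∧ InCut V θ z := by
    intro z
    constructor
    · rintro ⟨θ, h1, h2, h3⟩
      refine ⟨θ - k * (2 * π), by linarith, by linarith, ?_⟩
      rw [← inCut_add_int_mul k]; simpa using h3
    · rintro ⟨θ, h1, h2, h3⟩
      exact ⟨θ + k * (2 * π), by linarith, by linarith, (inCut_add_int_mul k).2 h3⟩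
  unfold Follows
  simp only [e]
  simp only [inCut_add_int_mul, show φ + k * (2 * π) + T = φ + T + k * (2 * π) by ring]

theorem IsNextTurn.unique {φ T T' : ℝ} (h : IsNextTurn V S φ T) (h' : IsNextTurn V S φ T') :
    T = T' :=
  le_antisymm (h'.2.2.2 T h.1 h.2.1 h.2.2.1) (h.2.2.2 T' h'.1 h'.2.1 h'.2.2.1)

theorem isNextTurn_add_two_pi {φ T : ℝ} (k : ℤ) :
    IsNextTurn V S (φ + k * (2 * π)) T ↔ IsNextTurn V S φ T := by
  simp only [IsNextTurn, follows_add_two_pi]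

/-- The angles of the iterated next cuts, without reduction modulo `2π`. -/
def orbitAngle (T : ℝ → ℝ) (φ : ℝ) : ℕ → ℝ
  | 0 => φ
  | i + 1 => orbitAngle T φ i + T (orbitAngle T φ i)

theorem orbitAngle_strictMono {T : ℝ → ℝ} (hT : ∀ φ, 0 < T φ) (φ : ℝ) :
    StrictMono (orbitAngle T φ) :=
  strictMono_nat_of_lt_succ fun i => by
    have := hT (orbitAngle T φ i)
    simp only [orbitAngle]
    linarith

theorem exists_orbitAngle_le_lt {T : ℝ → ℝ} {φ θ : ℝ} {k : ℕ} (h0 : φ ≤ θ)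
    (hk : θ < orbitAngle T φ k) :
    ∃ i < k, orbitAngle T φ i ≤ θ ∧ θ < orbitAngle T φ (i + 1) := by
  induction k with
  | zero => exact absurd h0 (not_le.2 hk)
  | succ k ih =>
    rcases le_or_gt (orbitAngle T φ k) θ with h | h
    · exact ⟨k, Nat.lt_succ_self k, h, hk⟩
    · obtain ⟨i, hi, h'⟩ := ih h
      exact ⟨i, hi.trans (Nat.lt_succ_self k), h'⟩

/-- If the cuts of an orbit go around, then every point of the segments is in one of them. -/
theorem exists_inCut_orbitAngle (hV : Wide V) (hne : ∀ z ∈ segPts S, ∃ θ, InCut V θ z)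
    {T : ℝ → ℝ} (hT : ∀ φ, IsNextTurn V S φ (T φ)) {φ : ℝ} {k : ℕ}
    (hk : φ + 2 * π ≤ orbitAngle T φ k) {z : ℝ × ℝ} (hz : z ∈ segPts S) :
    ∃ i < k, InCut V (orbitAngle T φ i) z := by
  by_contra hc
  push Not at hc
  obtain ⟨θ', h'⟩ := hne z hz
  obtain ⟨θ, h1, h2, m, hm⟩ := exists_angle_in_turn θ' φ
  rw [← inCut_add_int_mul m, ← hm] at h'
  obtain ⟨i, hi, h3, h4⟩ := exists_orbitAngle_le_lt h1 (h2.trans_le hk)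
  obtain ⟨t0, t1, t2, -⟩ := hT (orbitAngle T φ i)
  have h5 : InCut V (orbitAngle T φ (i + 1)) z :=
    (t2 z hz ⟨θ, h3, h4, h'⟩).resolve_left (hc i hi)
  have hik : i + 1 = k := by
    by_contra h
    exact hc (i + 1) (by omega) h5
  rw [hik] at h5 h4
  have h0 : ¬ InCut V φ z := hc 0 (by omega)
  have hlen : orbitAngle T φ k ≤ orbitAngle T φ i + 2 * π := by
    rw [← hik]; simp only [orbitAngle]; linarith
  rcases le_or_gt (orbitAngle T φ k - θ) π with h6 | h6
  · exact h0 (inCut_add_two_pi.1 (inCut_between hV h' h5 h2.le hk h6))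
  · exact hc i hi (inCut_outside hV h' h5 h6.le (by linarith) h3)

/-- Every covering by `k` cuts can be replaced by an orbit of length `k`, which proceeds at least
as fast. -/
theorem le_orbitAngle_of_cuts (hV : Wide V) {T : ℝ → ℝ} (hT : ∀ φ, IsNextTurn V S φ (T φ))
    {k : ℕ} (U : Fin k → ℝ) (hU : ∀ z ∈ segPts S, ∃ j, InCut V (U j) z) (j₀ : Fin k) :
    U j₀ + 2 * π ≤ orbitAngle T (U j₀) k := by
  -- the next angle of `U` after `η`
  have hnext : ∀ η, ∃ η', η < η' ∧ η' ≤ η + 2 * π ∧ (∃ j, ∃ m : ℤ, η' = U j + m * (2 * π)) ∧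
      ∀ j, ∃ m : ℤ, η' ≤ U j + m * (2 * π) ∧ U j + m * (2 * π) ≤ η + 2 * π := by
    intro η
    have : Nonempty (Fin k) := ⟨j₀⟩
    obtain ⟨j, hj⟩ := Finite.exists_min fun j => toIocMod two_pi_pos η (U j)
    have hform : ∀ j, toIocMod two_pi_pos η (U j)
        = U j + ((-toIocDiv two_pi_pos η (U j) : ℤ) : ℝ) * (2 * π) := by
      intro j
      have := self_sub_toIocDiv_zsmul two_pi_pos η (U j)
      rw [zsmul_eq_mul] at this
      push_cast
      linarith
    refine ⟨toIocMod two_pi_pos η (U j), left_lt_toIocMod _ _ _, toIocMod_le_right _ _ _,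
      ⟨j, _, hform j⟩, fun j' => ⟨_, (hj j').trans_eq (hform j'), ?_⟩⟩
    rw [← hform]
    exact toIocMod_le_right _ _ _
  choose nx hn1 hn2 hn3 hn4 using hnext
  have hfol : ∀ η, (∃ j, ∃ m : ℤ, η = U j + m * (2 * π)) → Follows V S η (nx η - η) := by
    rintro η - z hz ⟨θ, h1, h2, h3⟩
    rw [show η + (nx η - η) = nx η by ring] at *
    obtain ⟨j, hj⟩ := hU z hz
    obtain ⟨m, hm1, hm2⟩ := hn4 η j
    rw [← inCut_add_int_mul m] at hj
    rcases le_or_gt (U j + m * (2 * π) - θ) π with h | h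
    · exact Or.inr (inCut_between hV h3 hj h2.le hm1 h)
    · exact Or.inl (inCut_outside hV h3 hj h.le (by linarith) h1)
  set η : ℕ → ℝ := fun i => nx^[i] (U j₀) with hη
  have hηs : ∀ i, η (i + 1) = nx (η i) := fun i => Function.iterate_succ_apply' _ _ _
  have hηU : ∀ i, ∃ j, ∃ m : ℤ, η i = U j + m * (2 * π) := by
    intro i
    cases i with
    | zero => exact ⟨j₀, 0, by simp [hη]⟩
    | succ i => rw [hηs]; exact hn3 (η i)
  have hle : ∀ i, η i ≤ orbitAngle T (U j₀) i := by
    intro i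
    induction i with
    | zero => simp [hη, orbitAngle]
    | succ i ih =>
      rw [hηs]
      set o := orbitAngle T (U j₀) i with ho
      obtain ⟨t0, t1, t2, t3⟩ := hT o
      have e : orbitAngle T (U j₀) (i + 1) = o + T o := rfl
      rw [e]
      rcases le_or_gt (nx (η i)) o with h | h
      · linarith
      · have h5 := (hfol (η i) (hηU i)).shrink hV (δ := o - η i)
          (by have := hn2 (η i); linarith) (by linarith)
        rw [show η i + (o - η i) = o by ring] at h5
        have h6 := t3 _ (by linarith) (by have := hn2 (η i); linarith) h5
        linarith
  refine le_trans ?_ (hle k)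
  -- otherwise `U` has more than `k` different angles
  by_contra hc
  push Not at hc
  have hmono : StrictMono η := strictMono_nat_of_lt_succ fun i => by rw [hηs]; exact hn1 (η i)
  choose f m hf using hηU
  have hinj : Function.Injective fun i : Fin (k + 1) => f i := by
    intro i i' hii
    simp only at hii
    have e1 := hf i
    have e2 := hf i'
    rw [hii] at e1
    have lo : ∀ i : Fin (k + 1), U j₀ ≤ η i ∧ η i < U j₀ + 2 * π := by
      intro i
      have h1 : η 0 ≤ η i := hmono.monotone (Nat.zero_le _)
      have h2 : η i ≤ η k := hmono.monotone (Nat.lt_succ_iff.1 i.2)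
      exact ⟨h1, h2.trans_lt hc⟩
    have hm : m i = m i' := by
      have d : η i - η i' = ((m i - m i' : ℤ) : ℝ) * (2 * π) := by rw [e1, e2]; push_cast; ring
      have l1 := lo i
      have l2 := lo i'
      have l3 : ((m i - m i' : ℤ) : ℝ) < 1 := by
        by_contra h
        nlinarith [pi_pos]
      have l4 : (-1 : ℝ) < ((m i - m i' : ℤ) : ℝ) := by
        by_contra h
        nlinarith [pi_pos]
      have l5 : m i - m i' < 1 := by exact_mod_cast l3
      have l6 : -1 < m i - m i' := by exact_mod_cast l4
      omega
    have : η i = η i' := by rw [e1, e2, hm]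
    exact Fin.ext (hmono.injective this)
  have := Fintype.card_le_of_injective _ hinj
  simp at this

end Orbits

/-! ### Arcs of the circle in terms of angles -/

section CircleAngles

open Real

theorem exists_arg_exp (δ : ℝ) :
    ∃ m : ℤ, ((Circle.exp δ : Circle) : ℂ).arg = δ + m * (2 * π) :=
  Circle.exp_eq_exp.1 (Circle.exp_arg _)

theorem exp_div_exp (φ δ : ℝ) : Circle.exp (φ + δ) / Circle.exp φ = Circle.exp δ := by
  rw [← Circle.exp_sub]; congr 1; ring

theorem ccwAngle_exp (φ : ℝ) {δ : ℝ} (h0 : 0 ≤ δ) (h1 : δ < 2 * π) :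
    ccwAngle (Circle.exp φ) (Circle.exp (φ + δ)) = δ := by
  obtain ⟨m, hm⟩ := exists_arg_exp δ
  rw [ccwAngle, exp_div_exp, hm, ← zsmul_eq_mul, toIcoMod_add_zsmul]
  exact (toIcoMod_eq_self two_pi_pos).2 ⟨h0, by simpa using h1⟩

theorem turn_exp (φ : ℝ) {δ : ℝ} (h0 : 0 < δ) (h1 : δ ≤ 2 * π) :
    turn (Circle.exp φ) (Circle.exp (φ + δ)) = δ := by
  obtain ⟨m, hm⟩ := exists_arg_exp δ
  rw [turn, exp_div_exp, hm, ← zsmul_eq_mul, toIocMod_add_zsmul]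
  exact (toIocMod_eq_self two_pi_pos).2 ⟨h0, by simpa using h1⟩

theorem exists_exp_add_turn (φ : ℝ) (b : Circle) :
    ∃ T, 0 < T ∧ T ≤ 2 * π ∧ b = Circle.exp (φ + T) := by
  set θ := (b : ℂ).arg
  refine ⟨toIocMod two_pi_pos φ θ - φ, by linarith [left_lt_toIocMod two_pi_pos φ θ],
    by linarith [toIocMod_le_right two_pi_pos φ θ], ?_⟩
  rw [← Circle.exp_arg b, Circle.exp_eq_exp]
  refine ⟨toIocDiv two_pi_pos φ θ, ?_⟩
  have := self_sub_toIocDiv_zsmul two_pi_pos φ θ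
  rw [zsmul_eq_mul] at this
  linarith

theorem exists_exp_add_ccwAngle (φ : ℝ) (b : Circle) :
    ∃ δ, 0 ≤ δ ∧ δ < 2 * π ∧ b = Circle.exp (φ + δ) := by
  set θ := (b : ℂ).arg
  refine ⟨toIcoMod two_pi_pos φ θ - φ, by linarith [left_le_toIcoMod two_pi_pos φ θ],
    by linarith [toIcoMod_lt_right two_pi_pos φ θ], ?_⟩
  rw [← Circle.exp_arg b, Circle.exp_eq_exp]
  refine ⟨toIcoDiv two_pi_pos φ θ, ?_⟩
  have := self_sub_toIcoDiv_zsmul two_pi_pos φ θ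
  rw [zsmul_eq_mul] at this
  linarith

theorem exp_mem_arc {φ δ T : ℝ} (h0 : 0 ≤ δ) (h1 : δ < 2 * π) (hT0 : 0 < T) (hT : T ≤ 2 * π) :
    Circle.exp (φ + δ) ∈ arc (Circle.exp φ) (Circle.exp (φ + T)) ↔ δ < T := by
  rw [arc, Set.mem_ofPred_eq, ccwAngle_exp φ h0 h1, turn_exp φ hT0 hT]

theorem circleVec_exp (θ : ℝ) : circleVec (Circle.exp θ) = ![cos θ, sin θ] := by
  simp [circleVec, Circle.coe_exp, Complex.exp_ofReal_mul_I_re, Complex.exp_ofReal_mul_I_im]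

end CircleAngles

/-! ### The generator of the arcs and the correspondence of covers -/

section Generator

open Real

variable {V : Set (ℝ × ℝ)} {S : Set ((ℝ × ℝ) × (ℝ × ℝ))}

/-- The map that sends the normal of a cut to that of the next cut, for a choice `T` of turns. -/
noncomputable def nextMap (T : ℝ → ℝ) (u : Circle) : Circle :=
  Circle.exp ((u : ℂ).arg + T (u : ℂ).arg)

theorem nextMap_exp {T : ℝ → ℝ} (hT : ∀ φ, IsNextTurn V S φ (T φ)) {φ T' : ℝ}
    (h : IsNextTurn V S φ T') : nextMap T (Circle.exp φ) = Circle.exp (φ + T') := by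
  obtain ⟨m, hm⟩ := exists_arg_exp φ
  have h1 := hT (φ + m * (2 * π))
  rw [isNextTurn_add_two_pi] at h1
  rw [nextMap, hm, h1.unique h, Circle.exp_eq_exp]
  exact ⟨m, by ring⟩

theorem nextMap_iterate {T : ℝ → ℝ} (hT : ∀ φ, IsNextTurn V S φ (T φ)) (φ : ℝ) (i : ℕ) :
    (nextMap T)^[i] (Circle.exp φ) = Circle.exp (orbitAngle T φ i) := by
  induction i with
  | zero => rfl
  | succ i ih => rw [Function.iterate_succ_apply', ih, nextMap_exp hT (hT _)]; rfl

/-- The arcs of an orbit cover the circle iff its lift proceeds by a full turn. -/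
theorem orbitCovers_iff {T : ℝ → ℝ} (hT : ∀ φ, IsNextTurn V S φ (T φ)) (φ : ℝ) (k : ℕ) :
    OrbitCovers (nextMap T) k (Circle.exp φ) ↔ φ + 2 * π ≤ orbitAngle T φ k := by
  have hmono := orbitAngle_strictMono (fun φ => (hT φ).1) φ
  have hstep : ∀ i, orbitAngle T φ (i + 1) = orbitAngle T φ i + T (orbitAngle T φ i) :=
    fun _ => rfl
  simp only [OrbitCovers, Set.eq_univ_iff_forall, Set.mem_iUnion, Finset.mem_range, exists_prop,
    nextMap_iterate hT]
  constructor
  · intro h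
    by_contra hc
    push Not at hc
    -- the point where the orbit stops is not covered
    obtain ⟨i, hi, hmem⟩ := h (Circle.exp (orbitAngle T φ k))
    have h1 : orbitAngle T φ i < orbitAngle T φ k := hmono hi
    have h2 : orbitAngle T φ (i + 1) ≤ orbitAngle T φ k := hmono.monotone hi
    have h3 : φ ≤ orbitAngle T φ i := hmono.monotone (Nat.zero_le i)
    rw [hstep, show orbitAngle T φ k = orbitAngle T φ i + (orbitAngle T φ k - orbitAngle T φ i)
      by ring, exp_mem_arc (by linarith) (by linarith) (hT _).1 (hT _).2.1] at hmem
    rw [hstep] at h2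
    linarith
  · intro h x
    obtain ⟨δ, h0, h1, rfl⟩ := exists_exp_add_ccwAngle φ x
    obtain ⟨i, hi, h2, h3⟩ := exists_orbitAngle_le_lt (T := T) (φ := φ) (θ := φ + δ) (k := k)
      (by linarith) (by linarith)
    refine ⟨i, hi, ?_⟩
    rw [hstep] at h3 ⊢
    have h4 := (hT (orbitAngle T φ i)).2.1
    rw [show φ + δ = orbitAngle T φ i + (φ + δ - orbitAngle T φ i) by ring,
      exp_mem_arc (by linarith) (by linarith) (hT _).1 h4]
    linarith

variable {m n : ℕ}

/-- The sets `V` and `S` describe the instance in coordinates, up to a scaling `emb`. -/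
structure Describes (I : SepInstance m n) (V : Set (ℝ × ℝ)) (S : Set ((ℝ × ℝ) × (ℝ × ℝ)))
    (emb : Plane → ℝ × ℝ) : Prop where
  cut_iff : ∀ θ z, z ∈ I.cut (Circle.exp θ) ↔ InCut V θ (emb z)
  outer_iff : ∀ z, z ∈ I.outer ↔ emb z ∈ segPts S
  surj : ∀ y, ∃ z, emb z = y
  wide : Wide V
  finite : V.Finite
  common_cut : ∀ s ∈ S, ∃ θ, InCut V θ s.1 ∧ InCut V θ s.2
  symm : ∀ s ∈ S, (s.2, s.1) ∈ S

variable {I : SepInstance m n} {emb : Plane → ℝ × ℝ}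

theorem Describes.exists_inCut (h : Describes I V S emb) : ∀ z ∈ segPts S, ∃ θ, InCut V θ z := by
  rintro z ⟨s, hs, t, h0, h1, rfl⟩
  obtain ⟨θ, h2, h3⟩ := h.common_cut s hs
  exact ⟨θ, inCut_linePt h2 h3 h0 h1⟩

/-- On the level of angles, the family of arcs is the relation `Follows`. -/
theorem Describes.mem_sweepArcs_iff (h : Describes I V S emb) {φ T : ℝ} (hT0 : 0 < T)
    (hT : T ≤ 2 * π) :
    (Circle.exp φ, Circle.exp (φ + T)) ∈ I.sweepArcs ↔ Follows V S φ T := by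
  have key : ∀ z, (∃ w ∈ arc (Circle.exp φ) (Circle.exp (φ + T)), z ∈ I.cut w) ↔
      ∃ θ, φ ≤ θ ∧ θ < φ + T ∧ InCut V θ (emb z) := by
    intro z
    constructor
    · rintro ⟨w, hw, hz⟩
      obtain ⟨δ, h0, h1, rfl⟩ := exists_exp_add_ccwAngle φ w
      rw [exp_mem_arc h0 h1 hT0 hT] at hw
      exact ⟨φ + δ, by linarith, by linarith, (h.cut_iff _ _).1 hz⟩
    · rintro ⟨θ, h0, h1, hz⟩
      refine ⟨Circle.exp θ, ?_, (h.cut_iff _ _).2 hz⟩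
      rw [show θ = φ + (θ - φ) by ring, exp_mem_arc (by linarith) (by linarith) hT0 hT]
      linarith
  simp only [SepInstance.sweepArcs, Set.mem_ofPred_eq, key, h.cut_iff, Follows]
  constructor
  · intro H y hy
    obtain ⟨z, rfl⟩ := h.surj y
    exact H z ((h.outer_iff z).2 hy)
  · intro H z hz
    exact H (emb z) ((h.outer_iff z).1 hz)

theorem Describes.isNextGenerator (h : Describes I V S emb) {T : ℝ → ℝ}
    (hT : ∀ φ, IsNextTurn V S φ (T φ)) : IsNextGenerator I.sweepArcs (nextMap T) := by
  intro t
  constructor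
  · refine ⟨t, ?_⟩
    rw [← Circle.exp_arg t, nextMap_exp hT (hT _)]
    set φ := (t : ℂ).arg
    obtain ⟨h1, h2, h3, -⟩ := hT φ
    refine ⟨(h.mem_sweepArcs_iff h1 h2).2 h3, ?_⟩
    have := (exp_mem_arc (φ := φ) (δ := 0) le_rfl two_pi_pos h1 h2).2 h1
    rwa [add_zero] at this
  · intro a b hab ht
    obtain ⟨α, rfl⟩ : ∃ α, a = Circle.exp α := ⟨_, (Circle.exp_arg a).symm⟩
    obtain ⟨T', h1, h2, rfl⟩ := exists_exp_add_turn α b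
    obtain ⟨δ, h3, h4, rfl⟩ := exists_exp_add_ccwAngle α t
    rw [exp_mem_arc h3 h4 h1 h2] at ht
    rw [h.mem_sweepArcs_iff h1 h2] at hab
    obtain ⟨g1, g2, g3, g4⟩ := hT (α + δ)
    rw [nextMap_exp hT (hT _), turn_exp _ g1 g2, show α + T' = α + δ + (T' - δ) by ring,
      turn_exp _ (by linarith) (by linarith)]
    exact g4 _ (by linarith) (by linarith) (hab.shrink h.wide h2 h3)

theorem notMem_interior_halfPlane {a z : Plane} {c : ℝ} (ha : a ≠ 0) (hz : c ≤ dotProduct a z) :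
    z ∉ interior {x : Plane | dotProduct a x ≤ c} := by
  intro h
  -- moving `z` in the direction of the normal leaves the half-plane
  have hcont : Continuous fun t : ℝ => z + t • a := by fun_prop
  have h0 : (fun t : ℝ => z + t • a) 0 ∈ interior {x : Plane | dotProduct a x ≤ c} := by
    simpa using h
  have hev := hcont.continuousAt.eventually_mem (isOpen_interior.mem_nhds h0)
  have hev' : ∀ᶠ t : ℝ in nhdsWithin 0 (Set.Ioi 0),
      z + t • a ∈ interior {x : Plane | dotProduct a x ≤ c} :=
    hev.filter_mono nhdsWithin_le_nhds
  obtain ⟨t, ht, ht0⟩ := (hev'.and self_mem_nhdsWithin).exists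
  have h1 : z + t • a ∈ {x : Plane | dotProduct a x ≤ c} := interior_subset ht
  have h2 : 0 < dotProduct a a := by
    have e : 0 ≤ dotProduct a a := Finset.sum_nonneg fun i _ => mul_self_nonneg (a i)
    exact lt_of_le_of_ne e fun h => ha (dotProduct_self_eq_zero.1 h.symm)
  rw [Set.mem_ofPred_eq, dotProduct_add, dotProduct_smul, smul_eq_mul] at h1
  have h3 : (0 : ℝ) < t := ht0
  nlinarith

theorem circleVec_ne_zero (u : Circle) : circleVec u ≠ 0 := by
  intro h
  have h1 : (u : ℂ).re = 0 := congrFun h 0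
  have h2 : (u : ℂ).im = 0 := congrFun h 1
  exact Circle.coe_ne_zero u (Complex.ext h1 h2)

theorem exists_eq_smul_circleVec_rayPoint {a : Plane} (ha : a ≠ 0) :
    ∃ r : ℝ, 0 < r ∧ a = r • circleVec (rayPoint a) := by
  set d : ℂ := ⟨a 0, a 1⟩ with hd
  have hd0 : d ≠ 0 := by
    intro h0
    have e1 : a 0 = 0 := congrArg Complex.re h0
    have e2 : a 1 = 0 := congrArg Complex.im h0
    apply ha
    ext i
    fin_cases i <;> simp [e1, e2]
  refine ⟨‖d‖, norm_pos_iff.2 hd0, ?_⟩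
  rw [rayPoint, ← hd, circleVec_exp]
  have e1 := Complex.norm_mul_cos_arg d
  have e2 := Complex.norm_mul_sin_arg d
  ext i
  fin_cases i
  · exact e1.symm
  · exact e2.symm

theorem disjoint_interior_keep_cut (u : Circle) : Disjoint (interior (I.keep u)) (I.cut u) := by
  rw [Set.disjoint_left]
  intro z hz hc
  refine notMem_interior_halfPlane (circleVec_ne_zero u) le_rfl (interior_mono ?_ hz)
  rintro x ⟨p, hp, hle⟩
  exact hle.trans (hc p hp)

theorem Describes.separates_iInter_keep (h : Describes I V S emb) {T : ℝ → ℝ}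
    (hT : ∀ φ, IsNextTurn V S φ (T φ)) {k : ℕ} {x : Circle} (hx : OrbitCovers (nextMap T) k x) :
    I.Separates (⋂ i ∈ Finset.range k, I.keep ((nextMap T)^[i] x)) := by
  obtain ⟨φ, rfl⟩ : ∃ φ, x = Circle.exp φ := ⟨_, (Circle.exp_arg x).symm⟩
  constructor
  · exact Set.subset_iInter₂ fun i _ z hz => ⟨z, hz, le_rfl⟩
  · intro j
    rw [Set.disjoint_left]
    intro z hz hzj
    have hzo : z ∈ I.outer := Set.mem_iUnion.2 ⟨j, hzj⟩
    obtain ⟨i, hi, hc⟩ := exists_inCut_orbitAngle h.wide h.exists_inCut hT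
      ((orbitCovers_iff hT φ k).1 hx) ((h.outer_iff z).1 hzo)
    rw [← h.cut_iff, ← nextMap_iterate hT] at hc
    exact Set.disjoint_left.1 (disjoint_interior_keep_cut _)
      (interior_mono (Set.iInter₂_subset i (Finset.mem_range.2 hi)) hz) hc

/-- The number `k` of half-planes suffices for the separation. -/
def CutsSuffice (I : SepInstance m n) (k : ℕ) : Prop :=
  ∃ (a : Fin k → Plane) (c : Fin k → ℝ),
    (∀ j, a j ≠ 0) ∧ I.Separates {x | ∀ j, dotProduct (a j) x ≤ c j}

theorem exists_support (I : SepInstance m n) (hne : I.inner.Nonempty) (u : Circle) :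
    ∃ p ∈ I.inner, ∀ q ∈ I.inner, dotProduct (circleVec u) q ≤ dotProduct (circleVec u) p := by
  have hcomp : IsCompact I.inner := (Set.finite_range _).isCompact_convexHull ℝ
  have hcont : Continuous fun q : Plane => dotProduct (circleVec u) q := by
    unfold dotProduct; fun_prop
  exact hcomp.exists_isMaxOn hne hcont.continuousOn

theorem Describes.cutsSuffice_of_orbitCovers (h : Describes I V S emb) (hne : I.inner.Nonempty)
    {T : ℝ → ℝ} (hT : ∀ φ, IsNextTurn V S φ (T φ)) {k : ℕ} {x : Circle}
    (hx : OrbitCovers (nextMap T) k x) : CutsSuffice I k := by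
  have hsep := h.separates_iInter_keep hT hx
  choose p hp hmax using exists_support I hne
  refine ⟨fun j => circleVec ((nextMap T)^[j] x),
    fun j => dotProduct (circleVec ((nextMap T)^[j] x)) (p ((nextMap T)^[j] x)),
    fun j => circleVec_ne_zero _, ?_⟩
  convert hsep using 1
  ext z
  simp only [Set.mem_ofPred_eq, Set.mem_iInter, Finset.mem_range, SepInstance.keep]
  constructor
  · intro H i hi
    exact ⟨_, hp _, H ⟨i, hi⟩⟩
  · intro H j
    obtain ⟨q, hq, hle⟩ := H j j.2
    exact hle.trans (hmax _ q hq)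

theorem Describes.orbitCovers_of_cuts (h : Describes I V S emb) {T : ℝ → ℝ}
    (hT : ∀ φ, IsNextTurn V S φ (T φ)) {k : ℕ} (u : Fin k → Circle) (hout : I.outer.Nonempty)
    (hu : ∀ z ∈ I.outer, ∃ j, z ∈ I.cut (u j)) : ∃ x, OrbitCovers (nextMap T) k x := by
  obtain ⟨z, hz⟩ := hout
  obtain ⟨j₀, -⟩ := hu z hz
  choose U hU using fun j => (⟨_, (Circle.exp_arg (u j)).symm⟩ : ∃ φ, u j = Circle.exp φ)
  refine ⟨Circle.exp (U j₀), (orbitCovers_iff hT _ _).2 (le_orbitAngle_of_cuts h.wide hT U ?_ j₀)⟩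
  intro y hy
  obtain ⟨z, rfl⟩ := h.surj y
  obtain ⟨j, hj⟩ := hu z ((h.outer_iff z).2 hy)
  rw [hU, h.cut_iff] at hj
  exact ⟨j, hj⟩

/-- A separating half-plane that does not touch the polygon may be replaced by the parallel cut. -/
theorem Describes.orbitCovers_of_cutsSuffice (h : Describes I V S emb) {T : ℝ → ℝ}
    (hT : ∀ φ, IsNextTurn V S φ (T φ)) {k : ℕ} (hout : I.outer.Nonempty) (hk : CutsSuffice I k) :
    ∃ x, OrbitCovers (nextMap T) k x := by
  obtain ⟨a, c, ha, hin, hdis⟩ := hk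
  refine h.orbitCovers_of_cuts hT (fun j => rayPoint (a j)) hout ?_
  intro z hz
  have hopen : IsOpen {x : Plane | ∀ j, dotProduct (a j) x < c j} := by
    simp only [Set.ofPred_forall]
    exact isOpen_iInter_of_finite fun j => isOpen_lt (by unfold dotProduct; fun_prop) (by fun_prop)
  have hsub : {x : Plane | ∀ j, dotProduct (a j) x < c j}
      ⊆ interior {x | ∀ j, dotProduct (a j) x ≤ c j} :=
    interior_maximal (fun x hx j => (hx j).le) hopen
  obtain ⟨i, hi⟩ := Set.mem_iUnion.1 hz
  have hnot : ¬ ∀ j, dotProduct (a j) z < c j := fun H =>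
    Set.disjoint_left.1 (hdis i) (hsub H) hi
  push Not at hnot
  obtain ⟨j, hj⟩ := hnot
  refine ⟨j, fun p hp => ?_⟩
  have h1 : dotProduct (a j) p ≤ dotProduct (a j) z := (hin hp j).trans hj
  -- the normal is a positive multiple of the unit vector
  obtain ⟨r, hr, hvec⟩ := exists_eq_smul_circleVec_rayPoint (ha j)
  rw [hvec, smul_dotProduct, smul_dotProduct, smul_eq_mul, smul_eq_mul] at h1
  exact le_of_mul_le_mul_left h1 hr

end Generator


/-! ### Separating polygons from separating cuts, and conversely -/

section Polygons

open Real

/-- The coordinates of a point of the plane. -/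
def pairOf (z : Plane) : ℝ × ℝ := (z 0, z 1)

theorem dotProduct_eq_dot2 (a z : Plane) : dotProduct a z = dot2 (pairOf a) (pairOf z) := by
  simp [dotProduct, dot2, pairOf, Fin.sum_univ_two]

theorem circleVec_dotProduct (θ : ℝ) (z : Plane) :
    dotProduct (circleVec (Circle.exp θ)) z = dot2 (dirVec θ) (pairOf z) := by
  rw [circleVec_exp, dotProduct_eq_dot2]; rfl

theorem dotProduct_le_of_mem_convexHull {k : ℕ} {v : Fin k → Plane} {a : Plane} {c : ℝ}
    (h : ∀ i, dotProduct a (v i) ≤ c) {x : Plane} (hx : x ∈ convexHull ℝ (Set.range v)) :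
    dotProduct a x ≤ c := by
  have hlin : IsLinearMap ℝ fun x : Plane => dotProduct a x :=
    ⟨fun x y => dotProduct_add a x y, fun r x => dotProduct_smul r a x⟩
  have hsub : convexHull ℝ (Set.range v) ⊆ {x | dotProduct a x ≤ c} :=
    convexHull_min (by rintro _ ⟨i, rfl⟩; exact h i) (convex_halfSpace_le hlin c)
  exact hsub hx

theorem exists_dotProduct_eq (f : Plane →L[ℝ] ℝ) : ∃ a : Plane, ∀ x, f x = dotProduct a x := by
  refine ⟨fun i => f (Pi.single i 1), fun x => ?_⟩
  have := f.toLinearMap.pi_apply_eq_sum_univ x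
  simp only [ContinuousLinearMap.coe_coe, smul_eq_mul] at this
  rw [this, dotProduct]
  refine Finset.sum_congr rfl fun i _ => ?_
  rw [mul_comm]
  congr 2
  ext j
  simp [Pi.single_apply, eq_comm]

/-- A convex set that does not meet the interior of a convex hull is in a half-plane that touches
the hull. -/
theorem exists_inCut_of_disjoint_interior {k : ℕ} {v : Fin k → Plane}
    (hne : (interior (convexHull ℝ (Set.range v))).Nonempty) {s : Set Plane} (hs : Convex ℝ s)
    (hs0 : s.Nonempty) (hdis : Disjoint (interior (convexHull ℝ (Set.range v))) s) :
    ∃ θ, ∀ y ∈ s, InCut (Set.range fun i => pairOf (v i)) θ (pairOf y) := by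
  have hconv := convex_convexHull ℝ (Set.range v)
  obtain ⟨f, u, hf, hfs⟩ := geometric_hahn_banach_open hconv.interior isOpen_interior hs hdis
  obtain ⟨a, ha⟩ := exists_dotProduct_eq f
  have ha0 : a ≠ 0 := by
    rintro rfl
    obtain ⟨z, hz⟩ := hne
    obtain ⟨y, hy⟩ := hs0
    have := (hf z hz).trans_le (hfs y hy)
    simp [ha] at this
  have hle : ∀ i, f (v i) ≤ u := by
    intro i
    have h1 : v i ∈ closure (interior (convexHull ℝ (Set.range v))) := by
      rw [hconv.closure_interior_eq_closure_of_nonempty_interior hne]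
      exact subset_closure (subset_convexHull ℝ _ ⟨i, rfl⟩)
    exact closure_minimal (fun z hz => (hf z hz).le) (isClosed_le f.continuous continuous_const) h1
  obtain ⟨r, hr, hvec⟩ := exists_eq_smul_circleVec_rayPoint ha0
  refine ⟨(rayPoint a : ℂ).arg, ?_⟩
  rintro y hy _ ⟨i, rfl⟩
  rw [← circleVec_dotProduct, ← circleVec_dotProduct, Circle.exp_arg]
  have h1 := (hle i).trans (hfs y hy)
  rw [ha, ha, hvec, smul_dotProduct, smul_dotProduct, smul_eq_mul, smul_eq_mul] at h1
  exact le_of_mul_le_mul_left h1 hr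

theorem wide_of_interior_nonempty {k : ℕ} {v : Fin k → Plane}
    (hne : (interior (convexHull ℝ (Set.range v))).Nonempty) :
    Wide (Set.range fun i => pairOf (v i)) := by
  intro θ
  by_contra hc
  push Not at hc
  obtain ⟨z, hz⟩ := hne
  have hz' := interior_subset hz
  obtain ⟨i₀⟩ : Nonempty (Fin k) := by
    by_contra h
    rw [not_nonempty_iff] at h
    rw [Set.range_eq_empty, convexHull_empty] at hz'
    exact hz'
  set a := circleVec (Circle.exp θ) with ha
  have hall : ∀ i, dotProduct a (v i) = dotProduct a (v i₀) := fun i => by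
    rw [ha, circleVec_dotProduct, circleVec_dotProduct]
    exact hc _ ⟨i, rfl⟩ _ ⟨i₀, rfl⟩
  have hge : dotProduct a (v i₀) ≤ dotProduct a z := by
    have := dotProduct_le_of_mem_convexHull (a := -a) (c := -dotProduct a (v i₀))
      (fun i => by rw [neg_dotProduct, hall i]) hz'
    rw [neg_dotProduct] at this
    linarith
  exact notMem_interior_halfPlane (circleVec_ne_zero _) hge
    (interior_mono (fun x hx => dotProduct_le_of_mem_convexHull (fun i => (hall i).le) hx) hz)

theorem Wide.exists_pos {V : Set (ℝ × ℝ)} (hV : Wide V) {y v : ℝ × ℝ} (hy : 0 < dot2 y y)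
    (h : ∀ w ∈ V, 0 ≤ dot2 y (w - v)) : ∃ w ∈ V, 0 < dot2 y (w - v) := by
  obtain ⟨r, hr, e⟩ := exists_eq_scale2_turnFrom hy 0
  obtain ⟨w, hw, w', hw', hne⟩ := hV (0 + turnFrom 0 y)
  by_contra hc
  push Not at hc
  have h1 := le_antisymm (hc w hw) (h w hw)
  have h2 := le_antisymm (hc w' hw') (h w' hw')
  rw [e, dot2_scale2_left, dot2_sub] at h1 h2
  have h3 := (mul_eq_zero.1 h1).resolve_left hr.ne'
  have h4 := (mul_eq_zero.1 h2).resolve_left hr.ne'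
  exact hne (by linarith)

theorem dot2_self_pos {y : ℝ × ℝ} (hy : y ≠ 0) : 0 < dot2 y y := by
  have h : y.1 ≠ 0 ∨ y.2 ≠ 0 := by
    by_contra hc
    push Not at hc
    exact hy (Prod.ext hc.1 hc.2)
  rcases h with h | h
  · have := mul_self_pos.2 h
    unfold dot2; nlinarith [mul_self_nonneg y.2]
  · have := mul_self_pos.2 h
    unfold dot2; nlinarith [mul_self_nonneg y.1]

theorem exists_inCut_of_forall_le {V : Set (ℝ × ℝ)} {y z : ℝ × ℝ} (hy : 0 < dot2 y y)
    (h : ∀ v ∈ V, dot2 y v ≤ dot2 y z) : ∃ θ, InCut V θ z := by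
  obtain ⟨r, hr, e⟩ := exists_eq_scale2_turnFrom hy 0
  refine ⟨0 + turnFrom 0 y, fun v hv => ?_⟩
  have := h v hv
  rw [e, dot2_scale2_left, dot2_scale2_left] at this
  exact le_of_mul_le_mul_left this hr

/-- The mirror image of `exists_last_tangent`. -/
theorem exists_first_tangent {V : Set (ℝ × ℝ)} {z : ℝ × ℝ} (hV : Wide V) (hfin : V.Finite)
    {w : ℝ} (h : InCut V w z) :
    ∃ v' ∈ V, z ≠ v' ∧ ∀ v ∈ V, 0 ≤ dot2 (rot90 (z - v')) (v - v') := by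
  have hdot : ∀ (θ : ℝ) (u : ℝ × ℝ), dot2 (dirVec (π / 2 - θ)) u.swap = dot2 (dirVec θ) u := by
    intro θ u
    simp only [dot2, dirVec, cos_pi_div_two_sub, sin_pi_div_two_sub, Prod.fst_swap,
      Prod.snd_swap]
    ring
  have hV' : Wide (Prod.swap '' V) := by
    intro θ
    obtain ⟨v, hv, v', hv', hne⟩ := hV (π / 2 - θ)
    refine ⟨_, ⟨v, hv, rfl⟩, _, ⟨v', hv', rfl⟩, ?_⟩
    have e1 := hdot (π / 2 - θ) v
    have e2 := hdot (π / 2 - θ) v'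
    rw [sub_sub_cancel] at e1 e2
    rwa [e1, e2]
  have h' : InCut (Prod.swap '' V) (π / 2 - w) z.swap := by
    rintro _ ⟨v, hv, rfl⟩
    rw [hdot, hdot]
    exact h v hv
  obtain ⟨_, ⟨v', hv', rfl⟩, hne, htan⟩ := exists_last_tangent hV' (hfin.image _) h'
  refine ⟨v', hv', fun e => hne (by rw [e]), fun v hv => ?_⟩
  have := htan _ ⟨v, hv, rfl⟩
  simp only [dot2, rot90, Prod.fst_sub, Prod.snd_sub, Prod.fst_swap, Prod.snd_swap] at this ⊢
  linarith

/-- The points of `V` lie to the left of the ray from `v` to `u`. -/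
def IsOutEdge (V : Set (ℝ × ℝ)) (v u : ℝ × ℝ) : Prop :=
  u ∈ V ∧ u ≠ v ∧ ∀ w ∈ V, 0 ≤ dot2 (rot90 (u - v)) (w - v)

/-- All edges that leave a point have the same direction. -/
theorem IsOutEdge.le_zero {V : Set (ℝ × ℝ)} (hV : Wide V) {v u u' y : ℝ × ℝ}
    (h : IsOutEdge V v u) (h' : IsOutEdge V v u') (hy : dot2 (rot90 (u' - v)) (y - v) ≤ 0) :
    dot2 (rot90 (u - v)) (y - v) ≤ 0 := by
  have pos : ∀ {u}, IsOutEdge V v u → 0 < dot2 (rot90 (u - v)) (rot90 (u - v)) := by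
    intro u h
    apply dot2_self_pos
    intro e
    apply h.2.1
    have e1 := congrArg Prod.fst e
    have e2 := congrArg Prod.snd e
    simp only [rot90, Prod.fst_sub, Prod.snd_sub, Prod.fst_zero, Prod.snd_zero] at e1 e2
    exact Prod.ext (by linarith) (by linarith)
  obtain ⟨w, hw, hpos⟩ := hV.exists_pos (pos h') h'.2.2
  have h1 := h.2.2 w hw
  have h2 := h.2.2 u' h'.1
  have h3 := h'.2.2 u h.1
  have key : dot2 (rot90 (u' - v)) (w - v) * dot2 (rot90 (u - v)) (y - v)
      = dot2 (rot90 (u - v)) (w - v) * dot2 (rot90 (u' - v)) (y - v) := by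
    have h4 : dot2 (rot90 (u' - v)) (u - v) = -dot2 (rot90 (u - v)) (u' - v) := by
      simp only [dot2, rot90, Prod.fst_sub, Prod.snd_sub]; ring
    have h5 : dot2 (rot90 (u - v)) (u' - v) = 0 := by linarith
    simp only [dot2, rot90, Prod.fst_sub, Prod.snd_sub] at h5 ⊢
    linear_combination (-((w.1 - v.1) * (y.2 - v.2) - (w.2 - v.2) * (y.1 - v.1))) * h5
  by_contra hc
  push Not at hc
  nlinarith [mul_pos hpos hc, mul_nonneg h1 (neg_nonneg.2 hy)]

/-- From a point outside the interior of the convex hull one sees an edge from the outside. -/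
theorem exists_outEdge_le_zero {V : Set (ℝ × ℝ)} (hV : Wide V) (hfin : V.Finite) {y : ℝ × ℝ}
    {θ : ℝ} (h : InCut V θ y) :
    ∃ v ∈ V, ∃ u, IsOutEdge V v u ∧ dot2 (rot90 (u - v)) (y - v) ≤ 0 := by
  obtain ⟨v, hv, hne, htan⟩ := exists_first_tangent hV hfin h
  have hd : 0 < dot2 (rot90 (v - y)) (rot90 (v - y)) := by
    apply dot2_self_pos
    intro e
    apply hne
    have e1 := congrArg Prod.fst e
    have e2 := congrArg Prod.snd e
    simp only [rot90, Prod.fst_sub, Prod.snd_sub, Prod.fst_zero, Prod.snd_zero] at e1 e2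
    exact Prod.ext (by linarith) (by linarith)
  obtain ⟨θ', h'⟩ : ∃ θ', InCut V θ' v := by
    refine exists_inCut_of_forall_le hd fun w hw => ?_
    have := htan w hw
    simp only [dot2, rot90, Prod.fst_sub, Prod.snd_sub] at this ⊢
    linarith
  obtain ⟨u, hu, hne', hedge⟩ := exists_last_tangent hV hfin h'
  refine ⟨v, hv, u, ⟨hu, hne'.symm, fun w hw => ?_⟩, ?_⟩
  · have := hedge w hw
    simp only [dot2, rot90, Prod.fst_sub, Prod.snd_sub] at this ⊢
    linarith
  · have := htan u hu
    simp only [dot2, rot90, Prod.fst_sub, Prod.snd_sub] at this ⊢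
    linarith

variable {m n : ℕ} {I : SepInstance m n}

/-- The sides of a separating polygon are on separating lines. -/
theorem cutsSuffice_of_polygon {k : ℕ} {v : Fin k → Plane}
    (h : I.Separates (convexHull ℝ (Set.range v))) (hne : (interior I.inner).Nonempty) :
    CutsSuffice I k := by
  classical
  have hne' := hne.mono (interior_mono h.1)
  have hV := wide_of_interior_nonempty hne'
  set V := Set.range fun i => pairOf (v i) with hVdef
  -- at a vertex without an outgoing edge, the choice of the half-plane does not matter
  have hex : ∀ j, ∃ a : Plane, a ≠ 0 ∧ ∀ u, IsOutEdge V (pairOf (v j)) u →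
      (∀ i, dotProduct a (v i) ≤ dotProduct a (v j)) ∧
        ∀ y, dot2 (rot90 (u - pairOf (v j))) (pairOf y - pairOf (v j)) ≤ 0 →
          dotProduct a (v j) ≤ dotProduct a y := by
    intro j
    by_cases hj : ∃ u, IsOutEdge V (pairOf (v j)) u
    · obtain ⟨u, hu⟩ := hj
      have e : ∀ z : Plane, dotProduct
          (![u.2 - (pairOf (v j)).2, (pairOf (v j)).1 - u.1] : Plane) z
          = -dot2 (rot90 (u - pairOf (v j))) (pairOf z) := by
        intro z
        rw [dotProduct_eq_dot2]
        simp [dot2, rot90, pairOf]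
        ring
      refine ⟨![u.2 - (pairOf (v j)).2, (pairOf (v j)).1 - u.1], ?_, fun u' hu' => ⟨?_, ?_⟩⟩
      · intro h0
        have e1 := congrFun h0 0
        have e2 := congrFun h0 1
        simp only [Matrix.cons_val_zero, Matrix.cons_val_one, Pi.zero_apply] at e1 e2
        exact hu.2.1 (Prod.ext (by linarith) (by linarith))
      · intro i
        have := hu.2.2 _ ⟨i, rfl⟩
        rw [dot2_sub] at this
        rw [e, e]
        linarith
      · intro y hy
        have := hu.le_zero hV hu' hy
        rw [dot2_sub] at this
        rw [e, e]
        linarith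
    · exact ⟨![1, 0], fun h0 => one_ne_zero (congrFun h0 0), fun u hu => absurd ⟨u, hu⟩ hj⟩
  choose a ha0 ha using hex
  have hmax : ∀ j, ∃ i, ∀ i', dotProduct (a j) (v i') ≤ dotProduct (a j) (v i) := by
    intro j
    have : Nonempty (Fin k) := ⟨j⟩
    exact Finite.exists_max _
  choose t ht using hmax
  refine ⟨a, fun j => dotProduct (a j) (v (t j)), ha0, ?_, fun i => ?_⟩
  · exact fun x hx j => dotProduct_le_of_mem_convexHull (ht j) (h.1 hx)
  · refine (h.2 i).mono_left fun y hy => ?_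
    by_contra hc
    obtain ⟨θ, hθ⟩ := exists_inCut_of_disjoint_interior hne' (convex_singleton y)
      (Set.singleton_nonempty y) (Set.disjoint_singleton_right.2 hc)
    obtain ⟨_, ⟨j, rfl⟩, u, hu, hle⟩ :=
      exists_outEdge_le_zero hV (Set.finite_range _) (hθ y rfl)
    have h1 := (ha j u hu).2 y hle
    have h2 := (ha j u hu).1 (t j)
    exact notMem_interior_halfPlane (ha0 j) (h2.trans h1)
      (interior_mono (Set.ofPred_subset_ofPred.2 fun x hx => hx j) hy)

/-- The point where the tangents with normals at angles `a` and `b` meet. -/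
theorem exists_tangents_meet {a b A B : ℝ} (h : sin (b - a) ≠ 0) :
    ∃ p : Plane, dotProduct (circleVec (Circle.exp a)) p = A ∧
      dotProduct (circleVec (Circle.exp b)) p = B := by
  refine ⟨![(A * sin b - B * sin a) / sin (b - a), (B * cos a - A * cos b) / sin (b - a)], ?_, ?_⟩
  all_goals
    rw [circleVec_dotProduct]
    simp only [dot2, dirVec, pairOf, Matrix.cons_val_zero, Matrix.cons_val_one]
    field_simp
    rw [sin_sub]
    ring

theorem circleVec_combination (a t b : ℝ) (z : Plane) :
    sin (b - a) * dotProduct (circleVec (Circle.exp t)) z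
      = sin (b - t) * dotProduct (circleVec (Circle.exp a)) z
        + sin (t - a) * dotProduct (circleVec (Circle.exp b)) z := by
  rw [circleVec_dotProduct, circleVec_dotProduct, circleVec_dotProduct, dot2_dirVec_combination]

/-- If the normals of separating cuts leave out no half-turn, then the tangents of consecutive cuts
meet in the vertices of a separating polygon. -/
theorem exists_polygon (hne : (interior I.inner).Nonempty) (hsur : I.Surrounded) {k : ℕ}
    {ζ : ℕ → ℝ} (hmono : ∀ i < k, ζ i < ζ (i + 1)) (hk : ζ k = ζ 0 + 2 * π)
    (hsep : I.Separates (⋂ i ∈ Finset.range k, I.keep (Circle.exp (ζ i)))) :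
    ∃ v : Fin k → Plane, I.Separates (convexHull ℝ (Set.range v)) := by
  have hle : ∀ i j, i ≤ j → j ≤ k → ζ i ≤ ζ j := by
    intro i j hij hj
    induction j, hij using Nat.le_induction with
    | base => exact le_rfl
    | succ j hij ih => exact (ih (by omega)).trans (hmono j (by omega)).le
  -- every other normal has an angle on the complementary arc
  have hlift : ∀ i < k, ∀ j < k, ∃ t, ζ (i + 1) ≤ t ∧ t ≤ ζ i + 2 * π ∧
      Circle.exp t = Circle.exp (ζ j) := by
    intro i hi j hj
    rcases le_or_gt j i with h | h
    · refine ⟨ζ j + 2 * π, ?_, by linarith [hle j i h hi.le], Circle.exp_eq_exp.2 ⟨1, by simp⟩⟩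
      linarith [hle (i + 1) k hi le_rfl, hle 0 j (Nat.zero_le _) hj.le]
    · refine ⟨ζ j, hle _ _ h hj.le, ?_, rfl⟩
      linarith [hle 0 i (Nat.zero_le _) hi.le, hle j k hj.le le_rfl]
  -- otherwise the cuts leave an unbounded region
  have hgap : ∀ i < k, ζ (i + 1) < ζ i + π := by
    intro i hi
    by_contra hc
    push Not at hc
    set μ := (ζ i + ζ (i + 1)) / 2 with hμ
    obtain ⟨p, hp, t, ht, hout⟩ := hsur (circleVec (Circle.exp μ)) (circleVec_ne_zero _)
    obtain ⟨l, hl⟩ := Set.mem_iUnion.1 hout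
    refine Set.disjoint_left.1 (hsep.2 l) ?_ hl
    have hopen : IsOpen ((fun x => x - t • circleVec (Circle.exp μ)) ⁻¹' interior I.inner) :=
      isOpen_interior.preimage (by fun_prop)
    refine interior_maximal ?_ hopen (by simpa using hp)
    intro x hx
    refine Set.mem_iInter₂.2 fun j hj => ?_
    have hx' : x - t • circleVec (Circle.exp μ) ∈ I.inner := interior_subset hx
    refine ⟨_, hx', ?_⟩
    obtain ⟨s, hs1, hs2, hs⟩ := hlift i hi j (Finset.mem_range.1 hj)
    have hcos : dotProduct (circleVec (Circle.exp (ζ j))) (circleVec (Circle.exp μ)) ≤ 0 := by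
      rw [← hs, circleVec_dotProduct, circleVec_exp]
      have e : dot2 (dirVec s) (pairOf ![cos μ, sin μ]) = cos (s - μ) := by
        rw [cos_sub]; simp [dot2, dirVec, pairOf]
      rw [e]
      apply cos_nonpos_of_pi_div_two_le_of_le <;> linarith
    rw [dotProduct_sub, dotProduct_smul, smul_eq_mul]
    nlinarith
  choose q hq hqmax using exists_support I (hne.mono interior_subset)
  have hsin : ∀ i < k, 0 < sin (ζ (i + 1) - ζ i) := fun i hi =>
    sin_pos_of_pos_of_lt_pi (by linarith [hmono i hi]) (by linarith [hgap i hi])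
  have hmeet : ∀ i : Fin k, ∃ p : Plane,
      dotProduct (circleVec (Circle.exp (ζ i))) p
        = dotProduct (circleVec (Circle.exp (ζ i))) (q (Circle.exp (ζ i))) ∧
      dotProduct (circleVec (Circle.exp (ζ (i + 1)))) p
        = dotProduct (circleVec (Circle.exp (ζ (i + 1)))) (q (Circle.exp (ζ (i + 1)))) :=
    fun i => exists_tangents_meet (hsin i i.2).ne'
  choose p hp1 hp2 using hmeet
  refine ⟨p, ?_, fun l => (hsep.2 l).mono_left (interior_mono ?_)⟩
  · intro x hx
    by_contra hc
    obtain ⟨f, u, hf1, hf2⟩ := geometric_hahn_banach_closed_point (convex_convexHull ℝ _)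
      ((Set.finite_range p).isCompact_convexHull ℝ).isClosed hc
    obtain ⟨a, ha⟩ := exists_dotProduct_eq f
    have hf : ∀ i, dotProduct a (p i) < dotProduct a x := fun i => by
      rw [← ha, ← ha]
      exact (hf1 _ (subset_convexHull ℝ _ ⟨i, rfl⟩)).trans hf2
    have hk0 : 0 < k := by
      rcases Nat.eq_zero_or_pos k with h | h
      · rw [h] at hk; linarith [pi_pos]
      · exact h
    have ha0 : a ≠ 0 := by
      rintro rfl
      simpa using hf ⟨0, hk0⟩
    obtain ⟨r, hr, hvec⟩ := exists_eq_smul_circleVec_rayPoint ha0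
    obtain ⟨w, hw1, hw2, z, hw⟩ := exists_angle_in_turn (rayPoint a : ℂ).arg (ζ 0)
    have hw' : Circle.exp w = rayPoint a := by
      rw [← Circle.exp_arg (rayPoint a), Circle.exp_eq_exp]; exact ⟨z, hw⟩
    obtain ⟨i, hi, h1, h2⟩ : ∃ i < k, ζ i ≤ w ∧ w < ζ (i + 1) := by
      have : ∀ j, j ≤ k → w < ζ j → ∃ i < k, ζ i ≤ w ∧ w < ζ (i + 1) := by
        intro j
        induction j with
        | zero => intro _ h; exact absurd hw1 (not_le.2 h)
        | succ j ih =>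
          intro hj h
          rcases le_or_gt (ζ j) w with h' | h'
          · exact ⟨j, hj, h', h⟩
          · exact ih (by omega) h'
      exact this k le_rfl (by rw [hk]; exact hw2)
    -- the normal `w` is a nonnegative combination of the normals of two consecutive cuts
    have h3 : dotProduct (circleVec (Circle.exp w)) (p ⟨i, hi⟩)
        < dotProduct (circleVec (Circle.exp w)) x := by
      have := hf ⟨i, hi⟩
      rw [hvec, ← hw', smul_dotProduct, smul_dotProduct, smul_eq_mul, smul_eq_mul] at this
      exact lt_of_mul_lt_mul_left this hr.le
    have s1 : 0 ≤ sin (ζ (i + 1) - w) :=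
      sin_nonneg_of_nonneg_of_le_pi (by linarith) (by linarith [hgap i hi])
    have s2 : 0 ≤ sin (w - ζ i) :=
      sin_nonneg_of_nonneg_of_le_pi (by linarith) (by linarith [hgap i hi])
    have c1 := circleVec_combination (ζ i) w (ζ (i + 1)) (p ⟨i, hi⟩)
    have c2 := circleVec_combination (ζ i) w (ζ (i + 1)) x
    have e1 := hp1 ⟨i, hi⟩
    have e2 := hp2 ⟨i, hi⟩
    simp only at e1 e2
    rw [e1, e2] at c1
    have m1 := mul_le_mul_of_nonneg_left (hqmax (Circle.exp (ζ i)) x hx) s1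
    have m2 := mul_le_mul_of_nonneg_left (hqmax (Circle.exp (ζ (i + 1))) x hx) s2
    have := mul_lt_mul_of_pos_left h3 (hsin i hi)
    linarith
  · intro x hx
    refine Set.mem_iInter₂.2 fun j hj => ⟨_, hq (Circle.exp (ζ j)), ?_⟩
    refine dotProduct_le_of_mem_convexHull (fun i => ?_) hx
    obtain ⟨t, ht1, ht2, ht⟩ := hlift i i.2 j (Finset.mem_range.1 hj)
    rw [← ht]
    have hs := hsin i i.2
    have hg := hgap i i.2
    have hm := hmono i i.2
    have c1 := circleVec_combination (ζ i) t (ζ (i + 1)) (p i)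
    rw [hp1, hp2] at c1
    -- compare with the point of contact of that tangent whose coefficient may be positive
    have key : ∀ z ∈ I.inner,
        sin (ζ (i + 1) - t) * dotProduct (circleVec (Circle.exp (ζ i))) (q (Circle.exp (ζ i)))
          + sin (t - ζ i) * dotProduct (circleVec (Circle.exp (ζ (i + 1))))
            (q (Circle.exp (ζ (i + 1))))
        ≤ sin (ζ (i + 1) - t) * dotProduct (circleVec (Circle.exp (ζ i))) z
          + sin (t - ζ i) * dotProduct (circleVec (Circle.exp (ζ (i + 1)))) z →
        dotProduct (circleVec (Circle.exp t)) (p i)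
          ≤ dotProduct (circleVec (Circle.exp t)) (q (Circle.exp t)) := by
      intro z hz h
      refine le_trans ?_ (hqmax (Circle.exp t) z hz)
      rw [← c1, ← circleVec_combination] at h
      exact le_of_mul_le_mul_left h hs
    rcases le_or_gt t (ζ (i + 1) + π) with h | h
    · refine key _ (hq (Circle.exp (ζ (i + 1)))) ?_
      have s1 : sin (ζ (i + 1) - t) ≤ 0 :=
        sin_nonpos_of_nonpos_of_neg_pi_le (by linarith) (by linarith)
      have := hqmax (Circle.exp (ζ i)) _ (hq (Circle.exp (ζ (i + 1))))
      nlinarith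
    · refine key _ (hq (Circle.exp (ζ i))) ?_
      have s1 : sin (t - ζ i) ≤ 0 := by
        have : 0 ≤ sin (t - ζ i - π) :=
          sin_nonneg_of_nonneg_of_le_pi (by linarith) (by linarith)
        rw [sin_sub_pi] at this
        linarith
      have := hqmax (Circle.exp (ζ (i + 1))) _ (hq (Circle.exp (ζ i)))
      nlinarith

variable {V : Set (ℝ × ℝ)} {S : Set ((ℝ × ℝ) × (ℝ × ℝ))} {emb : Plane → ℝ × ℝ}

/-- In a surrounded instance, separating polygons need as many vertices as there are cuts: an
optimal orbit gives a polygon, and a polygon gives cuts. -/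
theorem Describes.isMinVertices (h : Describes I V S emb) {T : ℝ → ℝ}
    (hT : ∀ φ, IsNextTurn V S φ (T φ)) (hne : (interior I.inner).Nonempty)
    (hout : I.outer.Nonempty) {k : ℕ} (hk : IsArcCoverOptimum (nextMap T) k)
    (hsur : I.Surrounded) : I.IsMinVertices k := by
  constructor
  · obtain ⟨x, hx⟩ := hk.1
    obtain ⟨φ, rfl⟩ : ∃ φ, x = Circle.exp φ := ⟨_, (Circle.exp_arg x).symm⟩
    have hsep := h.separates_iInter_keep hT hx
    have hmono := orbitAngle_strictMono (fun φ => (hT φ).1) φ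
    -- the last cut of an optimal orbit does not yet go around
    have hlt : ∀ i < k, orbitAngle T φ i < φ + 2 * π := by
      intro i hi
      by_contra hc
      push Not at hc
      exact absurd (hk.2 ⟨_, (orbitCovers_iff hT φ i).2 hc⟩) (not_le.2 hi)
    have hk0 : 0 < k := by
      rcases Nat.eq_zero_or_pos k with h0 | h0
      · have := (orbitCovers_iff hT φ k).1 hx
        rw [h0] at this
        simp only [orbitAngle] at this
        linarith [pi_pos]
      · exact h0
    refine exists_polygon (ζ := fun i => if i < k then orbitAngle T φ i else φ + 2 * π) hne hsur
      (fun i hi => ?_) (by simp [hk0, orbitAngle]) ?_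
    · simp only [hi, if_true]
      split_ifs
      · exact hmono (Nat.lt_succ_self i)
      · exact hlt i hi
    · convert hsep using 4 with i hi
      rw [if_pos (Finset.mem_range.1 ‹_›), nextMap_iterate hT]
  · rintro j ⟨v, hv⟩
    exact hk.2 (h.orbitCovers_of_cutsSuffice hT hout (cutsSuffice_of_polygon hv hne))

end Polygons


/-! ### The chosen candidate is the next cut -/

section Choice

open Real

/-- The integer point as a real point. -/
def castPt (z : IntPt) : ℝ × ℝ := (z.1, z.2)

/-- The value of a linear vector at the parameter `τ`. -/
def lvEval (y : LinVec) (τ : ℝ) : ℝ × ℝ := castPt y.1 + scale2 τ (castPt y.2)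

theorem castPt_sub (z w : IntPt) : castPt (z - w) = castPt z - castPt w := by
  simp [castPt]

theorem castPt_rot90 (z : IntPt) : castPt (rot90 z) = rot90 (castPt z) := by
  simp [castPt, rot90]

theorem cross2_castPt (z w : IntPt) : ((cross2 z w : ℤ) : ℝ) = cross2 (castPt z) (castPt w) := by
  simp [castPt, cross2]

theorem lvEval_constVec (z : IntPt) (τ : ℝ) : lvEval (constVec z) τ = castPt z := by
  simp [lvEval, constVec, castPt, scale2]

theorem lvEval_crossNormalVec (e : LinVec) (p q v v' : IntPt) (τ : ℝ) :
    lvEval (crossNormalVec e p q v v') τ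
      = crossNormal (castPt p) (castPt q) (castPt v) (castPt v') (lvEval e τ) := by
  ext <;>
  · simp only [lvEval, crossNormalVec, crossNormal, castPt, rot90, scale2, dot2, Prod.fst_add,
      Prod.snd_add, Prod.fst_sub, Prod.snd_sub]
    push_cast
    ring

theorem quadEval_dotQuad (x y : LinVec) (τ : ℝ) :
    quadEval (dotQuad x y) τ = dot2 (lvEval x τ) (lvEval y τ) := by
  simp only [quadEval, dotQuad, lvEval, castPt, dot2, scale2, Prod.fst_add, Prod.snd_add]
  push_cast
  ring

theorem quadEval_crossQuad (x y : LinVec) (τ : ℝ) :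
    quadEval (crossQuad x y) τ = cross2 (lvEval x τ) (lvEval y τ) := by
  simp only [quadEval, crossQuad, lvEval, castPt, cross2, scale2, Prod.fst_add, Prod.snd_add]
  push_cast
  ring

theorem quadEval_negQuad (q : Quad) (τ : ℝ) : quadEval (negQuad q) τ = -quadEval q τ := by
  simp only [quadEval, negQuad]
  push_cast
  ring

theorem quadEval_constQuad (a : ℤ) (τ : ℝ) : quadEval (constQuad a) τ = a := by
  simp [quadEval, constQuad]

/-- The conditions of a candidate hold at the parameter `τ`. -/
def Cand.Holds (c : Cand) (τ : ℝ) : Prop :=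
  (∀ q ∈ c.2.1, quadEval q τ < 0) ∧ ∀ q ∈ c.2.2, quadEval q τ ≤ 0

theorem candE_holds {e : LinVec} {V : List IntPt} {z v u : IntPt} {τ : ℝ} :
    (candE e V z v u).Holds τ ↔ dot2 (lvEval e τ) (castPt z - castPt u) < 0 ∧
      0 < dot2 (rot90 (castPt z - castPt v)) (rot90 (castPt z - castPt v)) ∧
      ∀ w ∈ V, dot2 (rot90 (castPt z - castPt v)) (castPt w - castPt v) ≤ 0 := by
  rw [Cand.Holds, candE, List.forall_mem_map]
  simp only [List.forall_mem_cons, List.not_mem_nil, false_imp_iff, implies_true, and_true,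
    quadEval_dotQuad, quadEval_negQuad, lvEval_constVec, castPt_sub, castPt_rot90, neg_lt_zero,
    and_assoc]

/-- The two candidates of a crossing point amount to one disjunction of conditions. -/
theorem candX_holds {e : LinVec} {V : List IntPt} {p q v v' : IntPt} {τ : ℝ} {y : ℝ × ℝ} :
    (∃ c ∈ candX e V p q v v', c.Holds τ ∧ lvEval c.1 τ = y) ↔
      y = crossNormal (castPt p) (castPt q) (castPt v) (castPt v') (lvEval e τ) ∧
      dot2 (lvEval e τ) (castPt p - castPt v) < 0 ∧
      dot2 (lvEval e τ) (castPt v - castPt q) ≤ 0 ∧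
      (∀ w ∈ V, dot2 (lvEval e τ) (castPt w - castPt v) ≤ 0) ∧ 0 < dot2 y y ∧
      (∀ w ∈ V, dot2 y (castPt w - castPt v') ≤ 0) ∧
      (0 < cross2 (castPt q - castPt p) (castPt p - castPt v) ∨
        (cross2 (castPt q - castPt p) (castPt p - castPt v) = 0 ∧
          cross2 (castPt p - castPt v') (castPt q - castPt p) ≤ 0)) := by
  have hS : (∀ k ∈ strictX e p q v v', quadEval k τ < 0) ↔
      dot2 (lvEval e τ) (castPt p - castPt v) < 0 ∧
      0 < dot2 (crossNormal (castPt p) (castPt q) (castPt v) (castPt v') (lvEval e τ))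
        (crossNormal (castPt p) (castPt q) (castPt v) (castPt v') (lvEval e τ)) := by
    simp [strictX, quadEval_dotQuad, quadEval_negQuad, lvEval_constVec, castPt_sub,
      lvEval_crossNormalVec]
  have hW : (∀ k ∈ weakX e V p q v v', quadEval k τ ≤ 0) ↔
      dot2 (lvEval e τ) (castPt v - castPt q) ≤ 0 ∧
      (∀ w ∈ V, dot2 (lvEval e τ) (castPt w - castPt v) ≤ 0) ∧
      ∀ w ∈ V, dot2 (crossNormal (castPt p) (castPt q) (castPt v) (castPt v') (lvEval e τ))
        (castPt w - castPt v') ≤ 0 := by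
    rw [weakX, List.forall_mem_cons, List.forall_mem_append, List.forall_mem_map,
      List.forall_mem_map]
    simp only [quadEval_dotQuad, lvEval_constVec, castPt_sub, lvEval_crossNormalVec]
  simp only [candX, List.mem_cons, List.not_mem_nil, or_false, exists_eq_or_imp, exists_eq_left]
  simp only [Cand.Holds, List.forall_mem_cons, hS, hW, quadEval_constQuad, Int.cast_neg,
    cross2_castPt, castPt_sub, lvEval_crossNormalVec, neg_lt_zero, neg_nonpos]
  constructor
  · rintro (⟨⟨⟨h1, h2, h3⟩, h4, h5, h6⟩, rfl⟩ | ⟨⟨⟨h2, h3⟩, h1, h1', h7, h4, h5, h6⟩, rfl⟩)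
    · exact ⟨rfl, h2, h4, h5, h3, h6, Or.inl h1⟩
    · exact ⟨rfl, h2, h4, h5, h3, h6, Or.inr ⟨le_antisymm h1 h1', h7⟩⟩
  · rintro ⟨rfl, h2, h4, h5, h3, h6, h1 | ⟨h1, h7⟩⟩
    · exact Or.inl ⟨⟨⟨h1, h2, h3⟩, h4, h5, h6⟩, rfl⟩
    · exact Or.inr ⟨⟨⟨h2, h3⟩, h1.le, h1.ge, h7, h4, h5, h6⟩, rfl⟩

/-- The real points of a list of integer points. -/
def castPts (V : List IntPt) : Set (ℝ × ℝ) := {v | ∃ w ∈ V, castPt w = v}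

/-- The real segments of a list of integer segments. -/
def castSegs (S : List (IntPt × IntPt)) : Set ((ℝ × ℝ) × (ℝ × ℝ)) :=
  {s | ∃ t ∈ S, (castPt t.1, castPt t.2) = s}

/-- The list of candidates at the parameter `τ` realizes the predicate `IsCand`. -/
theorem isCand_iff {e : LinVec} {V : List IntPt} {S : List (IntPt × IntPt)} {τ : ℝ} {y : ℝ × ℝ} :
    (∃ c ∈ cands e V S, c.Holds τ ∧ lvEval c.1 τ = y) ↔
      IsCand (castPts V) (castSegs (bothWays S)) (lvEval e τ) y := by
  have hmem : ∀ c : Cand, c ∈ cands e V S ↔ c = (e, [], []) ∨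
      (∃ s ∈ bothWays S, ∃ v ∈ V, ∃ u ∈ V, candE e V s.1 v u = c) ∨
      ∃ s ∈ bothWays S, ∃ v ∈ V, ∃ v' ∈ V, c ∈ candX e V s.1 s.2 v v' := by
    intro c
    simp only [cands, candsE, candsX, List.mem_cons, List.mem_append, List.mem_flatMap,
      List.mem_map]
    constructor
    · rintro (h | ⟨_, ⟨s, hs, rfl⟩, h⟩ | h)
      · exact Or.inl h
      · exact Or.inr (Or.inl ⟨s, hs, h⟩)
      · exact Or.inr (Or.inr h)
    · rintro (h | ⟨s, hs, h⟩ | h)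
      · exact Or.inl h
      · exact Or.inr (Or.inl ⟨_, ⟨s, hs, rfl⟩, h⟩)
      · exact Or.inr (Or.inr h)
  have hVs : ∀ {P : ℝ × ℝ → Prop}, (∀ w ∈ castPts V, P w) ↔ ∀ w ∈ V, P (castPt w) := by
    intro P
    constructor
    · exact fun h w hw => h _ ⟨w, hw, rfl⟩
    · rintro h _ ⟨w, hw, rfl⟩
      exact h w hw
  constructor
  · rintro ⟨c, hc, hold, hy⟩
    rcases (hmem c).1 hc with rfl | ⟨s, hs, v, hv, u, hu, rfl⟩ | ⟨s, hs, v, hv, v', hv', hX⟩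
    · exact Or.inl hy.symm
    · rw [candE_holds] at hold
      have hy' : rot90 (castPt s.1 - castPt v) = y := by
        rw [← hy, candE, lvEval_constVec, castPt_rot90, castPt_sub]
      rw [hy'] at hold
      exact Or.inr (Or.inl ⟨_, ⟨s, hs, rfl⟩, _, ⟨v, hv, rfl⟩, _, ⟨u, hu, rfl⟩, hy'.symm, hold.1,
        hold.2.1, hVs.2 hold.2.2⟩)
    · obtain ⟨h1, h2, h3, h4, h5, h6, h7⟩ := candX_holds.1 ⟨c, hX, hold, hy⟩
      exact Or.inr (Or.inr ⟨_, ⟨s, hs, rfl⟩, _, ⟨v, hv, rfl⟩, _, ⟨v', hv', rfl⟩, h1, h2, h3,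
        hVs.2 h4, h5, hVs.2 h6, h7⟩)
  · rintro (rfl | ⟨_, ⟨s, hs, rfl⟩, _, ⟨v, hv, rfl⟩, _, ⟨u, hu, rfl⟩, hy, h1, h2, h3⟩ |
      ⟨_, ⟨s, hs, rfl⟩, _, ⟨v, hv, rfl⟩, _, ⟨v', hv', rfl⟩, h1, h2, h3, h4, h5, h6, h7⟩)
    · exact ⟨(e, [], []), (hmem _).2 (Or.inl rfl), by simp [Cand.Holds], rfl⟩
    · subst hy
      refine ⟨_, (hmem _).2 (Or.inr (Or.inl ⟨s, hs, v, hv, u, hu, rfl⟩)),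
        candE_holds.2 ⟨h1, h2, hVs.1 h3⟩, ?_⟩
      rw [candE, lvEval_constVec, castPt_rot90, castPt_sub]
    · obtain ⟨c, hc, h⟩ := candX_holds.2 ⟨h1, h2, h3, hVs.1 h4, h5, hVs.1 h6, h7⟩
      exact ⟨c, (hmem _).2 (Or.inr (Or.inr ⟨s, hs, v, hv, v', hv', hc⟩)), h⟩

theorem admissible_iff {P : Place} {τ : ℝ} {c : Cand}
    (h1 : ∀ q ∈ c.2.1, IsSign (signAt P q) (quadEval q τ))
    (h2 : ∀ q ∈ c.2.2, IsSign (signAt P q) (quadEval q τ)) :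
    admissible P c = true ↔ c.Holds τ := by
  simp only [admissible, Bool.and_eq_true, List.all_eq_true, decide_eq_true_eq, Cand.Holds]
  refine and_congr (forall₂_congr fun q hq => (h1 q hq).neg_iff) (forall₂_congr fun q hq => ?_)
  have := (h2 q hq).pos_iff
  rw [← not_lt (a := (0 : ℝ)), ← this]
  omega

theorem firstHalf_iff {P : Place} {τ φ ρ r ψ : ℝ} {x y : LinVec} (hρ : 0 < ρ) (hr : 0 < r)
    (hx : lvEval x τ = scale2 ρ (dirVec φ)) (hy : lvEval y τ = scale2 r (dirVec (φ + ψ)))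
    (h0 : 0 < ψ) (h1 : ψ ≤ 2 * π)
    (hc : IsSign (signAt P (crossQuad x y)) (quadEval (crossQuad x y) τ))
    (hd : IsSign (signAt P (dotQuad x y)) (quadEval (dotQuad x y) τ)) :
    firstHalf P x y = true ↔ ψ ≤ π := by
  have ec : quadEval (crossQuad x y) τ = ρ * r * sin ψ := by
    rw [quadEval_crossQuad, hx, hy]
    simp only [cross2, scale2, dirVec, cos_add, sin_add]
    linear_combination (ρ * r * sin ψ) * sin_sq_add_cos_sq φ
  have ed : quadEval (dotQuad x y) τ = ρ * r * cos ψ := by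
    rw [quadEval_dotQuad, hx, hy]
    simp only [dot2, scale2, dirVec, cos_add, sin_add]
    linear_combination (ρ * r * cos ψ) * sin_sq_add_cos_sq φ
  have hpos := mul_pos hρ hr
  have e : firstHalf P x y = true ↔ 0 < sin ψ ∨ (sin ψ = 0 ∧ cos ψ < 0) := by
    simp only [firstHalf, Bool.or_eq_true, Bool.and_eq_true, decide_eq_true_eq,
      int_mul_self_lt_one_iff]
    rw [hc.pos_iff, hc.zero_iff, hd.neg_iff, ec, ed, mul_pos_iff_of_pos_left hpos,
      mul_eq_zero, or_iff_right hpos.ne', mul_neg_iff]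
    simp [hpos, not_lt.2 hpos.le]
  rw [e]
  constructor
  · intro h
    by_contra hlt
    push Not at hlt
    have hs : sin ψ = -sin (ψ - π) := by rw [sin_sub_pi]; ring
    rcases h1.eq_or_lt with h1 | h1
    · rw [h1, sin_two_pi, cos_two_pi] at h
      rcases h with h | h
      · exact lt_irrefl _ h
      · linarith [h.2]
    · have := sin_pos_of_pos_of_lt_pi (x := ψ - π) (by linarith) (by linarith)
      rcases h with h | h <;> linarith
  · intro h
    rcases h.eq_or_lt with h | h
    · right; rw [h]; simp
    · exact Or.inl (sin_pos_of_pos_of_lt_pi h0 h)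

/-- Turns in different half-turns are compared by `firstHalf`. Otherwise they differ by less than a
half-turn, so that the determinant decides. -/
theorem turnLt_iff {P : Place} {τ φ ρ r r' ψ ψ' : ℝ} {x y y' : LinVec} (hρ : 0 < ρ) (hr : 0 < r)
    (hr' : 0 < r') (hx : lvEval x τ = scale2 ρ (dirVec φ))
    (hy : lvEval y τ = scale2 r (dirVec (φ + ψ)))
    (hy' : lvEval y' τ = scale2 r' (dirVec (φ + ψ')))
    (h0 : 0 < ψ) (h1 : ψ ≤ 2 * π) (h0' : 0 < ψ') (h1' : ψ' ≤ 2 * π)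
    (hc : IsSign (signAt P (crossQuad x y)) (quadEval (crossQuad x y) τ))
    (hd : IsSign (signAt P (dotQuad x y)) (quadEval (dotQuad x y) τ))
    (hc' : IsSign (signAt P (crossQuad x y')) (quadEval (crossQuad x y') τ))
    (hd' : IsSign (signAt P (dotQuad x y')) (quadEval (dotQuad x y') τ))
    (hcc : IsSign (signAt P (crossQuad y y')) (quadEval (crossQuad y y') τ)) :
    turnLt P x y y' = true ↔ ψ < ψ' := by
  have e1 := firstHalf_iff hρ hr hx hy h0 h1 hc hd
  have e2 := firstHalf_iff hρ hr' hx hy' h0' h1' hc' hd'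
  have ec : quadEval (crossQuad y y') τ = r * r' * sin (ψ' - ψ) := by
    rw [quadEval_crossQuad, hy, hy', show ψ' - ψ = (φ + ψ') - (φ + ψ) by ring]
    simp only [cross2, scale2, dirVec, sin_sub]
    ring
  have e3 : 0 < signAt P (crossQuad y y') ↔ 0 < sin (ψ' - ψ) := by
    rw [hcc.pos_iff, ec, mul_pos_iff_of_pos_left (mul_pos hr hr')]
  have hsame : ψ' - ψ < π → -π < ψ' - ψ → (0 < sin (ψ' - ψ) ↔ ψ < ψ') := by
    intro ha hb
    constructor
    · intro h
      by_contra hlt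
      push Not at hlt
      have := sin_nonpos_of_nonpos_of_neg_pi_le (x := ψ' - ψ) (by linarith) hb.le
      linarith
    · intro h
      exact sin_pos_of_pos_of_lt_pi (by linarith) ha
  simp only [turnLt, Bool.or_eq_true, Bool.and_eq_true, Bool.not_eq_true', decide_eq_true_eq,
    ← Bool.not_eq_true, e1, e2, e3]
  by_cases a1 : ψ ≤ π <;> by_cases a2 : ψ' ≤ π <;> simp only [a1, a2, not_true_eq_false,
    not_false_eq_true, true_and, and_true, and_false, false_and, or_false, false_or, or_true]
  · exact hsame (by linarith) (by linarith)
  · push Not at a2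
    simp only [true_iff]
    linarith
  · push Not at a1
    simp only [false_iff]
    linarith
  · push Not at a1 a2
    exact hsame (by linarith) (by linarith)

/-- A fold that keeps the smaller of two elements finds the minimum. -/
theorem foldl_min_le {β γ : Type} (lt : β → β → Bool) (f : γ → β) (key : β → ℝ) (M : Set β)
    (hlt : ∀ a ∈ M, ∀ b ∈ M, (lt a b = true ↔ key a < key b)) (l : List γ)
    (hl : ∀ c ∈ l, f c ∈ M) (y : β) (hy : y ∈ M) :
    key (l.foldl (fun y c => if lt (f c) y = true then f c else y) y) ≤ key y ∧
      ∀ c ∈ l, key (l.foldl (fun y c => if lt (f c) y = true then f c else y) y) ≤ key (f c) := by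
  induction l generalizing y with
  | nil => simp
  | cons c l ih =>
    have hc := hl c (by simp)
    rw [List.foldl_cons]
    have hy' : (if lt (f c) y = true then f c else y) ∈ M := by
      split_ifs
      · exact hc
      · exact hy
    obtain ⟨h1, h2⟩ := ih (fun c' h => hl c' (List.mem_cons_of_mem _ h)) _ hy'
    have hle : key (if lt (f c) y = true then f c else y) ≤ key y ∧
        key (if lt (f c) y = true then f c else y) ≤ key (f c) := by
      split_ifs with h
      · exact ⟨((hlt _ hc _ hy).1 h).le, le_rfl⟩
      · exact ⟨le_rfl, not_lt.1 fun h' => h ((hlt _ hc _ hy).2 h')⟩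
    refine ⟨h1.trans hle.1, fun c' h => ?_⟩
    rcases List.mem_cons.1 h with rfl | h
    · exact h1.trans hle.2
    · exact h2 c' h

/-- The choice is a candidate with the smallest turn. -/
theorem choose_spec {P : Place} {e : LinVec} {L : List Cand} {τ φ ρ : ℝ}
    (he : ((e, [], []) : Cand) ∈ L) (hρ : 0 < ρ) (hx : lvEval e τ = scale2 ρ (dirVec φ))
    (hL : ∀ c ∈ L, c.Holds τ → 0 < dot2 (lvEval c.1 τ) (lvEval c.1 τ))
    (hsign : ∀ q ∈ quads e L, IsSign (signAt P q) (quadEval q τ)) :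
    (∃ c ∈ L, c.Holds τ ∧ c.1 = choose P e L) ∧ ∀ c ∈ L, c.Holds τ →
      turnFrom φ (lvEval (choose P e L) τ) ≤ turnFrom φ (lvEval c.1 τ) := by
  have hq : ∀ c ∈ L, (∀ q ∈ c.2.1, q ∈ quads e L) ∧ (∀ q ∈ c.2.2, q ∈ quads e L) ∧
      crossQuad e c.1 ∈ quads e L ∧ dotQuad e c.1 ∈ quads e L ∧
      ∀ c' ∈ L, crossQuad c.1 c'.1 ∈ quads e L := by
    intro c hc
    have : ∀ q ∈ c.2.1 ++ (c.2.2 ++ (crossQuad e c.1 :: dotQuad e c.1 ::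
        L.map fun c' => crossQuad c.1 c'.1)), q ∈ quads e L :=
      fun q hq => List.mem_flatMap.2 ⟨c, hc, hq⟩
    refine ⟨fun q h => this q (by simp [h]), fun q h => this q (by simp [h]), this _ (by simp),
      this _ (by simp), fun c' h => this _ ?_⟩
    have : crossQuad c.1 c'.1 ∈ L.map fun c' => crossQuad c.1 c'.1 := List.mem_map.2 ⟨c', h, rfl⟩
    simp [this]
  have hadm : ∀ c ∈ L, (admissible P c = true ↔ c.Holds τ) := fun c hc =>
    admissible_iff (fun q h => hsign q ((hq c hc).1 q h)) fun q h => hsign q ((hq c hc).2.1 q h)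
  have he' : Cand.Holds (e, [], []) τ := by simp [Cand.Holds]
  have hfil : ∀ c, c ∈ (L.filter fun c => admissible P c) ↔ c ∈ L ∧ c.Holds τ := by
    intro c
    rw [List.mem_filter]
    exact and_congr_right fun hc => hadm c hc
  set M : Set LinVec := {y | ∃ c ∈ L, c.Holds τ ∧ c.1 = y} with hM
  have hlt : ∀ a ∈ M, ∀ b ∈ M, (turnLt P e a b = true ↔
      turnFrom φ (lvEval a τ) < turnFrom φ (lvEval b τ)) := by
    rintro _ ⟨c, hc, hold, rfl⟩ _ ⟨c', hc', hold', rfl⟩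
    obtain ⟨r, hr, hy⟩ := exists_eq_scale2_turnFrom (hL c hc hold) φ
    obtain ⟨r', hr', hy'⟩ := exists_eq_scale2_turnFrom (hL c' hc' hold') φ
    obtain ⟨-, -, q1, q2, q3⟩ := hq c hc
    obtain ⟨-, -, q1', q2', -⟩ := hq c' hc'
    exact turnLt_iff hρ hr hr' hx hy hy' (turnFrom_pos _ _) (turnFrom_le _ _) (turnFrom_pos _ _)
      (turnFrom_le _ _) (hsign _ q1) (hsign _ q2) (hsign _ q1') (hsign _ q2')
      (hsign _ (q3 c' hc'))
  constructor
  · rcases foldl_min_mem (turnLt P e) (fun c : Cand => c.1) (L.filter fun c => admissible P c) e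
      with h | ⟨c, hc, h⟩
    · exact ⟨_, he, he', h.symm⟩
    · exact ⟨c, ((hfil c).1 hc).1, ((hfil c).1 hc).2, h.symm⟩
  · intro c hc hold
    have := (foldl_min_le (turnLt P e) (fun c : Cand => c.1)
      (fun y => turnFrom φ (lvEval y τ)) M hlt (L.filter fun c => admissible P c)
      (fun c hc => ⟨c, ((hfil c).1 hc).1, ((hfil c).1 hc).2, rfl⟩) e
      ⟨_, he, he', rfl⟩).2 c ((hfil c).2 ⟨hc, hold⟩)
    exact this

/-- If the signs of all polynomials are computed correctly, then the choice is the next cut. -/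
theorem isNextTurn_choose {V : List IntPt} {S : List (IntPt × IntPt)} (hV : Wide (castPts V))
    (hfin : (castPts V).Finite)
    (hS : ∀ s ∈ castSegs (bothWays S), ∃ θ, InCut (castPts V) θ s.1 ∧ InCut (castPts V) θ s.2)
    (hsymm : ∀ s ∈ castSegs (bothWays S), (s.2, s.1) ∈ castSegs (bothWays S))
    {P : Place} {e : LinVec} {τ φ ρ : ℝ} (hρ : 0 < ρ) (hx : lvEval e τ = scale2 ρ (dirVec φ))
    (hsign : ∀ q ∈ quads e (cands e V S), IsSign (signAt P q) (quadEval q τ)) :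
    ∃ r T, 0 < r ∧ IsNextTurn (castPts V) (castSegs (bothWays S)) φ T ∧
      lvEval (choose P e (cands e V S)) τ = scale2 r (dirVec (φ + T)) := by
  have hpos : ∀ c ∈ cands e V S, c.Holds τ → 0 < dot2 (lvEval c.1 τ) (lvEval c.1 τ) := by
    intro c hc hold
    rcases isCand_iff.1 ⟨c, hc, hold, rfl⟩ with h | ⟨s, hs, v, hv, u, hu, h1, h2, h3, -⟩ |
      ⟨s, hs, v, hv, v', hv', h1, h2, h3, h4, h5, -⟩
    · rw [h, hx]
      have : dot2 (scale2 ρ (dirVec φ)) (scale2 ρ (dirVec φ)) = ρ ^ 2 := by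
        simp only [dot2, scale2, dirVec]
        linear_combination (ρ ^ 2) * sin_sq_add_cos_sq φ
      rw [this]
      positivity
    · exact h3
    · exact h5
  obtain ⟨⟨c, hc, hold, hcy⟩, hmin⟩ := choose_spec (List.mem_cons_self ..) hρ hx hpos hsign
  have hcand := isCand_iff.1 ⟨c, hc, hold, rfl⟩
  have hc0 := hpos c hc hold
  rw [hcy] at hcand hc0
  obtain ⟨r, hr, hy⟩ := exists_eq_scale2_turnFrom hc0 φ
  refine ⟨r, _, hr, ⟨turnFrom_pos _ _, turnFrom_le _ _, ?_, ?_⟩, hy⟩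
  · refine follows_of_le_turn hV hfin hS hsymm hρ (turnFrom_le _ _) fun y hy _ => ?_
    rw [← hx] at hy
    obtain ⟨c', hc', hold', rfl⟩ := isCand_iff.2 hy
    exact hmin c' hc' hold'
  · intro T' _ hT' hF
    rw [hx] at hcand
    exact turn_le_of_isCand hV hS hρ hcand hr (turnFrom_pos _ _) (turnFrom_le _ _) hy hT' hF

end Choice


/-! ### Instances in integer coordinates -/

section Instance

open Real

variable {m n : ℕ} {I : SepInstance m n}

/-- Three vertices in strictly convex position span the plane. -/
theorem interior_inner_nonempty (hI : I.Valid) : (interior I.inner).Nonempty := by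
  obtain ⟨hm, -, hconv, -⟩ := hI
  rw [SepInstance.inner, interior_convexHull_nonempty_iff_affineSpan_eq_top]
  set v : Fin m → Plane := fun i => ratPoint (I.vertex i) with hv
  have hne : (Set.range v).Nonempty := ⟨_, ⟨⟨0, by omega⟩, rfl⟩⟩
  rw [AffineSubspace.affineSpan_eq_top_iff_vectorSpan_eq_top_of_nonempty ℝ Plane Plane hne,
    eq_top_iff]
  intro z _
  have hd := hconv ⟨0, by omega⟩ ⟨1, by omega⟩ ⟨2, by omega⟩ (Fin.mk_lt_mk.2 (by norm_num))
    (Fin.mk_lt_mk.2 (by norm_num))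
  set q := I.vertex ⟨0, by omega⟩ with hq
  set q' := I.vertex ⟨1, by omega⟩ with hq'
  set q'' := I.vertex ⟨2, by omega⟩ with hq''
  have hd' : (0 : ℝ) < (q'.1 - q.1) * (q''.2 - q.2) - (q'.2 - q.2) * (q''.1 - q.1) := by
    exact_mod_cast hd
  set Δ : ℝ := (q'.1 - q.1) * (q''.2 - q.2) - (q'.2 - q.2) * (q''.1 - q.1) with hΔ
  have h1 : ratPoint q' - ratPoint q ∈ vectorSpan ℝ (Set.range v) :=
    vsub_mem_vectorSpan ℝ ⟨_, rfl⟩ ⟨_, rfl⟩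
  have h2 : ratPoint q'' - ratPoint q ∈ vectorSpan ℝ (Set.range v) :=
    vsub_mem_vectorSpan ℝ ⟨_, rfl⟩ ⟨_, rfl⟩
  -- Cramer's rule
  have e : z = ((z 0 * (q''.2 - q.2) - z 1 * (q''.1 - q.1)) / Δ) • (ratPoint q' - ratPoint q)
      + (((q'.1 - q.1) * z 1 - (q'.2 - q.2) * z 0) / Δ) • (ratPoint q'' - ratPoint q) := by
    have hne := hd'.ne'
    ext i
    fin_cases i
    · simp only [ratPoint, Fin.zero_eta, Pi.add_apply, Pi.smul_apply, Pi.sub_apply, smul_eq_mul,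
        Matrix.cons_val_zero]
      field_simp
      rw [hΔ]; ring
    · simp only [ratPoint, Fin.mk_one, Pi.add_apply, Pi.smul_apply, Pi.sub_apply, smul_eq_mul,
        Matrix.cons_val_one, Matrix.cons_val_zero]
      field_simp
      rw [hΔ]; ring
  rw [e]
  exact Submodule.add_mem _ (Submodule.smul_mem _ _ h1) (Submodule.smul_mem _ _ h2)

theorem outer_nonempty (hI : I.Valid) : I.outer.Nonempty :=
  ⟨_, Set.mem_iUnion.2 ⟨⟨0, hI.2.1⟩, left_mem_segment ℝ _ _⟩⟩

/-- The point `z` in coordinates, scaled by `D`. -/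
noncomputable def scaledPt (D : ℝ) (z : Plane) : ℝ × ℝ := scale2 D (pairOf z)

theorem scaledPt_injective {D : ℝ} (hD : 0 < D) : Function.Injective (scaledPt D) := by
  intro y z h
  have h1 := congrArg Prod.fst h
  have h2 := congrArg Prod.snd h
  ext i
  fin_cases i
  · exact mul_left_cancel₀ hD.ne' h1
  · exact mul_left_cancel₀ hD.ne' h2

theorem inCut_scaledPt {D : ℝ} (hD : 0 < D) {k : ℕ} {v : Fin k → Plane} {θ : ℝ} {z : Plane} :
    InCut (Set.range fun i => scaledPt D (v i)) θ (scaledPt D z)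
      ↔ InCut (Set.range fun i => pairOf (v i)) θ (pairOf z) := by
  simp only [InCut, Set.forall_mem_range, scaledPt, dot2_scale2_right, mul_le_mul_iff_right₀ hD]

/-- The segments of the instance in both orientations, scaled by `D`. -/
def scaledSegs (I : SepInstance m n) (D : ℝ) : Set ((ℝ × ℝ) × (ℝ × ℝ)) :=
  {s | ∃ i, s = (scaledPt D (ratPoint (I.seg i).1), scaledPt D (ratPoint (I.seg i).2)) ∨
    s = (scaledPt D (ratPoint (I.seg i).2), scaledPt D (ratPoint (I.seg i).1))}

theorem mem_segment_iff_linePt {D : ℝ} (hD : 0 < D) (p q z : Plane) :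
    z ∈ segment ℝ p q ↔
      ∃ t, 0 ≤ t ∧ t ≤ 1 ∧ scaledPt D z = linePt (scaledPt D p) (scaledPt D q) t := by
  have e : ∀ t : ℝ, linePt (scaledPt D p) (scaledPt D q) t = scaledPt D (p + t • (q - p)) := by
    intro t
    ext <;> simp [linePt, scaledPt, scale2, pairOf] <;> ring
  rw [segment_eq_image']
  constructor
  · rintro ⟨t, ht, rfl⟩
    exact ⟨t, ht.1, ht.2, (e t).symm⟩
  · rintro ⟨t, h0, h1, h⟩
    rw [e] at h
    exact ⟨t, ⟨h0, h1⟩, (scaledPt_injective hD h).symm⟩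

/-- A homothety does not affect the cuts, so that the scaled points describe the instance. The
common cut of a segment comes from its separation from the interior of the polygon. -/
theorem describes_scaled (hI : I.Valid) {D : ℝ} (hD : 0 < D) :
    Describes I (Set.range fun i => scaledPt D (ratPoint (I.vertex i))) (scaledSegs I D)
      (scaledPt D) where
  cut_iff θ z := by
    rw [inCut_scaledPt hD]
    constructor
    · rintro h _ ⟨i, rfl⟩
      rw [← circleVec_dotProduct, ← circleVec_dotProduct]
      exact h _ (subset_convexHull ℝ _ ⟨i, rfl⟩)
    · intro h p hp
      refine dotProduct_le_of_mem_convexHull (fun i => ?_) hp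
      rw [circleVec_dotProduct, circleVec_dotProduct]
      exact h _ ⟨i, rfl⟩
  outer_iff z := by
    simp only [SepInstance.outer, Set.mem_iUnion, SepInstance.segmentSet]
    constructor
    · rintro ⟨i, hi⟩
      obtain ⟨t, h⟩ := (mem_segment_iff_linePt hD _ _ _).1 hi
      exact ⟨_, ⟨i, Or.inl rfl⟩, t, h⟩
    · rintro ⟨_, ⟨i, rfl | rfl⟩, h⟩
      · exact ⟨i, (mem_segment_iff_linePt hD _ _ _).2 h⟩
      · refine ⟨i, ?_⟩
        rw [segment_symm]
        exact (mem_segment_iff_linePt hD _ _ _).2 h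
  surj y := by
    refine ⟨![y.1 / D, y.2 / D], ?_⟩
    ext <;> simp [scaledPt, scale2, pairOf, mul_div_cancel₀ _ hD.ne']
  wide θ := by
    obtain ⟨_, ⟨i, rfl⟩, _, ⟨j, rfl⟩, hne⟩ :=
      wide_of_interior_nonempty (interior_inner_nonempty hI) θ
    refine ⟨_, ⟨i, rfl⟩, _, ⟨j, rfl⟩, ?_⟩
    simp only [scaledPt, dot2_scale2_right]
    exact fun h => hne (mul_left_cancel₀ hD.ne' h)
  finite := Set.finite_range _
  common_cut := by
    have key : ∀ i, ∃ θ,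
        InCut (Set.range fun i => scaledPt D (ratPoint (I.vertex i))) θ
          (scaledPt D (ratPoint (I.seg i).1)) ∧
        InCut (Set.range fun i => scaledPt D (ratPoint (I.vertex i))) θ
          (scaledPt D (ratPoint (I.seg i).2)) := by
      intro i
      obtain ⟨θ, hθ⟩ := exists_inCut_of_disjoint_interior (interior_inner_nonempty hI)
        (convex_segment (𝕜 := ℝ) (ratPoint (I.seg i).1) (ratPoint (I.seg i).2))
        ⟨_, left_mem_segment ℝ _ _⟩ (hI.2.2.2 i)
      exact ⟨θ, (inCut_scaledPt hD).2 (hθ _ (left_mem_segment ℝ _ _)),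
        (inCut_scaledPt hD).2 (hθ _ (right_mem_segment ℝ _ _))⟩
    rintro _ ⟨i, rfl | rfl⟩
    · exact key i
    · obtain ⟨θ, h1, h2⟩ := key i
      exact ⟨θ, h2, h1⟩
  symm := by
    rintro _ ⟨i, rfl | rfl⟩
    · exact ⟨i, Or.inr rfl⟩
    · exact ⟨i, Or.inl rfl⟩

/-- Every segment has a cut of its own. -/
theorem exists_cuts (hI : I.Valid) : ∃ u : Fin n → Circle, ∀ z ∈ I.outer, ∃ j, z ∈ I.cut (u j) := by
  have h := describes_scaled hI one_pos
  have key : ∀ i, ∃ u : Circle, ∀ z ∈ I.segmentSet i, z ∈ I.cut u := by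
    intro i
    obtain ⟨θ, h1, h2⟩ := h.common_cut _ ⟨i, Or.inl rfl⟩
    refine ⟨Circle.exp θ, fun z hz => (h.cut_iff θ z).2 ?_⟩
    obtain ⟨t, h3, h4, e⟩ := (mem_segment_iff_linePt one_pos _ _ _).1 hz
    rw [e]
    exact inCut_linePt h1 h2 h3 h4
  choose u hu using key
  refine ⟨u, fun z hz => ?_⟩
  obtain ⟨i, hi⟩ := Set.mem_iUnion.1 hz
  exact ⟨i, hu i z hi⟩

/-! ### The input of the algorithm -/

/-- The point as numerators and denominators. -/
def fracPt (q : ℚ × ℚ) : FracPt := ((q.1.num, q.1.den), (q.2.num, q.2.den))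

/-- The instance as the input of the algorithm. -/
def inputOf (I : SepInstance m n) : List FracPt × List (FracPt × FracPt) :=
  (List.ofFn fun i => fracPt (I.vertex i),
    List.ofFn fun i => (fracPt (I.seg i).1, fracPt (I.seg i).2))

theorem enc_inputOf (I : SepInstance m n) : Enc.enc (inputOf I) = I.toData := by
  change Data.pair (Data.ofList (List.map _ _)) (Data.ofList (List.map _ _)) = _
  rw [inputOf, List.map_ofFn, List.map_ofFn]
  rfl

theorem esize_inputOf_le {b : ℕ} (hb : I.BitsAtMost b) :
    esize (inputOf I) ≤ 3 + (m + n + b) * (8 * (m + n + b) + 16) := by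
  have hpt : ∀ q : ℚ × ℚ, ratBits q.1 ≤ b → ratBits q.2 ≤ b → esize (fracPt q) ≤ 4 * b + 7 := by
    intro q h1 h2
    simp only [ratBits, max_le_iff] at h1 h2
    simp only [fracPt, esize_pair, esize_int]
    omega
  have hV : esize (inputOf I).1 ≤ (4 * b + 8) * m + 1 := by
    refine (esize_list_le _ (4 * b + 7) ?_).trans_eq ?_
    · intro a ha
      obtain ⟨i, rfl⟩ := (List.mem_ofFn' _ _).1 ha
      exact hpt _ (hb.1 i).1 (hb.1 i).2
    · simp [inputOf]
  have hS : esize (inputOf I).2 ≤ (8 * b + 16) * n + 1 := by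
    refine (esize_list_le _ (8 * b + 15) ?_).trans_eq ?_
    · intro a ha
      obtain ⟨i, rfl⟩ := (List.mem_ofFn' _ _).1 ha
      obtain ⟨h1, h2, h3, h4⟩ := hb.2 i
      have e1 := hpt _ h1 h2
      have e2 := hpt _ h3 h4
      rw [esize_pair]
      omega
    · simp [inputOf]
  have : esize (inputOf I) = esize (inputOf I).1 + esize (inputOf I).2 + 1 := rfl
  nlinarith

theorem foldl_mul_eq (l : List ℤ) (x : ℤ) : l.foldl (fun x y => x * y) x = x * l.prod := by
  induction l generalizing x with
  | nil => simp
  | cons y l ih => rw [List.foldl_cons, ih, List.prod_cons, mul_assoc]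

theorem commonDenom_spec (V : List FracPt) (S : List (FracPt × FracPt))
    (h : ∀ q ∈ V ++ ((S.map fun s => s.1) ++ S.map fun s => s.2), 0 < q.1.2 ∧ 0 < q.2.2) :
    0 < commonDenom V S ∧ ∀ q ∈ V ++ ((S.map fun s => s.1) ++ S.map fun s => s.2),
      q.1.2 ∣ commonDenom V S ∧ q.2.2 ∣ commonDenom V S := by
  rw [commonDenom, foldl_mul_eq, one_mul]
  constructor
  · refine List.prod_pos fun a ha => ?_
    obtain ⟨q, hq, ha⟩ := List.mem_flatMap.1 ha
    simp only [List.mem_cons, List.not_mem_nil, or_false] at ha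
    rcases ha with rfl | rfl
    · exact (h q hq).1
    · exact (h q hq).2
  · intro q hq
    exact ⟨List.dvd_prod (List.mem_flatMap.2 ⟨q, hq, by simp⟩),
      List.dvd_prod (List.mem_flatMap.2 ⟨q, hq, by simp⟩)⟩

theorem castPt_clearPt {D : ℤ} {q : ℚ × ℚ} (h1 : (q.1.den : ℤ) ∣ D) (h2 : (q.2.den : ℤ) ∣ D) :
    castPt (clearPt D (fracPt q)) = scaledPt D (ratPoint q) := by
  have key : ∀ r : ℚ, (r.den : ℤ) ∣ D → ((r.num * (D / r.den) : ℤ) : ℝ) = D * (r : ℝ) := by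
    rintro r ⟨c, rfl⟩
    have h0 : (r.den : ℤ) ≠ 0 := by exact_mod_cast r.den_ne_zero
    have h0' : (r.den : ℝ) ≠ 0 := by exact_mod_cast r.den_ne_zero
    rw [Int.mul_ediv_cancel_left _ h0, Rat.cast_def]
    push_cast
    field_simp
  exact Prod.ext (key _ h1) (key _ h2)

/-- The integer coordinates that the algorithm works with describe the instance. -/
theorem describes_cleared (hI : I.Valid) : ∃ emb : Plane → ℝ × ℝ,
    Describes I
      (castPts (clearVertices (commonDenom (inputOf I).1 (inputOf I).2) (inputOf I).1))
      (castSegs (bothWays (clearSegs (commonDenom (inputOf I).1 (inputOf I).2) (inputOf I).2)))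
      emb := by
  have hmemV : ∀ i, fracPt (I.vertex i) ∈ (inputOf I).1 := fun i =>
    (List.mem_ofFn' _ _).2 ⟨i, rfl⟩
  have hmemS : ∀ i, (fracPt (I.seg i).1, fracPt (I.seg i).2) ∈ (inputOf I).2 := fun i =>
    (List.mem_ofFn' _ _).2 ⟨i, rfl⟩
  have hpos : ∀ q : ℚ × ℚ, 0 < (fracPt q).1.2 ∧ 0 < (fracPt q).2.2 := fun q =>
    ⟨Int.natCast_pos.2 q.1.den_pos, Int.natCast_pos.2 q.2.den_pos⟩
  obtain ⟨hD, hdvd⟩ := commonDenom_spec (inputOf I).1 (inputOf I).2 (by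
    intro q hq
    simp only [List.mem_append, List.mem_map] at hq
    rcases hq with hq | ⟨s, hs, rfl⟩ | ⟨s, hs, rfl⟩
    · obtain ⟨i, rfl⟩ := (List.mem_ofFn' _ _).1 hq
      exact hpos _
    · obtain ⟨i, rfl⟩ := (List.mem_ofFn' _ _).1 hs
      exact hpos _
    · obtain ⟨i, rfl⟩ := (List.mem_ofFn' _ _).1 hs
      exact hpos _)
  set D := commonDenom (inputOf I).1 (inputOf I).2 with hDdef
  have eV : ∀ i, castPt (clearPt D (fracPt (I.vertex i))) = scaledPt D (ratPoint (I.vertex i)) :=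
    fun i => by
      have := hdvd (fracPt (I.vertex i)) (by simp [hmemV i])
      exact castPt_clearPt this.1 this.2
  have eS1 : ∀ i, castPt (clearPt D (fracPt (I.seg i).1)) = scaledPt D (ratPoint (I.seg i).1) :=
    fun i => by
      have := hdvd (fracPt (I.seg i).1) (by
        simp only [List.mem_append, List.mem_map]
        exact Or.inr (Or.inl ⟨_, hmemS i, rfl⟩))
      exact castPt_clearPt this.1 this.2
  have eS2 : ∀ i, castPt (clearPt D (fracPt (I.seg i).2)) = scaledPt D (ratPoint (I.seg i).2) :=
    fun i => by
      have := hdvd (fracPt (I.seg i).2) (by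
        simp only [List.mem_append, List.mem_map]
        exact Or.inr (Or.inr ⟨_, hmemS i, rfl⟩))
      exact castPt_clearPt this.1 this.2
  refine ⟨scaledPt D, ?_⟩
  have h := describes_scaled hI (D := D) (by exact_mod_cast hD)
  convert h using 1
  · ext v
    constructor
    · rintro ⟨w, hw, rfl⟩
      obtain ⟨q, hq, rfl⟩ := List.mem_map.1 hw
      obtain ⟨i, rfl⟩ := (List.mem_ofFn' _ _).1 hq
      exact ⟨i, (eV i).symm⟩
    · rintro ⟨i, rfl⟩
      exact ⟨_, List.mem_map.2 ⟨_, hmemV i, rfl⟩, eV i⟩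
  · ext s
    constructor
    · rintro ⟨w, hw, rfl⟩
      rcases List.mem_append.1 hw with hw | hw
      · obtain ⟨q, hq, rfl⟩ := List.mem_map.1 hw
        obtain ⟨i, rfl⟩ := (List.mem_ofFn' _ _).1 hq
        exact ⟨i, Or.inl (Prod.ext (eS1 i) (eS2 i))⟩
      · obtain ⟨w', hw', rfl⟩ := List.mem_map.1 hw
        obtain ⟨q, hq, rfl⟩ := List.mem_map.1 hw'
        obtain ⟨i, rfl⟩ := (List.mem_ofFn' _ _).1 hq
        exact ⟨i, Or.inr (Prod.ext (eS2 i) (eS1 i))⟩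
    · rintro ⟨i, rfl | rfl⟩
      · exact ⟨_, List.mem_append.2 (Or.inl (List.mem_map.2 ⟨_, hmemS i, rfl⟩)),
          Prod.ext (eS1 i) (eS2 i)⟩
      · exact ⟨_, List.mem_append.2 (Or.inr (List.mem_map.2 ⟨_, List.mem_map.2 ⟨_, hmemS i, rfl⟩,
          rfl⟩)), Prod.ext (eS2 i) (eS1 i)⟩

end Instance


/-! ### The output describes the next cut -/

section Output

open Real

/-- The angle of the first vector of a quadrant. -/
noncomputable def quadAngle (e : LinVec) : ℝ :=
  if e.1.1 = 1 then 0 else if e.1.2 = 1 then π / 2 else if e.1.1 = -1 then π else 3 * π / 2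

theorem quadAngle_spec {e : LinVec} (he : e ∈ quadrants) :
    castPt e.1 = dirVec (quadAngle e) ∧ castPt e.2 = rot90 (dirVec (quadAngle e)) := by
  have h1 : cos (3 * π / 2) = 0 := by
    rw [show 3 * π / 2 = π / 2 + π by ring, cos_add_pi, cos_pi_div_two, neg_zero]
  have h2 : sin (3 * π / 2) = -1 := by
    rw [show 3 * π / 2 = π / 2 + π by ring, sin_add_pi, sin_pi_div_two]
  simp only [quadrants, List.mem_cons, List.not_mem_nil, or_false] at he
  rcases he with rfl | rfl | rfl | rfl <;>
    simp [quadAngle, castPt, dirVec, rot90, h1, h2]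

theorem quadAngle_nonneg (e : LinVec) : 0 ≤ quadAngle e := by
  have := pi_pos
  unfold quadAngle
  split_ifs <;> positivity

theorem quadAngle_le (e : LinVec) : quadAngle e ≤ 3 * π / 2 := by
  have := pi_pos
  unfold quadAngle
  split_ifs <;> linarith

theorem exists_next_quadrant {e : LinVec} (he : e ∈ quadrants) :
    quadAngle e + π / 2 = 2 * π ∨ ∃ e' ∈ quadrants, quadAngle e' = quadAngle e + π / 2 := by
  simp only [quadrants, List.mem_cons, List.not_mem_nil, or_false, exists_eq_or_imp,
    exists_eq_left] at he ⊢
  rcases he with rfl | rfl | rfl | rfl <;> simp [quadAngle] <;> ring_nf <;> simp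

theorem exists_quadrant {ω : ℝ} (h0 : 0 ≤ ω) (h1 : ω < 2 * π) :
    ∃ e ∈ quadrants, ∃ α, 0 ≤ α ∧ α < π / 2 ∧ ω = quadAngle e + α := by
  simp only [quadrants, List.mem_cons, List.not_mem_nil, or_false, exists_eq_or_imp,
    exists_eq_left]
  rcases lt_or_ge ω (π / 2) with h | h
  · exact Or.inl ⟨ω, h0, h, by simp [quadAngle]⟩
  rcases lt_or_ge ω π with h | h
  · exact Or.inr (Or.inl ⟨ω - π / 2, by linarith, by linarith, by simp [quadAngle]⟩)
  rcases lt_or_ge ω (3 * π / 2) with h | h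
  · exact Or.inr (Or.inr (Or.inl ⟨ω - π, by linarith, by linarith, by simp [quadAngle]⟩))
  · exact Or.inr (Or.inr (Or.inr ⟨ω - 3 * π / 2, by linarith, by linarith, by simp [quadAngle]⟩))

theorem lvEval_tan {e : LinVec} (he : e ∈ quadrants) {α : ℝ} (hα : 0 < cos α) :
    lvEval e (tan α) = scale2 (1 / cos α) (dirVec (quadAngle e + α)) := by
  obtain ⟨h1, h2⟩ := quadAngle_spec he
  rw [lvEval, h1, h2, tan_eq_sin_div_cos]
  ext
  · simp only [dirVec, rot90, scale2, Prod.fst_add, cos_add]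
    field_simp
    ring
  · simp only [dirVec, rot90, scale2, Prod.snd_add, sin_add]
    field_simp

/-- The output of the algorithm, read as a radical. -/
def radicalOf (a b c : ℤ) : Radical := ⟨a, b, c⟩

/-- The ray that is written by `rayOut`. -/
def rayOf (e : LinVec) (r : QuadRoot) : RadicalRay :=
  ⟨radicalOf (r.1 * e.1.1 + r.2.1 * e.2.1) (r.2.2.1 * e.2.1) r.2.2.2,
    radicalOf (r.1 * e.1.2 + r.2.1 * e.2.2) (r.2.2.1 * e.2.2) r.2.2.2⟩

/-- The linear rational function that is written as a pair of matrices. -/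
def linRatOf (M : MatOut × MatOut) : LinRat :=
  ⟨!![M.1.1.1, M.1.1.2; M.1.2.1, M.1.2.2], !![M.2.1.1, M.2.1.2; M.2.2.1, M.2.2.2]⟩

theorem toData_radicalOf (a b c : ℤ) : (radicalOf a b c).toData = Enc.enc (radOut a b c) := by
  simp [radicalOf, Radical.toData, ratData, radOut, Enc.enc]

theorem toData_rayOf (e : LinVec) (r : QuadRoot) : (rayOf e r).toData = Enc.enc (rayOut e r) := by
  rw [RadicalRay.toData, rayOf, toData_radicalOf, toData_radicalOf]
  rfl

theorem toData_linRatOf (M : MatOut × MatOut) : (linRatOf M).toData = Enc.enc M := by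
  simp [linRatOf, LinRat.toData, matrixData, Enc.enc]

theorem bits_radicalOf_le (a b c : ℤ) : (radicalOf a b c).bits ≤ esize (radOut a b c) := by
  simp only [radicalOf, Radical.bits, ratBits, Rat.num_intCast, Rat.den_intCast, radOut,
    esize_pair, esize_int, Nat.cast_one]
  omega

theorem bits_rayOf_le (e : LinVec) (r : QuadRoot) : (rayOf e r).bits ≤ esize (rayOut e r) := by
  have h1 := bits_radicalOf_le (r.1 * e.1.1 + r.2.1 * e.2.1) (r.2.2.1 * e.2.1) r.2.2.2
  have h2 := bits_radicalOf_le (r.1 * e.1.2 + r.2.1 * e.2.2) (r.2.2.1 * e.2.2) r.2.2.2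
  simp only [RadicalRay.bits, rayOf, rayOut, esize_pair]
  omega

theorem bitsAtMost_linRatOf (M : MatOut × MatOut) : (linRatOf M).BitsAtMost (esize M) := by
  obtain ⟨⟨⟨a, b⟩, c, d⟩, ⟨a', b'⟩, c', d'⟩ := M
  intro i j
  simp only [esize_pair, esize_int]
  fin_cases i <;> fin_cases j <;> simp [linRatOf] <;> omega

theorem LinRat.BitsAtMost.mono {f : LinRat} {B B' : ℕ} (h : f.BitsAtMost B) (hB : B ≤ B') :
    f.BitsAtMost B' := fun i j => ⟨(h i j).1.trans hB, (h i j).2.trans hB⟩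

/-- The angle of a breakpoint. -/
noncomputable def placeAngle (p : LinVec × QuadRoot) : ℝ := quadAngle p.1 + arctan (rootVal p.2)

theorem rayPoint_of_eq {x : Plane} {ρ θ : ℝ} (hρ : 0 < ρ) (h : pairOf x = scale2 ρ (dirVec θ)) :
    rayPoint x = Circle.exp θ := by
  have h1 : x 0 = ρ * cos θ := congrArg Prod.fst h
  have h2 : x 1 = ρ * sin θ := congrArg Prod.snd h
  have e : (⟨x 0, x 1⟩ : ℂ) = ρ * (Complex.cos θ + Complex.sin θ * Complex.I) := by
    apply Complex.ext
    · simp [h1, ← Complex.ofReal_cos, ← Complex.ofReal_sin]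
    · simp [h2, ← Complex.ofReal_cos, ← Complex.ofReal_sin]
  rw [rayPoint, e, Complex.arg_mul_cos_add_sin_mul_I_eq_toIocMod hρ, Circle.exp_eq_exp]
  refine ⟨-toIocDiv two_pi_pos (-π) θ, ?_⟩
  have := self_sub_toIocDiv_zsmul two_pi_pos (-π) θ
  rw [zsmul_eq_mul] at this
  push_cast
  linarith

theorem exists_pairOf_eq_of_rayPoint {x : Plane} (hx : x ≠ 0) {θ : ℝ}
    (h : rayPoint x = Circle.exp θ) : ∃ ρ, 0 < ρ ∧ pairOf x = scale2 ρ (dirVec θ) := by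
  obtain ⟨ρ, hρ, e⟩ := exists_eq_smul_circleVec_rayPoint hx
  rw [h, circleVec_exp] at e
  exact ⟨ρ, hρ, Prod.ext (congrFun e 0) (congrFun e 1)⟩

theorem pairOf_rayOf {e : LinVec} {r : QuadRoot} (hr : RootOk r) :
    pairOf (rayOf e r).val = scale2 (r.1 : ℝ) (lvEval e (rootVal r)) := by
  have h0 : (r.1 : ℝ) ≠ 0 := by exact_mod_cast hr.1.ne'
  ext
  · simp only [pairOf, rayOf, RadicalRay.val, radicalOf, Radical.val, lvEval, castPt, scale2,
      rootVal, Matrix.cons_val_zero, Prod.fst_add]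
    push_cast
    field_simp
    ring
  · simp only [pairOf, rayOf, RadicalRay.val, radicalOf, Radical.val, lvEval, castPt, scale2,
      rootVal, Matrix.cons_val_one, Matrix.cons_val_zero, Prod.snd_add]
    push_cast
    field_simp
    ring

theorem rayOf_spec {e : LinVec} (he : e ∈ quadrants) {r : QuadRoot} (hr : RootOk r) :
    (rayOf e r).Valid ∧ rayPoint (rayOf e r).val = Circle.exp (placeAngle (e, r)) := by
  have h0 : (0 : ℝ) < r.1 := by exact_mod_cast hr.1
  have hc := cos_arctan_pos (rootVal r)
  have h1 : pairOf (rayOf e r).val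
      = scale2 (r.1 * (1 / cos (arctan (rootVal r)))) (dirVec (placeAngle (e, r))) := by
    rw [pairOf_rayOf hr]
    have := lvEval_tan he hc
    rw [tan_arctan] at this
    rw [this]
    simp only [scale2, placeAngle, mul_assoc]
  have hpos : 0 < r.1 * (1 / cos (arctan (rootVal r))) := by positivity
  refine ⟨⟨?_, ?_, ?_⟩, rayPoint_of_eq hpos h1⟩
  · exact Int.cast_nonneg hr.2
  · exact Int.cast_nonneg hr.2
  · intro h
    rw [h] at h1
    have e1 := congrArg Prod.fst h1
    have e2 := congrArg Prod.snd h1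
    simp only [pairOf, scale2, dirVec, Pi.zero_apply] at e1 e2
    have e3 := (mul_eq_zero.1 e1.symm).resolve_left hpos.ne'
    have e4 := (mul_eq_zero.1 e2.symm).resolve_left hpos.ne'
    have := sin_sq_add_cos_sq (placeAngle (e, r))
    rw [e3, e4] at this
    norm_num at this

/-- On a ray in the quadrant, the output matrices evaluate the linear vector `y`. -/
theorem agreesAt_linOut {e y : LinVec} (he : e ∈ quadrants) {α r θ : ℝ} (h0 : 0 ≤ α)
    (h1 : α < π / 2) {x : Plane} (hx : x ≠ 0) (hxα : rayPoint x = Circle.exp (quadAngle e + α))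
    (hr : 0 < r) (hy : lvEval y (tan α) = scale2 r (dirVec θ)) {g : Circle → Circle}
    (hg : g (Circle.exp (quadAngle e + α)) = Circle.exp θ) :
    (linRatOf (linOut e y)).AgreesAt g x := by
  obtain ⟨ρ, hρ, hxe⟩ := exists_pairOf_eq_of_rayPoint hx hxα
  have hc : 0 < cos α := cos_pos_of_mem_Ioo ⟨by linarith, h1⟩
  obtain ⟨e1, e2⟩ := quadAngle_spec he
  have hX : dot2 (castPt e.1) (pairOf x) = ρ * cos α := by
    rw [e1, hxe]
    simp only [dot2, scale2, dirVec, cos_add, sin_add]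
    linear_combination (ρ * cos α) * sin_sq_add_cos_sq (quadAngle e)
  have hY : dot2 (castPt e.2) (pairOf x) = ρ * cos α * tan α := by
    rw [e2, hxe, tan_eq_sin_div_cos]
    simp only [dot2, scale2, dirVec, rot90, cos_add, sin_add]
    field_simp
    linear_combination (sin α) * sin_sq_add_cos_sq (quadAngle e)
  have hpos : 0 < ρ * cos α := mul_pos hρ hc
  have hden : ∀ i, (linRatOf (linOut e y)).denom x i = ρ * cos α := by
    intro i
    rw [← hX]
    fin_cases i <;>
      simp [LinRat.denom, linRatOf, linOut, Matrix.mulVec, dotProduct, Fin.sum_univ_two, dot2,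
        castPt, pairOf]
  have hnum : pairOf ((linRatOf (linOut e y)).numer x)
      = scale2 (ρ * cos α) (lvEval y (tan α)) := by
    have : scale2 (ρ * cos α) (lvEval y (tan α))
        = scale2 (ρ * cos α) (castPt y.1) + scale2 (ρ * cos α * tan α) (castPt y.2) := by
      ext <;> simp [lvEval, scale2] <;> ring
    rw [this, ← hY, ← hX]
    ext <;>
    · simp [LinRat.numer, linRatOf, linOut, Matrix.mulVec, dotProduct, Fin.sum_univ_two, dot2,
        castPt, pairOf, scale2]
      ring
  have heval : pairOf ((linRatOf (linOut e y)).eval x) = scale2 r (dirVec θ) := by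
    rw [← hy]
    have n1 := congrArg Prod.fst hnum
    have n2 := congrArg Prod.snd hnum
    ext
    · simp only [pairOf, LinRat.eval, hden] at n1 ⊢
      rw [n1, scale2, mul_div_cancel_left₀ _ hpos.ne']
    · simp only [pairOf, LinRat.eval, hden] at n2 ⊢
      rw [n2, scale2, mul_div_cancel_left₀ _ hpos.ne']
  refine ⟨fun i => ?_, fun h => ?_, ?_⟩
  · rw [hden]
    exact hpos.ne'
  · rw [h] at heval
    have c1 := congrArg Prod.fst heval
    have c2 := congrArg Prod.snd heval
    simp only [pairOf, scale2, dirVec, Pi.zero_apply] at c1 c2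
    have c3 := (mul_eq_zero.1 c1.symm).resolve_left hr.ne'
    have c4 := (mul_eq_zero.1 c2.symm).resolve_left hr.ne'
    have := sin_sq_add_cos_sq θ
    rw [c3, c4] at this
    norm_num at this
  · rw [rayPoint_of_eq hr heval, hxα, hg]

/-- At every parameter, the signs of the polynomials can be computed from a breakpoint. -/
theorem exists_place (Q : List Quad) {τ : ℝ} (hτ : 0 ≤ τ) :
    ∃ P : Place, ∀ q ∈ Q, IsSign (signAt P q) (quadEval q τ) := by
  obtain ⟨-, hok, ⟨r₀, hr₀, hv₀⟩, hroot⟩ := breaks_spec Q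
  obtain ⟨r, hr, hmax⟩ := ((breaks Q).finite_toSet.subset
      (t := {r | r ∈ breaks Q ∧ rootVal r ≤ τ}) fun r h => h.1).exists_maximalFor rootVal _
    ⟨r₀, hr₀, by rw [hv₀]; exact hτ⟩
  rcases hr.2.eq_or_lt with h | h
  · refine ⟨(r, false), fun q _ => ?_⟩
    rw [← h]
    simpa [signAt] using isSign_signAtRoot (hok r hr.1).1 q
  · refine ⟨(r, true), fun q hq => isSign_signAt_right (hok r hr.1).1 q h fun x h1 h2 h3 => ?_⟩
    by_contra hc
    push Not at hc
    obtain ⟨r', hr', rfl⟩ := hroot q hq hc x ((hok r hr.1).2.trans_lt h1) h3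
    exact absurd (hmax ⟨hr', h2⟩ h1.le) (not_le.2 h1)

end Output


/-! ### All breakpoints, and the encoded description of the next-generator -/

section Assembly

open Real

/-- The breakpoints of all quadrants, in counterclockwise order. -/
def places (V : List IntPt) (S : List (IntPt × IntPt)) : List (LinVec × QuadRoot) :=
  quadrants.flatMap fun e => (breaks (quads e (cands e V S))).map fun r => (e, r)

theorem mem_places {V : List IntPt} {S : List (IntPt × IntPt)} {p : LinVec × QuadRoot} :
    p ∈ places V S ↔ p.1 ∈ quadrants ∧ p.2 ∈ breaks (quads p.1 (cands p.1 V S)) := by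
  obtain ⟨e, r⟩ := p
  simp only [places, List.mem_flatMap, List.mem_map, Prod.mk.injEq]
  constructor
  · rintro ⟨e', he', r', hr', rfl, rfl⟩
    exact ⟨he', hr'⟩
  · rintro ⟨he, hr⟩
    exact ⟨e, he, r, hr, rfl, rfl⟩

theorem integerOut_eq (V : List IntPt) (S : List (IntPt × IntPt)) :
    integerOut V S = (places V S).map fun p => itemOut p.1 (cands p.1 V S) p.2 := by
  simp [integerOut, places, quadrantOut, List.map_flatMap, Function.comp_def]

theorem placeAngle_bounds {V : List IntPt} {S : List (IntPt × IntPt)} {p : LinVec × QuadRoot}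
    (hp : p ∈ places V S) : quadAngle p.1 ≤ placeAngle p ∧ placeAngle p < quadAngle p.1 + π / 2 := by
  have h := ((breaks_spec _).2.1 p.2 (mem_places.1 hp).2).2
  have h1 := arctan_lt_pi_div_two (rootVal p.2)
  have h2 : 0 ≤ arctan (rootVal p.2) := arctan_nonneg.2 h
  exact ⟨by rw [placeAngle]; linarith, by rw [placeAngle]; linarith⟩

theorem places_pairwise (V : List IntPt) (S : List (IntPt × IntPt)) :
    (places V S).Pairwise fun p p' => placeAngle p < placeAngle p' := by
  rw [places, List.pairwise_flatMap]
  constructor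
  · intro e _
    rw [List.pairwise_map]
    refine (breaks_spec _).1.imp fun h => ?_
    simp only [placeAngle]
    linarith [arctan_strictMono h]
  · have hq : quadrants.Pairwise fun e e' => quadAngle e + π / 2 ≤ quadAngle e' := by
      have := pi_pos
      simp only [quadrants, List.pairwise_cons, List.mem_cons, List.not_mem_nil, or_false,
        forall_eq_or_imp, forall_eq, false_imp_iff, implies_true, List.Pairwise.nil, and_true]
      norm_num [quadAngle]
      refine ⟨⟨?_, ?_⟩, ?_, ?_⟩ <;> linarith
    refine hq.imp_of_mem fun {e e'} he he' hle => ?_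
    intro p hp p' hp'
    obtain ⟨r, hr, rfl⟩ := List.mem_map.1 hp
    obtain ⟨r', hr', rfl⟩ := List.mem_map.1 hp'
    have h1 := (placeAngle_bounds (p := (e, r)) (mem_places.2 ⟨he, hr⟩)).2
    have h2 := (placeAngle_bounds (p := (e', r')) (mem_places.2 ⟨he', hr'⟩)).1
    exact h1.trans_le (hle.trans h2)

/-- The piecewise linear rational function that the algorithm describes. -/
def descriptionOf (V : List IntPt) (S : List (IntPt × IntPt)) {N : ℕ}
    (f : Fin (N + 1) → LinVec × QuadRoot) : PiecewiseLinRat where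
  N := N
  boundary i := rayOf (f i).1 (f i).2
  atPoint i := linRatOf (linOut (f i).1 (choose ((f i).2, false) (f i).1 (cands (f i).1 V S)))
  onArc i := linRatOf (linOut (f i).1 (choose ((f i).2, true) (f i).1 (cands (f i).1 V S)))

theorem toData_descriptionOf {V : List IntPt} {S : List (IntPt × IntPt)} {N : ℕ}
    {f : Fin (N + 1) → LinVec × QuadRoot} (hf : places V S = List.ofFn f) :
    (descriptionOf V S f).toData = Enc.enc (integerOut V S) := by
  rw [integerOut_eq, hf, List.map_ofFn]
  change _ = Data.ofList (List.map _ _)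
  rw [List.map_ofFn, PiecewiseLinRat.toData]
  simp only [descriptionOf, toData_rayOf, toData_linRatOf]
  rfl

theorem bits_descriptionOf {V : List IntPt} {S : List (IntPt × IntPt)} {N : ℕ}
    {f : Fin (N + 1) → LinVec × QuadRoot} (hf : places V S = List.ofFn f) {B : ℕ}
    (hB : esize (integerOut V S) ≤ B) : (descriptionOf V S f).pieces ≤ 2 * B ∧
      ∀ i, ((descriptionOf V S f).atPoint i).BitsAtMost B ∧
        ((descriptionOf V S f).onArc i).BitsAtMost B ∧
        ((descriptionOf V S f).boundary i).bits ≤ B := by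
  constructor
  · have h := length_le_esize (integerOut V S)
    rw [integerOut_eq, List.length_map, hf, List.length_ofFn, ← hf, ← integerOut_eq] at h
    simp only [PiecewiseLinRat.pieces, descriptionOf]
    omega
  · intro i
    have hmem : itemOut (f i).1 (cands (f i).1 V S) (f i).2 ∈ integerOut V S := by
      rw [integerOut_eq, hf]
      exact List.mem_map.2 ⟨f i, (List.mem_ofFn' _ _).2 ⟨i, rfl⟩, rfl⟩
    have h := (esize_mem_le hmem).trans hB
    simp only [itemOut, esize_pair] at h
    refine ⟨(bitsAtMost_linRatOf _).mono ?_, (bitsAtMost_linRatOf _).mono ?_,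
      (bits_rayOf_le _ _).trans ?_⟩ <;> omega

variable {m n : ℕ} {I : SepInstance m n} {emb : Plane → ℝ × ℝ} {V : List IntPt}
  {S : List (IntPt × IntPt)}

/-- If the signs are computed correctly, the chosen linear vector gives the next cut. -/
theorem Describes.choose_eq (H : Describes I (castPts V) (castSegs (bothWays S)) emb) {e : LinVec}
    (he : e ∈ quadrants) {α : ℝ} (h0 : 0 ≤ α) (h1 : α < π / 2) {P : Place}
    (hsign : ∀ q ∈ quads e (cands e V S), IsSign (signAt P q) (quadEval q (tan α))) :
    ∃ r T, 0 < r ∧ IsNextTurn (castPts V) (castSegs (bothWays S)) (quadAngle e + α) T ∧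
      lvEval (choose P e (cands e V S)) (tan α) = scale2 r (dirVec (quadAngle e + α + T)) := by
  have hc : 0 < cos α := cos_pos_of_mem_Ioo ⟨by linarith, h1⟩
  exact isNextTurn_choose H.wide H.finite H.common_cut H.symm (one_div_pos.2 hc)
    (lvEval_tan he hc) hsign

theorem Describes.exists_isNextTurn (H : Describes I (castPts V) (castSegs (bothWays S)) emb)
    (φ : ℝ) : ∃ T, IsNextTurn (castPts V) (castSegs (bothWays S)) φ T := by
  obtain ⟨ω, h0, h1, k, hk⟩ := exists_angle_in_turn φ 0
  obtain ⟨e, he, α, h2, h3, hα⟩ := exists_quadrant h0 (by simpa using h1)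
  obtain ⟨P, hP⟩ := exists_place (quads e (cands e V S))
    (tan_nonneg_of_nonneg_of_le_pi_div_two h2 h3.le)
  obtain ⟨r, T, -, hT, -⟩ := H.choose_eq he h2 h3 hP
  rw [← hα, hk, isNextTurn_add_two_pi] at hT
  exact ⟨T, hT⟩

/-- The signs of all polynomials are constant on the open arc between consecutive breakpoints, so
that the choice made immediately to the right of a breakpoint is valid on the whole arc. -/
theorem Describes.represents (H : Describes I (castPts V) (castSegs (bothWays S)) emb)
    {T : ℝ → ℝ} (hT : ∀ φ, IsNextTurn (castPts V) (castSegs (bothWays S)) φ (T φ)) {N : ℕ}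
    {f : Fin (N + 1) → LinVec × QuadRoot} (hf : places V S = List.ofFn f) :
    (descriptionOf V S f).Represents (nextMap T) := by
  have hmem : ∀ p, p ∈ places V S ↔ ∃ i, f i = p := fun p => by
    rw [hf, List.mem_ofFn']; rfl
  have hquad : ∀ i, (f i).1 ∈ quadrants := fun i => (mem_places.1 ((hmem _).2 ⟨i, rfl⟩)).1
  have hbreak : ∀ i, (f i).2 ∈ breaks (quads (f i).1 (cands (f i).1 V S)) := fun i =>
    (mem_places.1 ((hmem _).2 ⟨i, rfl⟩)).2
  have hok : ∀ i, RootOk (f i).2 ∧ 0 ≤ rootVal (f i).2 := fun i =>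
    (breaks_spec _).2.1 _ (hbreak i)
  have hray : ∀ i, rayPoint (rayOf (f i).1 (f i).2).val
      = Circle.exp (placeAngle (f i)) := fun i => (rayOf_spec (hquad i) (hok i).1).2
  have hmono : StrictMono fun i => placeAngle (f i) := by
    have := places_pairwise V S
    rw [hf, List.pairwise_ofFn] at this
    exact fun i j hij => this hij
  have hbounds : ∀ i, 0 ≤ placeAngle (f i) ∧ placeAngle (f i) < 2 * π := by
    intro i
    obtain ⟨h1, h2⟩ := placeAngle_bounds ((hmem _).2 ⟨i, rfl⟩)
    have h3 := quadAngle_nonneg (f i).1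
    have h4 := quadAngle_le (f i).1
    exact ⟨by linarith, by linarith⟩
  -- the first vector of a quadrant is a breakpoint
  have hstart : ∀ e ∈ quadrants, ∃ j, placeAngle (f j) = quadAngle e := by
    intro e he
    obtain ⟨r, hr, hr0⟩ := (breaks_spec (quads e (cands e V S))).2.2.1
    obtain ⟨j, hj⟩ := (hmem (e, r)).1 (mem_places.2 ⟨he, hr⟩)
    exact ⟨j, by rw [hj, placeAngle, hr0, arctan_zero, add_zero]⟩
  have hzero : placeAngle (f 0) = 0 := by
    obtain ⟨j, hj⟩ := hstart ((1, 0), (0, 1)) (by simp [quadrants])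
    have h1 : placeAngle (f 0) ≤ placeAngle (f j) := hmono.monotone (Fin.zero_le j)
    rw [hj] at h1
    simp only [quadAngle, if_true] at h1
    exact le_antisymm h1 (hbounds 0).1
  -- the end of the arc that begins at a breakpoint, as an angle of at most a full turn
  have hend : ∀ i, ∃ U, placeAngle (f i) < U ∧ U ≤ 2 * π ∧
      Circle.exp (placeAngle (f (i + 1))) = Circle.exp U ∧
      ∀ j, placeAngle (f i) < placeAngle (f j) → U ≤ placeAngle (f j) := by
    intro i
    rcases eq_or_ne i (Fin.last N) with rfl | hi
    · refine ⟨2 * π, (hbounds _).2, le_rfl, ?_, fun j hj => ?_⟩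
      · rw [Fin.last_add_one, hzero, Circle.exp_two_pi, Circle.exp_zero]
      · exact absurd (hmono.lt_iff_lt.1 hj) (not_lt.2 (Fin.le_last j))
    · have hlt : i < i + 1 := Fin.lt_add_one_iff.2 (lt_of_le_of_ne (Fin.le_last i) hi)
      refine ⟨_, hmono hlt, (hbounds _).2.le, rfl, fun j hj => hmono.monotone ?_⟩
      exact Fin.add_one_le_of_lt (hmono.lt_iff_lt.1 hj)
  refine ⟨⟨fun i => (rayOf_spec (hquad i) (hok i).1).1,
    fun (i j : Fin (N + 1)) hij => ?_⟩, fun (i : Fin (N + 1)) x hx => ⟨?_, ?_⟩⟩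
  · simp only [descriptionOf, hray]
    have hccw : ∀ i, ccwAngle 1 (Circle.exp (placeAngle (f i))) = placeAngle (f i) := by
      intro i
      have := ccwAngle_exp 0 (hbounds i).1 (hbounds i).2
      rwa [Circle.exp_zero, zero_add] at this
    rw [hccw, hccw]
    exact hmono hij
  · intro hxi
    simp only [descriptionOf, hray] at hxi
    have h0 : 0 ≤ arctan (rootVal (f i).2) := arctan_nonneg.2 (hok i).2
    have h1 := arctan_lt_pi_div_two (rootVal (f i).2)
    obtain ⟨r, T', hr, hT', hy⟩ := H.choose_eq (hquad i) h0 h1 (P := ((f i).2, false))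
      (fun q _ => by
        rw [tan_arctan]
        simpa [signAt] using isSign_signAtRoot (hok i).1 q)
    exact agreesAt_linOut (hquad i) h0 h1 hx hxi hr hy (nextMap_exp hT hT')
  · intro hxi'
    have hxi : rayPoint x ∈ openArc (rayPoint (rayOf (f i).1 (f i).2).val)
      (rayPoint (rayOf (f (i + 1)).1 (f (i + 1)).2).val) := hxi'
    obtain ⟨U, hU, hU2, hexp, hnext⟩ := hend i
    set κ := placeAngle (f i) with hκ
    rw [hray, hray, hexp, ← hκ] at hxi
    obtain ⟨δ, hδ0, hδ1, hxδ⟩ := exists_exp_add_ccwAngle κ (rayPoint x)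
    have hκ0 := (hbounds i).1
    rw [hxδ, openArc, Set.mem_ofPred_eq, ccwAngle_exp κ hδ0 hδ1,
      show U = κ + (U - κ) by ring, turn_exp κ (by linarith) (by linarith)] at hxi
    obtain ⟨hδ, hδU⟩ := hxi
    -- no quadrant begins inside of the arc
    have hUq : U ≤ quadAngle (f i).1 + π / 2 := by
      have h1 := (placeAngle_bounds ((hmem _).2 ⟨i, rfl⟩)).2
      rcases exists_next_quadrant (hquad i) with h | ⟨e', he', h⟩
      · rw [h]; exact hU2
      · obtain ⟨j, hj⟩ := hstart e' he'
        rw [← h, ← hj]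
        exact hnext j (by rw [hj, h]; exact h1)
    set α := arctan (rootVal (f i).2) + δ with hα
    have hκα : κ + δ = quadAngle (f i).1 + α := by rw [hκ, placeAngle, hα]; ring
    have h0 : 0 ≤ arctan (rootVal (f i).2) := arctan_nonneg.2 (hok i).2
    have hα0 : 0 ≤ α := by linarith
    have hα1 : α < π / 2 := by linarith
    have hatan : arctan (tan α) = α := arctan_tan (by linarith) hα1
    have hτ : rootVal (f i).2 < tan α := by
      rw [← arctan_strictMono.lt_iff_lt, hatan]
      linarith
    rw [hκα] at hxδ
    obtain ⟨r, T', hr, hT', hy⟩ := H.choose_eq (hquad i) hα0 hα1 (P := ((f i).2, true)) (by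
      intro q hq
      refine isSign_signAt_right (hok i).1 q hτ fun y hy1 hy2 hy3 => ?_
      -- a root in between would be a breakpoint inside of the arc
      by_contra hc
      push Not at hc
      obtain ⟨r', hr', rfl⟩ := (breaks_spec _).2.2.2 q hq hc y ((hok i).2.trans_lt hy1) hy3
      obtain ⟨j, hj⟩ := (hmem ((f i).1, r')).1 (mem_places.2 ⟨hquad i, hr'⟩)
      have g1 := arctan_strictMono hy1
      have g2 := arctan_strictMono.monotone hy2
      rw [hatan] at g2
      have := hnext j (by rw [hj, hκ, placeAngle, placeAngle]; simp only; linarith)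
      rw [hj, placeAngle] at this
      simp only at this
      linarith)
    exact agreesAt_linOut (hquad i) hα0 hα1 hx hxδ hr hy (nextMap_exp hT hT')

theorem exists_places_eq_ofFn (V : List IntPt) (S : List (IntPt × IntPt)) :
    ∃ (N : ℕ) (f : Fin (N + 1) → LinVec × QuadRoot), places V S = List.ofFn f := by
  obtain ⟨r, hr, -⟩ :=
    (breaks_spec (quads ((1, 0), (0, 1)) (cands ((1, 0), (0, 1)) V S))).2.2.1
  have hne : (((1, 0), (0, 1)), r) ∈ places V S := mem_places.2 ⟨by simp [quadrants], hr⟩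
  obtain ⟨p, l, h⟩ := List.exists_cons_of_ne_nil (List.ne_nil_of_mem hne)
  exact ⟨l.length, (p :: l).get, by rw [h]; exact (List.ofFn_get (p :: l)).symm⟩

end Assembly

theorem mainTheorem6 :
    ∃ (c : Prog) (p : Polynomial ℕ), ∀ (m n b : ℕ) (I : SepInstance m n),
      I.Valid → I.BitsAtMost b →
      ∃ (G : PiecewiseLinRat) (g : Circle → Circle) (k : ℕ),
        -- the reduction takes polynomial time
        c.OutputsWithin I.toData G.toData (p.eval (m + n + b)) ∧
        -- the next-generator is piecewise linear rational, of polynomial size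
        G.Represents g ∧
        G.pieces ≤ p.eval (m + n + b) ∧
        (∀ i, (G.atPoint i).BitsAtMost (p.eval (m + n + b)) ∧
          (G.onArc i).BitsAtMost (p.eval (m + n + b)) ∧
          (G.boundary i).bits ≤ p.eval (m + n + b)) ∧
        IsNextGenerator I.sweepArcs g ∧
        -- the two problems have the same optimum, and solutions give solutions
        IsArcCoverOptimum g k ∧ I.IsMinCuts k ∧
        (∀ (j : ℕ) (x : Circle), OrbitCovers g j x →
          I.Separates (⋂ i ∈ Finset.range j, I.keep (g^[i] x))) ∧
        (I.Surrounded → I.IsMinVertices k) := by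
  classical
  obtain ⟨c, p, hc, hp⟩ := PT.algorithm
  -- a bound on the size of the input, see `esize_inputOf_le`
  let q : Polynomial ℕ := 3 + Polynomial.X * (8 * Polynomial.X + 16)
  have hq : ∀ s : ℕ, q.eval s = 3 + s * (8 * s + 16) := fun s => by simp [q]
  -- the factor 2 accounts for the two pieces, a point and an open arc, at every breakpoint
  refine ⟨c 0, 2 * p.comp q, fun m n b I hI hb => ?_⟩
  have hsize : p.eval (esize (inputOf I)) ≤ (p.comp q).eval (m + n + b) := by
    rw [Polynomial.eval_comp, hq]
    exact p.eval_nat_mono (esize_inputOf_le hb)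
  have htwo : (2 * p.comp q).eval (m + n + b) = 2 * (p.comp q).eval (m + n + b) := by simp
  obtain ⟨emb, H⟩ := describes_cleared hI
  -- the algorithm works with the instance scaled by a common denominator
  set V := clearVertices (commonDenom (inputOf I).1 (inputOf I).2) (inputOf I).1 with hV
  set S := clearSegs (commonDenom (inputOf I).1 (inputOf I).2) (inputOf I).2 with hS
  have hout : algorithm (inputOf I) = integerOut V S := rfl
  choose T hT using H.exists_isNextTurn
  obtain ⟨N, f, hf⟩ := exists_places_eq_ofFn V S
  have hne := interior_inner_nonempty hI
  obtain ⟨hpieces, hbits⟩ := bits_descriptionOf hf ((hout ▸ hp (inputOf I)).trans hsize)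
  -- the two problems have the same feasible numbers
  have hiff : ∀ k, (∃ x, OrbitCovers (nextMap T) k x) ↔ CutsSuffice I k := fun k =>
    ⟨fun ⟨_, hx⟩ => H.cutsSuffice_of_orbitCovers (hne.mono interior_subset) hT hx,
      H.orbitCovers_of_cutsSuffice hT (outer_nonempty hI)⟩
  have hex : ∃ k, ∃ x, OrbitCovers (nextMap T) k x := by
    obtain ⟨u, hu⟩ := exists_cuts hI
    exact ⟨n, H.orbitCovers_of_cuts hT u (outer_nonempty hI) hu⟩
  have hleast : IsArcCoverOptimum (nextMap T) (Nat.find hex) :=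
    ⟨Nat.find_spec hex, fun k hk => Nat.find_min' hex hk⟩
  refine ⟨descriptionOf V S f, nextMap T, Nat.find hex, ?_, H.represents hT hf, ?_, ?_,
    H.isNextGenerator hT, hleast, ?_, fun j x hx => H.separates_iInter_keep hT hx,
    H.isMinVertices hT hne (outer_nonempty hI) hleast⟩
  · obtain ⟨τ, t, hrun, hτ, -, ht⟩ := hc 0
      (Function.update (fun _ => Data.int 0) 0 I.toData) (inputOf I) (by simp [enc_inputOf])
    refine ⟨τ, t, hrun, ?_, ?_⟩
    · rw [hτ, hout, toData_descriptionOf hf]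
    · rw [htwo]
      omega
  · rw [htwo]; exact hpieces
  · intro i
    obtain ⟨h1, h2, h3⟩ := hbits i
    rw [htwo]
    exact ⟨h1.mono (by omega), h2.mono (by omega), by omega⟩
  · exact ⟨(hiff _).1 hleast.1, fun k hk => hleast.2 ((hiff k).2 hk)⟩
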